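/- Let $K$ be a field of characteristic $0$ and $I$ a finite non-empty set. **Systems.** Let $\mathcal{H}_I$ be the Connes–Kreimer Hopf algebra of rooted trees decorated by $I$: the polynomial algebra over $K$ generated by these trees, graded by the number of vertices, with the coproduct given by admissible cuts, i.e. $\Delta\circ B_i^+=B_i^+\otimes 1+(Id\otimes B_i^+)\circ\Delta$ for all $i\in I$, where $B_i^+$ grafts the trees of a forest on a common root decorated by $i$. An SDSE $(S)$ is a system $X_i=B_i^+(F_i(X_j,\,j\in I))$, $i\in I$, where the $F_i\in K[[h_j,\,j\in I]]$ are non-constant. It has a unique solution $(X_i)_{i\in I}$ in the completion of $\mathcal{H}_I$; let $X_i(n)$ be the homogeneous component of degree $n$ of $X_i$, and let $\mathcal{H}_{(S)}$ be the subalgebra of $\mathcal{H}_I$ generated by the $X_i(n)$, $i \in I$, $n\geq 1$. The system is *Hopf* if $\mathcal{H}_{(S)}$ is a Hopf subalgebra. Then $\mathfrak{g}_{(S)}$ denotes the Lie algebra $Prim(\mathcal{H}_{(S)}^*)$ of the primitive elements of the graded dual of $\mathcal{H}_{(S)}$. The system is *connected* if the graph on $I$ with an edge from $i$ to $j$ whenever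 $\partial F_i/\partial h_j\neq 0$ is connected. **Fundamental systems.** For $a,\beta\in K$ put $$\Phi_{a,\beta}(h)=\sum_{k\geq 0}\frac{a(a+\beta)\cdots(a+(k-1)\beta)}{k!}h^k,\qquad L_\beta(h)=\sum_{k\geq 1}\frac{\beta^{k-1}}{k}h^k,$$ so that $L_\beta(h)=-\frac{1}{\beta}\ln(1-\beta h)$ if $\beta\neq 0$ and $L_0(h)=h$. Consider a finite set $V=I_0\sqcup J_0\sqcup K_0\sqcup I_1\sqcup J_1$ with $I_0\cup J_0\neq\emptyset$, and scalars $\beta_i$ ($i\in I_0$), $\nu_i$ ($i\in I_1\cup J_1$), $a^{(i)}_j$. A *basic fundamental system* on $V$ is given by: * for $i\in I_0$: $F_i=\Phi_{1,\beta_i}(h_i)\prod_{j\in I_0\setminus\{i\}}\Phi_{1+\beta_j,\beta_j}(h_j)\prod_{j\in J_0}(1-h_j)^{-1}$; * for $i\in J_0$: $F_i=\prod_{j\in I_0}\Phi_{1+\beta_j,\beta_j}(h_j)\prod_{j\in J_0\setminus\{i\}}(1-h_j)^{-1}$; * for $i\in K_0$: $F_i=\prod_{j\in I_0}\Phi_{1+\beta_j,\beta_j}(h_j)\prod_{j\in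 J_0}(1-h_j)^{-1}$; * for $i\in I_1$, with $\nu_i\neq 1$, or $a_j^{(i)}\neq 1+\beta_j$ for some $j\in I_0$, or $a_j^{(i)}\neq 1$ for some $j\in J_0$, or $a_j^{(i)}\neq 0$ for some $j\in K_0$: if $\nu_i\neq 0$, $$F_i=\frac{1}{\nu_i}\prod_{j\in I_0}\Phi_{\nu_ia^{(i)}_j,\beta_j}(h_j)\prod_{j\in J_0}\Phi_{\nu_ia^{(i)}_j,1}(h_j)\prod_{j\in K_0}\Phi_{\nu_ia^{(i)}_j,0}(h_j)+1-\frac{1}{\nu_i},$$ and if $\nu_i=0$, $$F_i=\sum_{j\in I_0}a_j^{(i)}L_{\beta_j}(h_j)+\sum_{j\in J_0}a_j^{(i)}L_1(h_j)+\sum_{j\in K_0}a_j^{(i)}h_j+1;$$ * for $i\in J_1$: $\nu_i\neq 0$; the set $I_1^{(i)}=\{j\in I_1 : a_j^{(i)}\neq 0\}$ is non-empty; $\nu_j=1$ for all $j\in I_1^{(i)}$; the $F_j$, $j\in I_1^{(i)}$, are all equal, and $b^{(i)}_t=a^{(j)}_t$ for $j\in I_1^{(i)}$ and $t\in I_0\cup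 J_0\cup K_0$; then $$F_i=\frac{1}{\nu_i}\prod_{j\in I_0}\Phi_{b_j^{(i)}-1-\beta_j,\beta_j}(h_j)\prod_{j\in J_0}\Phi_{b_j^{(i)}-1,1}(h_j)\prod_{j\in K_0}\Phi_{b_j^{(i)},0}(h_j)+\sum_{j\in I_1^{(i)}}a_j^{(i)}h_j+1-\frac{1}{\nu_i}.$$ A Hopf SDSE with set of vertices $I$ is *fundamental* if there are a basic fundamental system $(F_v)_{v \in V}$, a surjection $\pi:I\to V$ and non-zero scalars $\kappa_x,\mu_x$ ($x\in I$) such that the system is given by the series $\mu_x F_{\pi(x)}\big(\sum_{\pi(y)=v}\kappa_y h_y,\ v\in V\big)$, $x\in I$ (a dilatation followed by a change of variables). For a Hopf SDSE there are scalars $\lambda_n^{(i,j)}$, $n\geq 1$, with $(f_{\bullet_j}\otimes Id)\circ\Delta(X_i(n+1))=\lambda_n^{(i,j)}X_i(n)$, where $f_{\bullet_j}$ is the linear form giving the coefficient of the tree with a single vertex, decorated by $j$. For a fundamental SDSE there are scalars $b_j$, $j\in I$, such that for all $i,j$, for $n$ large enough, $\lambda_n^{(i,j)}=b_j(n-1)+\tilde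 a_j^{(i)}$ for some scalar $\tilde a_j^{(i)}$. It is *abelian* if $b_j=0$ for all $j$. **Lie algebras and modules.** The Faà di Bruno Lie algebra $\mathfrak{g}_{FdB}$ has a basis $(e(k))_{k\geq 1}$, with $[e(k),e(l)]=(l-k)e(k+l)$. The $\mathfrak{g}_{FdB}$-module $V_0$ has a basis $(f(k))_{k\geq 1}$, with $e(k).f(l)=l f(k+l)$. For $M\geq 0$, $V_0^M\triangleleft\mathfrak{g}_{FdB}$ is the semi-direct product, where $V_0^M$, with basis $(f^{(i)}(k))_{1\leq i\leq M,\,k\geq 1}$, is an abelian ideal. For $c\in K$ and $\upsilon\in K^M$, the module $W_{c,\upsilon}$ over it has a basis $(g(k))_{k\geq 1}$, with $e(k).g(l)=(l+c)g(k+l)$ and $f^{(i)}(k).g(l)=\upsilon_i g(k+l)$. Given $N\geq 0$, $c_j\in K$ and $\upsilon^{(j)}\in K^M$ for $1\leq j\leq N$, let $$\mathfrak{g}=\left(W_{c_1,\upsilon^{(1)}}\oplus\cdots\oplus W_{c_N,\upsilon^{(N)}}\right)\triangleleft\left(V_0^M\triangleleft\mathfrak{g}_{FdB}\right),$$ with basis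 $g^{(j)}(k)$, $f^{(i)}(k)$, $e(k)$. The following $\mathfrak{g}$-modules have a basis $(h(k))_{k\geq 1}$: * $W'_{\nu,0}$, $\nu\in K^M$: $e(k).h(l)=(l-1)h(k+l)$, $f^{(i)}(k).h(1)=\nu_ih(k+1)$, $f^{(i)}(k).h(l)=0$ if $l\geq 2$, $g^{(j)}(k).h(l)=0$; * $W'_{\nu,1}$, $\nu\in K^M$: $e(k).h(1)=h(k+1)$, $e(k).h(l)=(l-1)h(k+l)$ if $l\geq 2$, $f^{(i)}(k).h(1)=\nu_ih(k+1)$, $f^{(i)}(k).h(l)=0$ if $l\geq 2$, $g^{(j)}(k).h(l)=0$; * $W''_{c,\nu,\mu}$, $c\in K$, $\nu\in K^M$, $\mu\in K^N$, such that $c=c_j-1$ and $\nu=\upsilon^{(j)}$ for all $j$ with $\mu_j\neq 0$ (this is the condition for the formulas to define a module): $e(k).h(l)=(l+c)h(k+l)$, $f^{(i)}(k).h(l)=\nu_ih(k+l)$, $g^{(j)}(k).h(1)=\mu_jh(k+1)$, $g^{(j)}(k).h(l)=0$ if $l\geq 2$. **Theorem.** Let $(S)$ be a connected, fundamental, non-abelian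 Hopf SDSE. There exist $M,N\geq 0$, scalars $c_1,\ldots,c_N\in K$, vectors $\upsilon^{(1)},\ldots,\upsilon^{(N)}\in K^M$, and a finite (possibly empty) direct sum $W$ of modules of the form $W'_{\nu,0}$, $W'_{\nu,1}$, $W''_{c,\nu,\mu}$ over $\left(\bigoplus_{j=1}^N W_{c_j,\upsilon^{(j)}}\right)\triangleleft\left(V_0^M\triangleleft\mathfrak{g}_{FdB}\right)$, such that, as Lie algebras, $$\mathfrak{g}_{(S)}\approx W\triangleleft\left(\left(W_{c_1,\upsilon^{(1)}}\oplus\cdots\oplus W_{c_N,\upsilon^{(N)}}\right)\triangleleft\left(V_0^M\triangleleft\mathfrak{g}_{FdB}\right)\right).$$ -/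

import Mathlib

open scoped TensorProduct

namespace DysonSchwinger

universe u v

/-! ## Decorated rooted trees and the Connes-Kreimer Hopf algebra -/

section Trees

/-- Plane rooted trees whose vertices are decorated by `D`. -/
inductive PlaneTree (D : Type v) : Type v
  | node : D → List (PlaneTree D) → PlaneTree D

/-- Elementary moves between plane trees with the same underlying rooted tree: permute the
children of a vertex. -/
inductive PlaneTree.Step {D : Type v} : PlaneTree D → PlaneTree D → Prop
  | perm (d : D) {l l' : List (PlaneTree D)} (h : l.Perm l') :
      PlaneTree.Step (PlaneTree.node d l) (PlaneTree.node d l')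
  | child (d : D) (l₁ l₂ : List (PlaneTree D)) {t t' : PlaneTree D} (h : PlaneTree.Step t t') :
      PlaneTree.Step (PlaneTree.node d (l₁ ++ t :: l₂)) (PlaneTree.node d (l₁ ++ t' :: l₂))

/-- (Non-plane) rooted trees decorated by `D`. -/
def RTree (D : Type v) : Type v := Quot (PlaneTree.Step (D := D))

variable {D : Type v}

/-- The rooted tree underlying a plane rooted tree. -/
def RTree.mk (t : PlaneTree D) : RTree D := Quot.mk _ t

/-- A plane representative of a rooted tree. -/
noncomputable def RTree.out (t : RTree D) : PlaneTree D := Quot.out t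

theorem RTree.mk_out (t : RTree D) : RTree.mk t.out = t := Quot.out_eq t

/-- The rooted tree with root decorated by `d`, to which the trees of the multiset `s`
are grafted. -/
noncomputable def RTree.node (d : D) (s : Multiset (RTree D)) : RTree D :=
  RTree.mk (PlaneTree.node d (s.toList.map RTree.out))

mutual
/-- Number of vertices of a plane tree. -/
def PlaneTree.weight : PlaneTree D → ℕ
  | PlaneTree.node _ l => PlaneTree.weightList l + 1
/-- Number of vertices of a list of plane trees. -/
def PlaneTree.weightList : List (PlaneTree D) → ℕ
  | [] => 0
  | t :: l => PlaneTree.weight t + PlaneTree.weightList l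
end

theorem PlaneTree.weightList_eq (l : List (PlaneTree D)) :
    PlaneTree.weightList l = (l.map PlaneTree.weight).sum := by
  induction l with
  | nil => simp [PlaneTree.weightList]
  | cons t l ih => simp [PlaneTree.weightList, ih]

theorem PlaneTree.Step.weight_eq {t t' : PlaneTree D} (h : PlaneTree.Step t t') :
    t.weight = t'.weight := by
  induction h with
  | perm d h => simp [PlaneTree.weight, PlaneTree.weightList_eq, (h.map PlaneTree.weight).sum_eq]
  | child d l₁ l₂ h ih => simp [PlaneTree.weight, PlaneTree.weightList_eq, ih]

/-- Number of vertices of a rooted tree. -/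
def RTree.weight (t : RTree D) : ℕ :=
  Quot.lift PlaneTree.weight (fun _ _ h => h.weight_eq) t

theorem RTree.mk_node_congr (d : D) {l l' : List (PlaneTree D)}
    (h : l.map RTree.mk = l'.map RTree.mk) :
    RTree.mk (PlaneTree.node d l) = RTree.mk (PlaneTree.node d l') := by
  suffices H : ∀ (l l' : List (PlaneTree D)), l.map RTree.mk = l'.map RTree.mk →
      ∀ p : List (PlaneTree D),
        RTree.mk (PlaneTree.node d (p ++ l)) = RTree.mk (PlaneTree.node d (p ++ l')) by
    simpa using H l l' h []
  intro l
  induction l with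
  | nil =>
    intro l' h p
    have : l' = [] := by simpa using h.symm
    rw [this]
  | cons t l ih =>
    intro l' h p
    cases l' with
    | nil => simp at h
    | cons t' l' =>
      simp only [List.map_cons, List.cons.injEq] at h
      obtain ⟨h1, h2⟩ := h
      have e1 : RTree.mk (PlaneTree.node d (p ++ t :: l))
          = RTree.mk (PlaneTree.node d (p ++ t' :: l)) := by
        have h1' := Quot.eqvGen_exact h1
        induction h1' with
        | rel x y hxy => exact Quot.sound (PlaneTree.Step.child d p l hxy)
        | refl x => rfl
        | symm x y _ ih => exact (ih (Quot.eqvGen_sound (by assumption)).symm.symm).symm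
        | trans x y z hxy hyz ih1 ih2 =>
          exact (ih1 (Quot.eqvGen_sound hxy)).trans (ih2 (Quot.eqvGen_sound hyz))
      rw [e1]
      simpa using ih l' h2 (p ++ [t'])

theorem RTree.mk_node (d : D) (l : List (PlaneTree D)) :
    RTree.mk (PlaneTree.node d l) = RTree.node d (l.map RTree.mk : List (RTree D)) := by
  unfold RTree.node
  set l' : List (PlaneTree D) :=
    ((l.map RTree.mk : List (RTree D)) : Multiset (RTree D)).toList.map RTree.out with hl'
  have hp : (l'.map RTree.mk).Perm (l.map RTree.mk) := by
    have : l'.map RTree.mk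
        = ((l.map RTree.mk : List (RTree D)) : Multiset (RTree D)).toList := by
      rw [hl', List.map_map]
      conv_rhs => rw [← List.map_id (Multiset.toList _)]
      exact List.map_congr_left fun t _ => RTree.mk_out t
    rw [this, ← Multiset.coe_eq_coe]
    simp
  obtain ⟨m, hm1, hm2⟩ : ∃ m : List (PlaneTree D), m.Perm l ∧ l'.map RTree.mk = m.map RTree.mk := by
    have h := congrFun (congrFun (List.eq_map_comp_perm RTree.mk) (l'.map RTree.mk)) l
    rw [← h] at hp
    obtain ⟨m, hm1, hm2⟩ := hp
    exact ⟨m, hm2, hm1⟩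
  calc RTree.mk (PlaneTree.node d l) = RTree.mk (PlaneTree.node d m) :=
        (Quot.sound (PlaneTree.Step.perm d hm1)).symm
    _ = _ := (RTree.mk_node_congr d hm2).symm

theorem RTree.exists_eq_node (t : RTree D) : ∃ (d : D) (s : Multiset (RTree D)), t = RTree.node d s := by
  induction t using Quot.ind with
  | mk t => cases t with
    | node d l => exact ⟨d, _, RTree.mk_node d l⟩

theorem RTree.weight_node (d : D) (s : Multiset (RTree D)) :
    (RTree.node d s).weight = (s.map RTree.weight).sum + 1 := by
  have h : ∀ t : RTree D, PlaneTree.weight t.out = t.weight := by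
    intro t
    conv_rhs => rw [← RTree.mk_out t]
    rfl
  have : (RTree.node d s).weight = PlaneTree.weight (PlaneTree.node d (s.toList.map RTree.out)) := rfl
  rw [this, PlaneTree.weight, PlaneTree.weightList_eq, List.map_map]
  conv_rhs => rw [← Multiset.coe_toList s]
  rw [Multiset.map_coe, Multiset.sum_coe]
  congr 2
  exact List.map_congr_left fun t _ => h t

end Trees

section HopfAlgebra

variable (K : Type u) [Field K] (D : Type v)

/-- The algebra of rooted trees decorated by `D`: the polynomial algebra generated by
the decorated rooted trees. -/
abbrev TreeAlg : Type (max u v) := MvPolynomial (RTree D) K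

variable {D}

/-- The grafting operator `B⁺_d`: it sends a forest to the tree obtained by grafting all the
trees of the forest on a common root decorated by `d`. -/
noncomputable def graft (d : D) : TreeAlg K D →ₗ[K] TreeAlg K D :=
  (MvPolynomial.basisMonomials (RTree D) K).constr K
    fun s => MvPolynomial.X (RTree.node d (Finsupp.toMultiset s))

mutual
/-- The coproduct of a plane tree: `Δ(B⁺_d(F)) = B⁺_d(F) ⊗ 1 + (Id ⊗ B⁺_d)(Δ(F))`. -/
noncomputable def PlaneTree.comul : PlaneTree D → TreeAlg K D ⊗[K] TreeAlg K D
  | PlaneTree.node d l =>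
      (MvPolynomial.X (RTree.mk (PlaneTree.node d l)) : TreeAlg K D) ⊗ₜ[K] (1 : TreeAlg K D) +
        LinearMap.lTensor (TreeAlg K D) (graft K d) (PlaneTree.comulList l)
/-- The coproduct of a list of plane trees: the product of their coproducts. -/
noncomputable def PlaneTree.comulList : List (PlaneTree D) → TreeAlg K D ⊗[K] TreeAlg K D
  | [] => 1
  | t :: l => PlaneTree.comul t * PlaneTree.comulList l
end

theorem PlaneTree.comulList_eq (l : List (PlaneTree D)) :
    PlaneTree.comulList K l = (l.map (PlaneTree.comul K)).prod := by
  induction l with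
  | nil => simp [PlaneTree.comulList]
  | cons t l ih => simp [PlaneTree.comulList, ih]

theorem PlaneTree.Step.mk_eq {t t' : PlaneTree D} (h : PlaneTree.Step t t') :
    RTree.mk t = RTree.mk t' := Quot.sound h

theorem PlaneTree.Step.comul_eq {t t' : PlaneTree D} (h : PlaneTree.Step t t') :
    t.comul K = t'.comul K := by
  induction h with
  | perm d h =>
    simp only [PlaneTree.comul, PlaneTree.comulList_eq,
      (h.map (PlaneTree.comul K)).prod_eq, (PlaneTree.Step.perm d h).mk_eq]
  | child d l₁ l₂ h ih =>
    simp only [PlaneTree.comul, PlaneTree.comulList_eq, (PlaneTree.Step.child d l₁ l₂ h).mk_eq,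
      List.map_append, List.map_cons, ih]

/-- The coproduct of a rooted tree. -/
noncomputable def RTree.comul (t : RTree D) : TreeAlg K D ⊗[K] TreeAlg K D :=
  Quot.lift (PlaneTree.comul K) (fun _ _ h => h.comul_eq K) t

theorem RTree.comul_node (d : D) (s : Multiset (RTree D)) :
    (RTree.node d s).comul K =
      (MvPolynomial.X (RTree.node d s) : TreeAlg K D) ⊗ₜ[K] (1 : TreeAlg K D) +
        LinearMap.lTensor (TreeAlg K D) (graft K d) (s.map (RTree.comul K)).prod := by
  have h : ∀ t : RTree D, PlaneTree.comul K t.out = t.comul K := by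
    intro t
    conv_rhs => rw [← RTree.mk_out t]
    rfl
  have : (RTree.node d s).comul K
      = PlaneTree.comul K (PlaneTree.node d (s.toList.map RTree.out)) := rfl
  rw [this, PlaneTree.comul, PlaneTree.comulList_eq, List.map_map]
  congr 2
  conv_rhs => rw [← Multiset.coe_toList s]
  rw [Multiset.map_coe, Multiset.prod_coe]
  congr 1
  exact List.map_congr_left fun t _ => h t

variable (D)

/-- The coproduct of the algebra of decorated rooted trees. -/
noncomputable def comulHom : TreeAlg K D →ₐ[K] TreeAlg K D ⊗[K] TreeAlg K D :=
  MvPolynomial.aeval (RTree.comul K)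

/-- The counit of the algebra of decorated rooted trees. -/
noncomputable def counitHom : TreeAlg K D →ₐ[K] K :=
  MvPolynomial.aeval fun _ => 0

/-- The homogeneous elements of degree `n`: combinations of forests with `n` vertices. -/
noncomputable def homog (n : ℕ) : Submodule K (TreeAlg K D) :=
  MvPolynomial.weightedHomogeneousSubmodule K RTree.weight n

variable {D}

theorem graft_monomial (d : D) (s : RTree D →₀ ℕ) :
    graft K d (MvPolynomial.monomial s 1) = MvPolynomial.X (RTree.node d s.toMultiset) := by
  have := (MvPolynomial.basisMonomials (RTree D) K).constr_basis K
    (fun s => (MvPolynomial.X (RTree.node d (Finsupp.toMultiset s)) : TreeAlg K D)) s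
  simpa [graft] using this

theorem treeAlg_induction {p : TreeAlg K D → Prop} (hm : ∀ s : RTree D →₀ ℕ, p (MvPolynomial.monomial s 1))
    (ha : ∀ x y, p x → p y → p (x + y)) (hs : ∀ (c : K) x, p x → p (c • x)) (x : TreeAlg K D) : p x := by
  induction x using MvPolynomial.induction_on' with
  | monomial u a =>
    have := hs a _ (hm u)
    rwa [MvPolynomial.smul_monomial, smul_eq_mul, mul_one] at this
  | add p q hp hq => exact ha _ _ hp hq

theorem monomial_eq_prod (s : RTree D →₀ ℕ) :
    (MvPolynomial.monomial s 1 : TreeAlg K D) = (s.toMultiset.map MvPolynomial.X).prod := by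
  rw [MvPolynomial.monomial_eq, Finsupp.toMultiset_map, Finsupp.prod_toMultiset]
  simp [Finsupp.prod_mapDomain_index, pow_add]

/-- Grafting is a `1`-cocycle. -/
theorem comulHom_graft (d : D) (x : TreeAlg K D) :
    comulHom K D (graft K d x) = graft K d x ⊗ₜ[K] (1 : TreeAlg K D) +
      LinearMap.lTensor (TreeAlg K D) (graft K d) (comulHom K D x) := by
  induction x using treeAlg_induction with
  | hm s =>
    have h2 : comulHom K D (MvPolynomial.monomial s 1)
        = (s.toMultiset.map (RTree.comul K)).prod := by
      rw [monomial_eq_prod, map_multiset_prod, Multiset.map_map]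
      congr 1
      exact Multiset.map_congr rfl fun t _ => by simp [comulHom]
    rw [graft_monomial, h2, ← RTree.comul_node]
    simp [comulHom]
  | ha x y hx hy => simp only [map_add, hx, hy, TensorProduct.add_tmul]; abel
  | hs c x hx => simp only [map_smul, hx, smul_add, TensorProduct.smul_tmul']

/-- A subalgebra stable under all the grafting operators is everything. -/
theorem eq_top_of_graft (A : Subalgebra K (TreeAlg K D))
    (h : ∀ d, ∀ x ∈ A, graft K d x ∈ A) : A = ⊤ := by
  have key : ∀ n (t : RTree D), t.weight ≤ n → (MvPolynomial.X t : TreeAlg K D) ∈ A := by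
    intro n
    induction n with
    | zero =>
      intro t ht
      obtain ⟨d, s, rfl⟩ := t.exists_eq_node
      simp [RTree.weight_node] at ht
    | succ n ih =>
      intro t ht
      obtain ⟨d, s, rfl⟩ := t.exists_eq_node
      rw [RTree.weight_node] at ht
      have hs : (s.map (MvPolynomial.X (R := K))).prod ∈ A := by
        refine Subalgebra.multiset_prod_mem _ ?_
        intro y hy
        obtain ⟨t, hts, rfl⟩ := Multiset.mem_map.1 hy
        refine ih t ?_
        have := Multiset.single_le_sum (fun _ _ => Nat.zero_le _) _ (Multiset.mem_map_of_mem RTree.weight hts)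
        omega
      have := h d _ hs
      classical
      rw [show s = Finsupp.toMultiset (Multiset.toFinsupp s) by simp, ← monomial_eq_prod, graft_monomial] at this
      simpa using this
  rw [eq_top_iff]
  intro x _
  induction x using MvPolynomial.induction_on with
  | C a => exact A.algebraMap_mem a
  | add p q hp hq => exact A.add_mem (hp trivial) (hq trivial)
  | mul_X p t hp => exact A.mul_mem (hp trivial) (key _ t le_rfl)

theorem counitHom_graft (d : D) (x : TreeAlg K D) : counitHom K D (graft K d x) = 0 := by
  induction x using treeAlg_induction with
  | hm s => rw [graft_monomial]; simp [counitHom]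
  | ha x y hx hy => simp [hx, hy]
  | hs c x hx => simp [hx]


theorem comulHom_coassoc (x : TreeAlg K D) :
    TensorProduct.assoc K (TreeAlg K D) (TreeAlg K D) (TreeAlg K D)
        (LinearMap.rTensor (TreeAlg K D) (comulHom K D).toLinearMap (comulHom K D x)) =
      LinearMap.lTensor (TreeAlg K D) (comulHom K D).toLinearMap (comulHom K D x) := by
  let φ₁ : TreeAlg K D →ₐ[K] TreeAlg K D ⊗[K] (TreeAlg K D ⊗[K] TreeAlg K D) :=
    (Algebra.TensorProduct.assoc K K K (TreeAlg K D) (TreeAlg K D) (TreeAlg K D)).toAlgHom.comp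
      ((Algebra.TensorProduct.map (comulHom K D) (AlgHom.id K _)).comp (comulHom K D))
  let φ₂ : TreeAlg K D →ₐ[K] TreeAlg K D ⊗[K] (TreeAlg K D ⊗[K] TreeAlg K D) :=
    (Algebra.TensorProduct.map (AlgHom.id K _) (comulHom K D)).comp (comulHom K D)
  have h1 : ∀ x, φ₁ x = TensorProduct.assoc K (TreeAlg K D) (TreeAlg K D) (TreeAlg K D)
        (LinearMap.rTensor (TreeAlg K D) (comulHom K D).toLinearMap (comulHom K D x)) :=
    fun x => rfl
  have h2 : ∀ x, φ₂ x =
      LinearMap.lTensor (TreeAlg K D) (comulHom K D).toLinearMap (comulHom K D x) := fun x => rfl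
  have key : AlgHom.equalizer φ₁ φ₂ = ⊤ := by
    refine eq_top_of_graft K _ fun d x hx => ?_
    rw [AlgHom.mem_equalizer, h1, h2] at hx
    rw [AlgHom.mem_equalizer, h1, h2, comulHom_graft]
    have e1 : ∀ u : TreeAlg K D ⊗[K] TreeAlg K D,
        TensorProduct.assoc K (TreeAlg K D) (TreeAlg K D) (TreeAlg K D)
          (LinearMap.rTensor (TreeAlg K D) (comulHom K D).toLinearMap
            (LinearMap.lTensor (TreeAlg K D) (graft K d) u)) =
        LinearMap.lTensor (TreeAlg K D) (LinearMap.lTensor (TreeAlg K D) (graft K d))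
          (TensorProduct.assoc K (TreeAlg K D) (TreeAlg K D) (TreeAlg K D)
            (LinearMap.rTensor (TreeAlg K D) (comulHom K D).toLinearMap u)) := by
      intro u
      induction u with
      | zero => simp
      | add u v hu hv => simp only [map_add, hu, hv]
      | tmul a b =>
        simp only [LinearMap.lTensor_tmul, LinearMap.rTensor_tmul]
        generalize (comulHom K D).toLinearMap a = w
        induction w with
        | zero => simp
        | add u v hu hv => simp only [TensorProduct.add_tmul, map_add, hu, hv]
        | tmul p q => simp
    have e2 : ∀ u : TreeAlg K D ⊗[K] TreeAlg K D,
        LinearMap.lTensor (TreeAlg K D) (comulHom K D).toLinearMap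
            (LinearMap.lTensor (TreeAlg K D) (graft K d) u) =
        TensorProduct.assoc K (TreeAlg K D) (TreeAlg K D) (TreeAlg K D)
          ((LinearMap.lTensor (TreeAlg K D) (graft K d) u) ⊗ₜ[K] 1) +
        LinearMap.lTensor (TreeAlg K D) (LinearMap.lTensor (TreeAlg K D) (graft K d))
          (LinearMap.lTensor (TreeAlg K D) (comulHom K D).toLinearMap u) := by
      intro u
      induction u with
      | zero => simp
      | add u v hu hv => simp only [map_add, hu, hv, TensorProduct.add_tmul]; abel
      | tmul a b => simp [comulHom_graft, TensorProduct.tmul_add]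
    rw [map_add, map_add, map_add, e1, e2, hx, ← add_assoc]
    congr 1
    simp only [LinearMap.rTensor_tmul, LinearMap.lTensor_tmul, AlgHom.toLinearMap_apply,
      comulHom_graft, TensorProduct.add_tmul, map_add, map_one, Algebra.TensorProduct.one_def]
    simp
  have := (AlgHom.mem_equalizer φ₁ φ₂ x).1 (key ▸ Algebra.mem_top)
  rwa [h1, h2] at this

theorem counit_rTensor (x : TreeAlg K D) :
    LinearMap.rTensor (TreeAlg K D) (counitHom K D).toLinearMap (comulHom K D x) = 1 ⊗ₜ[K] x := by
  let φ₁ : TreeAlg K D →ₐ[K] K ⊗[K] TreeAlg K D :=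
    (Algebra.TensorProduct.map (counitHom K D) (AlgHom.id K _)).comp (comulHom K D)
  have h1 : ∀ x, φ₁ x = LinearMap.rTensor (TreeAlg K D) (counitHom K D).toLinearMap
      (comulHom K D x) := fun x => rfl
  have key : AlgHom.equalizer φ₁ Algebra.TensorProduct.includeRight = ⊤ := by
    refine eq_top_of_graft K _ fun d x hx => ?_
    rw [AlgHom.mem_equalizer, h1, Algebra.TensorProduct.includeRight_apply] at hx
    rw [AlgHom.mem_equalizer, h1, Algebra.TensorProduct.includeRight_apply, comulHom_graft]
    have e1 : ∀ u : TreeAlg K D ⊗[K] TreeAlg K D,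
        LinearMap.rTensor (TreeAlg K D) (counitHom K D).toLinearMap
            (LinearMap.lTensor (TreeAlg K D) (graft K d) u) =
          LinearMap.lTensor K (graft K d)
            (LinearMap.rTensor (TreeAlg K D) (counitHom K D).toLinearMap u) := by
      intro u
      induction u with
      | zero => simp
      | add u v hu hv => simp only [map_add, hu, hv]
      | tmul a b => simp
    rw [map_add, e1, hx]
    simp [counitHom_graft]
  exact (AlgHom.mem_equalizer φ₁ _ x).1 (key ▸ Algebra.mem_top)

theorem counit_lTensor (x : TreeAlg K D) :
    LinearMap.lTensor (TreeAlg K D) (counitHom K D).toLinearMap (comulHom K D x) = x ⊗ₜ[K] 1 := by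
  let φ₁ : TreeAlg K D →ₐ[K] TreeAlg K D ⊗[K] K :=
    (Algebra.TensorProduct.map (AlgHom.id K _) (counitHom K D)).comp (comulHom K D)
  have h1 : ∀ x, φ₁ x = LinearMap.lTensor (TreeAlg K D) (counitHom K D).toLinearMap
      (comulHom K D x) := fun x => rfl
  have key : AlgHom.equalizer φ₁ Algebra.TensorProduct.includeLeft = ⊤ := by
    refine eq_top_of_graft K _ fun d x _ => ?_
    rw [AlgHom.mem_equalizer, h1, Algebra.TensorProduct.includeLeft_apply, comulHom_graft]
    have e1 : ∀ u : TreeAlg K D ⊗[K] TreeAlg K D,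
        LinearMap.lTensor (TreeAlg K D) (counitHom K D).toLinearMap
            (LinearMap.lTensor (TreeAlg K D) (graft K d) u) = 0 := by
      intro u
      induction u with
      | zero => simp
      | add u v hu hv => simp only [map_add, hu, hv, add_zero]
      | tmul a b => simp [counitHom_graft]
    rw [map_add, e1]
    simp
  exact (AlgHom.mem_equalizer φ₁ _ x).1 (key ▸ Algebra.mem_top)

/-! ### Gradings -/

variable {K} in
theorem mem_homog {n : ℕ} {x : TreeAlg K D} :
    x ∈ homog K D n ↔ MvPolynomial.IsWeightedHomogeneous RTree.weight x n := Iff.rfl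

variable {K} in
theorem homog_mul {m n : ℕ} {x y : TreeAlg K D} (hx : x ∈ homog K D m) (hy : y ∈ homog K D n) :
    x * y ∈ homog K D (m + n) := MvPolynomial.IsWeightedHomogeneous.mul hx hy

theorem one_mem_homog : (1 : TreeAlg K D) ∈ homog K D 0 :=
  MvPolynomial.isWeightedHomogeneous_one _ _

theorem weight_toMultiset (s : RTree D →₀ ℕ) :
    (s.toMultiset.map RTree.weight).sum = Finsupp.weight RTree.weight s := by
  induction s using Finsupp.induction_linear with
  | zero => simp
  | add s t hs ht => rw [map_add, Multiset.map_add, Multiset.sum_add, hs, ht, map_add]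
  | single a n => simp [Finsupp.weight_apply, Finsupp.toMultiset_single, Multiset.nsmul_singleton]

theorem homog_induction {n : ℕ} {p : TreeAlg K D → Prop} (h0 : p 0)
    (hm : ∀ s : RTree D →₀ ℕ, (s.toMultiset.map RTree.weight).sum = n →
      p (MvPolynomial.monomial s 1))
    (ha : ∀ x y, p x → p y → p (x + y)) (hs : ∀ (c : K) x, p x → p (c • x))
    (x : TreeAlg K D) (hx : x ∈ homog K D n) : p x := by
  rw [← x.support_sum_monomial_coeff]
  refine Finset.sum_induction _ p ha h0 fun s hs' => ?_
  have := hs (x.coeff s) _ (hm s ?_)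
  · rwa [MvPolynomial.smul_monomial, smul_eq_mul, mul_one] at this
  · rw [weight_toMultiset]
    exact hx (MvPolynomial.mem_support_iff.1 hs')

theorem graft_mem_homog (d : D) {n : ℕ} {x : TreeAlg K D} (hx : x ∈ homog K D n) :
    graft K d x ∈ homog K D (n + 1) := by
  refine homog_induction K (p := fun x => graft K d x ∈ homog K D (n + 1)) (by simp)
    (fun s hs => ?_) (fun x y hx hy => by rw [map_add]; exact Submodule.add_mem _ hx hy)
    (fun c x hx => by rw [map_smul]; exact Submodule.smul_mem _ _ hx) x hx
  · rw [graft_monomial, mem_homog, ← hs, ← RTree.weight_node]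
    exact MvPolynomial.isWeightedHomogeneous_X _ _ _

/-- The homogeneous elements of degree `n` of the tensor square. -/
noncomputable def homogTensor (n : ℕ) : Submodule K (TreeAlg K D ⊗[K] TreeAlg K D) :=
  Submodule.span K {u | ∃ i j : ℕ, ∃ a ∈ homog K D i, ∃ b ∈ homog K D j, i + j = n ∧ a ⊗ₜ[K] b = u}

theorem homogTensor_mul {m n : ℕ} {u v : TreeAlg K D ⊗[K] TreeAlg K D}
    (hu : u ∈ homogTensor K m) (hv : v ∈ homogTensor K n) : u * v ∈ homogTensor K (m + n) := by
  have := Submodule.mul_mem_mul hu hv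
  unfold homogTensor at this
  rw [Submodule.span_mul_span] at this
  refine Submodule.span_mono ?_ this
  rintro _ ⟨_, ⟨i, j, a, ha, b, hb, hij, rfl⟩, _, ⟨i', j', a', ha', b', hb', hij', rfl⟩, rfl⟩
  refine ⟨i + i', j + j', a * a', homog_mul ha ha', b * b', homog_mul hb hb', by omega, ?_⟩
  simp

theorem comul_mem_homogTensor (t : RTree D) : t.comul K ∈ homogTensor K t.weight := by
  suffices h : ∀ n (t : RTree D), t.weight ≤ n → t.comul K ∈ homogTensor K t.weight from
    h _ t le_rfl
  intro n
  induction n with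
  | zero =>
    intro t ht
    obtain ⟨d, s, rfl⟩ := t.exists_eq_node
    simp [RTree.weight_node] at ht
  | succ n ih =>
    intro t ht
    obtain ⟨d, s, rfl⟩ := t.exists_eq_node
    have hs : ∀ t ∈ s, t.weight ≤ n := by
      intro t hts
      have := Multiset.single_le_sum (fun _ _ => Nat.zero_le _) _
        (Multiset.mem_map_of_mem RTree.weight hts)
      rw [RTree.weight_node] at ht
      omega
    have hprod : (s.map (RTree.comul K)).prod ∈ homogTensor K (s.map RTree.weight).sum := by
      clear ht
      induction s using Multiset.induction_on with
      | empty =>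
        exact Submodule.subset_span ⟨0, 0, 1, one_mem_homog K, 1, one_mem_homog K, rfl, rfl⟩
      | cons t s ihs =>
        rw [Multiset.map_cons, Multiset.map_cons, Multiset.prod_cons, Multiset.sum_cons]
        exact homogTensor_mul K (ih t (hs t (Multiset.mem_cons_self _ _)))
          (ihs fun t' ht' => hs t' (Multiset.mem_cons_of_mem ht'))
    rw [RTree.comul_node]
    refine Submodule.add_mem _ ?_ ?_
    · exact Submodule.subset_span ⟨_, 0, _, MvPolynomial.isWeightedHomogeneous_X _ _ _, 1,
        one_mem_homog K, rfl, rfl⟩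
    · rw [RTree.weight_node]
      generalize (s.map (RTree.comul K)).prod = u at hprod
      generalize (s.map RTree.weight).sum = k at hprod
      unfold homogTensor at hprod
      induction hprod using Submodule.span_induction with
      | mem u hu =>
        obtain ⟨i, j, a, ha, b, hb, hij, rfl⟩ := hu
        exact Submodule.subset_span
          ⟨i, j + 1, a, ha, _, graft_mem_homog K d hb, by omega, by simp⟩
      | zero => simp
      | add u v _ _ hu hv => rw [map_add]; exact Submodule.add_mem _ hu hv
      | smul c u _ hu => rw [map_smul]; exact Submodule.smul_mem _ _ hu

theorem comulHom_mem_homogTensor {n : ℕ} {x : TreeAlg K D} (hx : x ∈ homog K D n) :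
    comulHom K D x ∈ homogTensor K n := by
  refine homog_induction K (p := fun x => comulHom K D x ∈ homogTensor K n) (by simp)
    (fun s hs => ?_) (fun x y hx hy => by rw [map_add]; exact Submodule.add_mem _ hx hy)
    (fun c x hx => by rw [map_smul]; exact Submodule.smul_mem _ _ hx) x hx
  · have h2 : comulHom K D (MvPolynomial.monomial s 1)
        = (s.toMultiset.map (RTree.comul K)).prod := by
      rw [monomial_eq_prod, map_multiset_prod, Multiset.map_map]
      congr 1
      exact Multiset.map_congr rfl fun t _ => by simp [comulHom]
    rw [h2, ← hs]
    generalize s.toMultiset = s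
    induction s using Multiset.induction_on with
    | empty =>
      exact Submodule.subset_span ⟨0, 0, 1, one_mem_homog K, 1, one_mem_homog K, rfl, rfl⟩
    | cons t s ihs =>
      rw [Multiset.map_cons, Multiset.map_cons, Multiset.prod_cons, Multiset.sum_cons]
      exact homogTensor_mul K (comul_mem_homogTensor K t) ihs

/-- The projection on the homogeneous component of degree `n`. -/
noncomputable def homogProj (n : ℕ) : TreeAlg K D →ₗ[K] TreeAlg K D :=
  MvPolynomial.weightedHomogeneousComponent RTree.weight n

theorem homogProj_mem (n : ℕ) (x : TreeAlg K D) : homogProj K n x ∈ homog K D n :=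
  MvPolynomial.weightedHomogeneousComponent_mem _ _ _

theorem homogProj_of_mem {n : ℕ} {x : TreeAlg K D} (hx : x ∈ homog K D n) (m : ℕ) :
    homogProj K m x = if m = n then x else 0 :=
  MvPolynomial.weightedHomogeneousComponent_of_mem hx

theorem homogProj_map_comul {n i j : ℕ} (hij : i + j ≠ n) {x : TreeAlg K D}
    (hx : x ∈ homog K D n) :
    TensorProduct.map (homogProj K i) (homogProj K j) (comulHom K D x) = 0 := by
  have h := comulHom_mem_homogTensor K hx
  generalize comulHom K D x = u at h
  unfold homogTensor at h
  induction h using Submodule.span_induction with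
  | mem u hu =>
    obtain ⟨i', j', a, ha, b, hb, hij', rfl⟩ := hu
    rw [TensorProduct.map_tmul, homogProj_of_mem K ha, homogProj_of_mem K hb]
    split_ifs with h1 h2
    · omega
    · simp
    · simp
    · simp
  | zero => simp
  | add u v _ _ hu hv => rw [map_add, hu, hv, add_zero]
  | smul c u _ hu => rw [map_smul, hu, smul_zero]

end HopfAlgebra
/-! ## Systems of Dyson-Schwinger equations -/

section SDSE

/-- A system of combinatorial Dyson-Schwinger equations `X_i = B⁺_i(F_i(X_j, j ∈ I))`, given by
a family of non-constant formal series. -/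
structure SDSE (K : Type u) [Field K] (I : Type v) where
  /-- The formal series `F_i`. -/
  F : I → MvPowerSeries I K
  nonconstant : ∀ i, ∀ c : K, F i ≠ MvPowerSeries.C c

variable {K : Type u} [Field K] {I : Type v}

/-- An element `∑ x_n`, with `x_n` homogeneous of degree `n`, of the completion `∏ H(n)` of the
algebra `H` of trees is represented by the formal series `∑ x_n Tⁿ ∈ H[[T]]`; the product, and the
substitution in a formal series, in the completion become those of `H[[T]]`.
If `x_i = ∑ x_i(n)`, then `evalSeries F x` represents `F(x_j, j ∈ I)`. -/
noncomputable def evalSeries (F : MvPowerSeries I K) (x : I → ℕ → TreeAlg K I) :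
    PowerSeries (TreeAlg K I) :=
  MvPowerSeries.subst (fun j => PowerSeries.mk (x j)) F

/-- `x` is a solution of the system: `x_i = ∑ x_i(n)`, with `x_i(n)` homogeneous of degree `n`, and
`x_i = B⁺_i(F_i(x_j, j ∈ I))`. As `B⁺_i` increases the degree by one, in degree `0` this reads
`x_i(0) = 0`, and in degree `n + 1` this says that `x_i(n+1)` is the image under `B⁺_i` of the component
of degree `n` of `F_i(x_j, j ∈ I)`. -/
structure SDSE.IsSolution (S : SDSE K I) (x : I → ℕ → TreeAlg K I) : Prop where
  homog : ∀ i n, x i n ∈ DysonSchwinger.homog K I n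
  zero : ∀ i, x i 0 = 0
  succ : ∀ i n, x i (n + 1) = graft K i (PowerSeries.coeff n (evalSeries (S.F i) x))

theorem hasSubst_mk [Finite I] {x : I → ℕ → TreeAlg K I} (hx : ∀ j, x j 0 = 0) :
    MvPowerSeries.HasSubst fun j => (PowerSeries.mk (x j) : MvPowerSeries Unit (TreeAlg K I)) := by
  refine MvPowerSeries.hasSubst_of_constantCoeff_zero fun j => ?_
  have : PowerSeries.constantCoeff (PowerSeries.mk (x j)) = 0 := by
    rw [← PowerSeries.coeff_zero_eq_constantCoeff_apply, PowerSeries.coeff_mk, hx]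
  exact this

theorem coeff_evalSeries [Finite I] {x : I → ℕ → TreeAlg K I} (hx : ∀ j, x j 0 = 0)
    (F : MvPowerSeries I K) (n : ℕ) :
    PowerSeries.coeff n (evalSeries F x) = finsum fun d : I →₀ ℕ =>
      MvPowerSeries.coeff d F •
        PowerSeries.coeff n (d.prod fun j e => (PowerSeries.mk (x j)) ^ e) :=
  MvPowerSeries.coeff_subst (hasSubst_mk hx) F _

theorem coeff_evalSeries_congr [Finite I] {x y : I → ℕ → TreeAlg K I} (hx : ∀ j, x j 0 = 0)
    (hy : ∀ j, y j 0 = 0) (F : MvPowerSeries I K) (n : ℕ) (h : ∀ j, ∀ k ≤ n, x j k = y j k) :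
    PowerSeries.coeff n (evalSeries F x) = PowerSeries.coeff n (evalSeries F y) := by
  rw [coeff_evalSeries hx, coeff_evalSeries hy]
  refine finsum_congr fun d => ?_
  congr 1
  have hq : ∀ j, Ideal.Quotient.mk (Ideal.span {(PowerSeries.X : PowerSeries (TreeAlg K I)) ^ (n + 1)})
      (PowerSeries.mk (x j)) = Ideal.Quotient.mk _ (PowerSeries.mk (y j)) := by
    intro j
    rw [Ideal.Quotient.eq, Ideal.mem_span_singleton, PowerSeries.X_pow_dvd_iff]
    intro k hk
    simp [h j k (by omega)]
  have hp : Ideal.Quotient.mk (Ideal.span {(PowerSeries.X : PowerSeries (TreeAlg K I)) ^ (n + 1)})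
      (d.prod fun j e => (PowerSeries.mk (x j)) ^ e)
      = Ideal.Quotient.mk _ (d.prod fun j e => (PowerSeries.mk (y j)) ^ e) := by
    simp only [Finsupp.prod, map_prod, map_pow, hq]
  rw [Ideal.Quotient.eq, Ideal.mem_span_singleton, PowerSeries.X_pow_dvd_iff] at hp
  have := hp n (Nat.lt_succ_self n)
  rwa [map_sub, sub_eq_zero] at this

/-- The formal series `∑ x_n Tⁿ` with `x_n` homogeneous of degree `n`. -/
noncomputable def homogSeries (K : Type u) [Field K] (I : Type v) :
    Subsemiring (PowerSeries (TreeAlg K I)) where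
  carrier := {f | ∀ n, PowerSeries.coeff n f ∈ homog K I n}
  mul_mem' {f g} hf hg n := by
    rw [PowerSeries.coeff_mul]
    refine Submodule.sum_mem _ fun p hp => ?_
    rw [← Finset.HasAntidiagonal.mem_antidiagonal.1 hp]
    exact homog_mul (hf _) (hg _)
  one_mem' n := by
    rw [PowerSeries.coeff_one]
    split_ifs with h
    · rw [h]; exact one_mem_homog K
    · exact Submodule.zero_mem _
  add_mem' {f g} hf hg n := by rw [map_add]; exact Submodule.add_mem _ (hf n) (hg n)
  zero_mem' n := by simp

theorem coeff_evalSeries_mem_homog [Finite I] {x : I → ℕ → TreeAlg K I} (hx : ∀ j, x j 0 = 0)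
    (h : ∀ j n, x j n ∈ homog K I n) (F : MvPowerSeries I K) (n : ℕ) :
    PowerSeries.coeff n (evalSeries F x) ∈ homog K I n := by
  rw [coeff_evalSeries hx]
  refine finsum_induction (p := (· ∈ homog K I n)) (Submodule.zero_mem _)
    (fun _ _ => Submodule.add_mem _) fun d => Submodule.smul_mem _ _ ?_
  have hj : ∀ j, PowerSeries.mk (x j) ∈ homogSeries K I := fun j n => by
    rw [PowerSeries.coeff_mk]; exact h j n
  have : (d.prod fun j e => (PowerSeries.mk (x j)) ^ e) ∈ homogSeries K I :=
    Subsemiring.prod_mem _ fun j _ => Subsemiring.pow_mem _ (hj j) _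
  exact this n

/-- The successive approximations of the solution of the system. -/
noncomputable def SDSE.approx (S : SDSE K I) : ℕ → I → ℕ → TreeAlg K I
  | 0, _, _ => 0
  | _ + 1, _, 0 => 0
  | m + 1, i, n + 1 => graft K i (PowerSeries.coeff n (evalSeries (S.F i) (S.approx m)))

theorem SDSE.approx_zero (S : SDSE K I) (m : ℕ) (i : I) : S.approx m i 0 = 0 := by
  cases m <;> rfl

theorem SDSE.approx_homog [Finite I] (S : SDSE K I) (m : ℕ) :
    ∀ i n, S.approx m i n ∈ homog K I n := by
  induction m with
  | zero => intro i n; exact Submodule.zero_mem _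
  | succ m ih =>
    intro i n
    cases n with
    | zero => exact Submodule.zero_mem _
    | succ n =>
      exact graft_mem_homog K i (coeff_evalSeries_mem_homog (S.approx_zero m) ih _ n)

theorem SDSE.approx_stable [Finite I] (S : SDSE K I) (m : ℕ) :
    ∀ i, ∀ n ≤ m, S.approx m i n = S.approx (m + 1) i n := by
  induction m with
  | zero =>
    intro i n hn
    obtain rfl : n = 0 := by omega
    rfl
  | succ m ih =>
    intro i n hn
    cases n with
    | zero => rfl
    | succ n =>
      refine congrArg (graft K i) (coeff_evalSeries_congr (S.approx_zero m) (S.approx_zero (m + 1))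
        _ n fun j k hk => ih j k (by omega))

theorem SDSE.approx_eq [Finite I] (S : SDSE K I) (i : I) (n : ℕ) {m : ℕ} (hm : n ≤ m) :
    S.approx m i n = S.approx n i n := by
  induction m, hm using Nat.le_induction with
  | base => rfl
  | succ m hm ih => rw [← S.approx_stable m i n hm, ih]

/-- A system of Dyson-Schwinger equations has a unique solution. -/
theorem SDSE.existsUnique_solution [Finite I] (S : SDSE K I) : ∃! x, S.IsSolution x := by
  refine ⟨fun i n => S.approx n i n, ⟨fun i n => S.approx_homog n i n, fun i => rfl, ?_⟩, ?_⟩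
  · intro i n
    refine congrArg (graft K i) (coeff_evalSeries_congr (S.approx_zero n) (fun j => rfl)
      _ n fun j k hk => S.approx_eq j k hk)
  · intro y hy
    suffices h : ∀ n, ∀ i, ∀ k ≤ n, y i k = S.approx k i k by
      funext i n
      exact h n i n le_rfl
    intro n
    induction n with
    | zero =>
      intro i k hk
      obtain rfl : k = 0 := by omega
      exact hy.zero i
    | succ n ih =>
      intro i k hk
      rcases Nat.lt_or_ge k (n + 1) with h | h
      · exact ih i k (by omega)
      · obtain rfl : k = n + 1 := by omega
        rw [hy.succ]
        refine congrArg (graft K i) (coeff_evalSeries_congr hy.zero (S.approx_zero n)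
          _ n fun j k hk => ?_)
        rw [ih j k hk, S.approx_eq j k hk]

/-- The image of `A ⊗ A` in `H ⊗ H`, for a subalgebra `A` of `H`. -/
noncomputable def tensorSq (A : Subalgebra K (TreeAlg K I)) :
    A ⊗[K] A →ₐ[K] TreeAlg K I ⊗[K] TreeAlg K I :=
  Algebra.TensorProduct.map A.val A.val

theorem tensorSq_injective (A : Subalgebra K (TreeAlg K I)) :
    Function.Injective (tensorSq A) := by
  have := TensorProduct.map_injective_of_flat_flat (R := K) A.val.toLinearMap A.val.toLinearMap
    Subtype.val_injective Subtype.val_injective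
  exact this

variable [Finite I]

/-- `S.X i n` is the homogeneous component of degree `n` of the component `X_i` of the unique
solution of the system. -/
noncomputable def SDSE.X (S : SDSE K I) : I → ℕ → TreeAlg K I :=
  S.existsUnique_solution.choose

theorem SDSE.isSolution_X (S : SDSE K I) : S.IsSolution S.X :=
  S.existsUnique_solution.choose_spec.1

/-- The subalgebra generated by the homogeneous components of the solution. -/
noncomputable def SDSE.subalgebra (S : SDSE K I) : Subalgebra K (TreeAlg K I) :=
  Algebra.adjoin K (Set.range fun p : I × ℕ => S.X p.1 p.2)

/-- The system is Hopf if the subalgebra generated by the homogeneous components of its solution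
is a Hopf subalgebra. As this subalgebra is graded and connected, it is a Hopf subalgebra
as soon as it is stable under the coproduct. -/
def SDSE.IsHopf (S : SDSE K I) : Prop :=
  ∀ x ∈ S.subalgebra, comulHom K I x ∈ (tensorSq S.subalgebra).range

end SDSE
/-! ## The Lie algebra of a Hopf system -/

section Coalgebra

variable {K : Type u} [Field K] {A : Type*} {H : Type*} [AddCommGroup A] [Module K A]
  [AddCommGroup H] [Module K H] {ι : A →ₗ[K] H} {δA : A →ₗ[K] A ⊗[K] A} {δH : H →ₗ[K] H ⊗[K] H}

theorem coassoc_of_injective (hι : Function.Injective ι)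
    (h : ∀ a, TensorProduct.map ι ι (δA a) = δH (ι a))
    (hH : ∀ x, TensorProduct.assoc K H H H (LinearMap.rTensor H δH (δH x)) =
      LinearMap.lTensor H δH (δH x)) (x : A) :
    TensorProduct.assoc K A A A (LinearMap.rTensor A δA (δA x)) =
      LinearMap.lTensor A δA (δA x) := by
  have hinj : Function.Injective (TensorProduct.map ι (TensorProduct.map ι ι)) :=
    TensorProduct.map_injective_of_flat_flat (R := K) _ _ hι
      (TensorProduct.map_injective_of_flat_flat (R := K) _ _ hι hι)
  apply hinj
  have e1 : ∀ u : A ⊗[K] A, TensorProduct.map ι (TensorProduct.map ι ι)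
      (TensorProduct.assoc K A A A (LinearMap.rTensor A δA u)) =
      TensorProduct.assoc K H H H (LinearMap.rTensor H δH (TensorProduct.map ι ι u)) := by
    intro u
    induction u with
    | zero => simp
    | add u v hu hv => simp only [map_add, hu, hv]
    | tmul a b =>
      rw [LinearMap.rTensor_tmul, TensorProduct.map_tmul, LinearMap.rTensor_tmul, ← h]
      generalize δA a = w
      induction w with
      | zero => simp
      | add u v hu hv => simp only [map_add, TensorProduct.add_tmul, hu, hv]
      | tmul p q => simp
  have e2 : ∀ u : A ⊗[K] A, TensorProduct.map ι (TensorProduct.map ι ι)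
      (LinearMap.lTensor A δA u) = LinearMap.lTensor H δH (TensorProduct.map ι ι u) := by
    intro u
    induction u with
    | zero => simp
    | add u v hu hv => simp only [map_add, hu, hv]
    | tmul a b => simp [h]
  rw [e1, e2, h, hH]

theorem counit_rTensor_of_injective {εH : H →ₗ[K] K} (hι : Function.Injective ι)
    (h : ∀ a, TensorProduct.map ι ι (δA a) = δH (ι a))
    (hH : ∀ x, LinearMap.rTensor H εH (δH x) = 1 ⊗ₜ[K] x) (x : A) :
    LinearMap.rTensor A (εH ∘ₗ ι) (δA x) = 1 ⊗ₜ[K] x := by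
  have hinj : Function.Injective (LinearMap.lTensor K ι) :=
    Module.Flat.lTensor_preserves_injective_linearMap _ hι
  apply hinj
  have e1 : ∀ u : A ⊗[K] A, LinearMap.lTensor K ι (LinearMap.rTensor A (εH ∘ₗ ι) u) =
      LinearMap.rTensor H εH (TensorProduct.map ι ι u) := by
    intro u
    induction u with
    | zero => simp
    | add u v hu hv => simp only [map_add, hu, hv]
    | tmul a b => simp
  rw [e1, h, hH, LinearMap.lTensor_tmul]

theorem counit_lTensor_of_injective {εH : H →ₗ[K] K} (hι : Function.Injective ι)
    (h : ∀ a, TensorProduct.map ι ι (δA a) = δH (ι a))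
    (hH : ∀ x, LinearMap.lTensor H εH (δH x) = x ⊗ₜ[K] 1) (x : A) :
    LinearMap.lTensor A (εH ∘ₗ ι) (δA x) = x ⊗ₜ[K] 1 := by
  have hinj : Function.Injective (LinearMap.rTensor K ι) :=
    Module.Flat.rTensor_preserves_injective_linearMap _ hι
  apply hinj
  have e1 : ∀ u : A ⊗[K] A, LinearMap.rTensor K ι (LinearMap.lTensor A (εH ∘ₗ ι) u) =
      LinearMap.lTensor H εH (TensorProduct.map ι ι u) := by
    intro u
    induction u with
    | zero => simp
    | add u v hu hv => simp only [map_add, hu, hv]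
    | tmul a b => simp
  rw [e1, h, hH, LinearMap.rTensor_tmul]

end Coalgebra

section Convolution

variable {K : Type u} [Field K] {A : Type*} [CommRing A] [Algebra K A]

theorem map_mul_of_primitive {ε : A →ₗ[K] K} {f g : A →ₗ[K] K} 
    (hf : ∀ x y, f (x * y) = f x * ε y + ε x * f y)
    (hg : ∀ x y, g (x * y) = g x * ε y + ε x * g y) (u v : A ⊗[K] A) :
    LinearMap.mul' K K (TensorProduct.map f g (u * v)) =
      LinearMap.mul' K K (TensorProduct.map f g u) * LinearMap.mul' K K (TensorProduct.map ε ε v) +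
      LinearMap.mul' K K (TensorProduct.map f ε u) * LinearMap.mul' K K (TensorProduct.map ε g v) +
      LinearMap.mul' K K (TensorProduct.map ε g u) * LinearMap.mul' K K (TensorProduct.map f ε v) +
      LinearMap.mul' K K (TensorProduct.map ε ε u) *
        LinearMap.mul' K K (TensorProduct.map f g v) := by
  induction u with
  | zero => simp
  | add u u' hu hu' => simp only [add_mul, map_add, hu, hu']; ring
  | tmul a b =>
    induction v with
    | zero => simp
    | add v v' hv hv' => simp only [mul_add, map_add, hv, hv']; ring
    | tmul c d =>
      simp only [Algebra.TensorProduct.tmul_mul_tmul, TensorProduct.map_tmul, LinearMap.mul'_apply,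
        hf, hg]
      ring

end Convolution

section LieAlgebra

/-- A Hopf system of Dyson-Schwinger equations. -/
structure HopfSDSE (K : Type u) [Field K] (I : Type v) [Finite I] extends SDSE K I where
  isHopf : toSDSE.IsHopf

variable {K : Type u} [Field K] {I : Type v} [Finite I]

/-- The Hopf algebra generated by the solution of a Hopf system. -/
noncomputable abbrev HopfSDSE.A (S : HopfSDSE K I) : Subalgebra K (TreeAlg K I) := S.subalgebra

/-- The restriction of the coproduct. -/
noncomputable def HopfSDSE.comulA (S : HopfSDSE K I) : S.A →ₐ[K] S.A ⊗[K] S.A :=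
  (AlgEquiv.ofInjective (tensorSq S.A) (tensorSq_injective _)).symm.toAlgHom.comp
    (((comulHom K I).comp S.A.val).codRestrict (tensorSq S.A).range fun x => S.isHopf x x.2)

theorem HopfSDSE.tensorSq_comulA (S : HopfSDSE K I) (x : S.A) :
    tensorSq S.A (S.comulA x) = comulHom K I (x : TreeAlg K I) := by
  have := AlgEquiv.apply_symm_apply (AlgEquiv.ofInjective (tensorSq S.A) (tensorSq_injective _))
    ((((comulHom K I).comp S.A.val).codRestrict (tensorSq S.A).range fun x => S.isHopf x x.2) x)
  exact congrArg Subtype.val this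

/-- The restriction of the counit. -/
noncomputable def HopfSDSE.counitA (S : HopfSDSE K I) : S.A →ₐ[K] K :=
  (counitHom K I).comp S.A.val

/-- The coalgebra structure, restricted from the algebra of trees. -/
noncomputable instance (S : HopfSDSE K I) : Coalgebra K S.A where
  comul := S.comulA.toLinearMap
  counit := S.counitA.toLinearMap
  coassoc := LinearMap.ext fun x =>
    coassoc_of_injective (ι := S.A.val.toLinearMap) (δA := S.comulA.toLinearMap)
      (δH := (comulHom K I).toLinearMap) Subtype.val_injective S.tensorSq_comulA
      (comulHom_coassoc K) x
  rTensor_counit_comp_comul := LinearMap.ext fun x =>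
    counit_rTensor_of_injective (ι := S.A.val.toLinearMap) (δA := S.comulA.toLinearMap)
      (δH := (comulHom K I).toLinearMap) (εH := (counitHom K I).toLinearMap)
      Subtype.val_injective S.tensorSq_comulA (counit_rTensor K) x
  lTensor_counit_comp_comul := LinearMap.ext fun x =>
    counit_lTensor_of_injective (ι := S.A.val.toLinearMap) (δA := S.comulA.toLinearMap)
      (δH := (comulHom K I).toLinearMap) (εH := (counitHom K I).toLinearMap)
      Subtype.val_injective S.tensorSq_comulA (counit_lTensor K) x

theorem SDSE.mem_span_homog (S : SDSE K I) {x : TreeAlg K I} (hx : x ∈ S.subalgebra) :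
    x ∈ Submodule.span K {y | y ∈ S.subalgebra ∧ ∃ m, y ∈ homog K I m} := by
  have hx' : x ∈ Submodule.span K (Submonoid.closure
      (Set.range fun p : I × ℕ => S.X p.1 p.2) : Set (TreeAlg K I)) := by
    rw [← Algebra.adjoin_eq_span]; exact hx
  refine Submodule.span_mono ?_ hx'
  intro y hy
  refine ⟨?_, ?_⟩
  · induction hy using Submonoid.closure_induction with
    | mem x hx => exact Algebra.subset_adjoin hx
    | one => exact Subalgebra.one_mem _
    | mul x y _ _ hx hy => exact Subalgebra.mul_mem _ hx hy
  · induction hy using Submonoid.closure_induction with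
    | mem x hx => obtain ⟨p, rfl⟩ := hx; exact ⟨_, S.isSolution_X.homog p.1 p.2⟩
    | one => exact ⟨0, one_mem_homog K⟩
    | mul x y _ _ hx hy =>
      obtain ⟨a, ha⟩ := hx
      obtain ⟨b, hb⟩ := hy
      exact ⟨a + b, homog_mul ha hb⟩

theorem SDSE.homogProj_mem_subalgebra (S : SDSE K I) {x : TreeAlg K I} (hx : x ∈ S.subalgebra)
    (n : ℕ) : homogProj K n x ∈ S.subalgebra := by
  have hx' := S.mem_span_homog hx
  clear hx
  induction hx' using Submodule.span_induction with
  | mem x hx =>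
    obtain ⟨h, m, hm⟩ := hx
    rw [homogProj_of_mem K hm]
    split_ifs
    · exact h
    · exact Subalgebra.zero_mem _
  | zero => rw [map_zero]; exact Subalgebra.zero_mem _
  | add x y _ _ hx hy => rw [map_add]; exact Subalgebra.add_mem _ hx hy
  | smul c x _ hx => rw [map_smul]; exact Subalgebra.smul_mem _ hx c

/-- The projection of the Hopf algebra on its homogeneous component of degree `n`. -/
noncomputable def HopfSDSE.proj (S : HopfSDSE K I) (n : ℕ) : S.A →ₗ[K] S.A where
  toFun x := ⟨homogProj K n x, S.homogProj_mem_subalgebra x.2 n⟩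
  map_add' x y := Subtype.ext (map_add (homogProj K n) (x : TreeAlg K I) y)
  map_smul' c x := Subtype.ext (map_smul (homogProj K n) c (x : TreeAlg K I))

/-- The elements of the dual `S.A → K` that vanish in all large degrees: the graded dual. -/
def HopfSDSE.IsGradedDual (S : HopfSDSE K I) (f : S.A →ₗ[K] K) : Prop :=
  ∃ N : ℕ, ∀ n > N, ∀ x : S.A, (x : TreeAlg K I) ∈ homog K I n → f x = 0

/-- The primitive elements of the dual: those `f` whose coproduct, dual to the
multiplication of `S.A`, is `f ⊗ ε + ε ⊗ f`. -/
def HopfSDSE.IsPrimitive (S : HopfSDSE K I) (f : S.A →ₗ[K] K) : Prop :=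
  ∀ x y : S.A, f (x * y) = f x * Coalgebra.counit (R := K) y + Coalgebra.counit (R := K) x * f y

theorem HopfSDSE.eq_sum_proj (S : HopfSDSE K I) {f : S.A →ₗ[K] K} {N : ℕ}
    (hf : ∀ n > N, ∀ x : S.A, (x : TreeAlg K I) ∈ homog K I n → f x = 0) :
    f = ∑ i ∈ Finset.range (N + 1), f ∘ₗ S.proj i := by
  have key : ∀ y ∈ Submodule.span K {y | y ∈ S.subalgebra ∧ ∃ m, y ∈ homog K I m},
      ∃ x : S.A, (x : TreeAlg K I) = y ∧ f x = ∑ i ∈ Finset.range (N + 1), f (S.proj i x) := by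
    intro y hy
    induction hy using Submodule.span_induction with
    | mem y hy =>
      obtain ⟨h, m, hm⟩ := hy
      refine ⟨⟨y, h⟩, rfl, ?_⟩
      have hp : ∀ i, S.proj i ⟨y, h⟩ = if i = m then ⟨y, h⟩ else 0 := by
        intro i
        apply Subtype.ext
        have := homogProj_of_mem K hm i
        split_ifs at this ⊢ <;> exact this
      simp only [hp]
      rcases Nat.lt_or_ge N m with hN | hN
      · rw [hf m hN ⟨y, h⟩ hm, Finset.sum_eq_zero]
        intro i hi
        rw [if_neg (by have := Finset.mem_range.1 hi; omega), map_zero]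
      · rw [Finset.sum_eq_single m]
        · rw [if_pos rfl]
        · intro i _ hi
          rw [if_neg hi, map_zero]
        · intro hm
          exact absurd (Finset.mem_range.2 (by omega)) hm
    | zero => exact ⟨0, rfl, by simp⟩
    | add x y _ _ hx hy =>
      obtain ⟨a, rfl, ha⟩ := hx
      obtain ⟨b, rfl, hb⟩ := hy
      exact ⟨a + b, rfl, by simp only [map_add, ha, hb, Finset.sum_add_distrib]⟩
    | smul c x _ hx =>
      obtain ⟨a, rfl, ha⟩ := hx
      exact ⟨c • a, rfl, by simp only [map_smul, ha, Finset.smul_sum]⟩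
  refine LinearMap.ext fun x => ?_
  obtain ⟨x', hx', h⟩ := key x (S.mem_span_homog x.2)
  obtain rfl : x' = x := Subtype.ext hx'
  rw [h]
  simp

theorem HopfSDSE.map_proj_comulA (S : HopfSDSE K I) {n i j : ℕ} (hij : i + j ≠ n) {x : S.A}
    (hx : (x : TreeAlg K I) ∈ homog K I n) :
    TensorProduct.map (S.proj i) (S.proj j) (S.comulA x) = 0 := by
  apply tensorSq_injective S.A
  have e : ∀ u : S.A ⊗[K] S.A, tensorSq S.A (TensorProduct.map (S.proj i) (S.proj j) u) =
      TensorProduct.map (homogProj K i) (homogProj K j) (tensorSq S.A u) := by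
    intro u
    induction u with
    | zero => simp
    | add u v hu hv => simp only [map_add, hu, hv]
    | tmul a b => rfl
  rw [e, S.tensorSq_comulA, homogProj_map_comul K hij hx, map_zero]

theorem HopfSDSE.IsGradedDual.conv {S : HopfSDSE K I} {f g : S.A →ₗ[K] K} (hf : S.IsGradedDual f)
    (hg : S.IsGradedDual g) :
    S.IsGradedDual (WithConv.toConv f * WithConv.toConv g).ofConv := by
  obtain ⟨N, hN⟩ := hf
  obtain ⟨M, hM⟩ := hg
  refine ⟨N + M, fun n hn x hx => ?_⟩
  have h : TensorProduct.map f g (S.comulA x) = 0 := by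
    have e : TensorProduct.map f g = ∑ i ∈ Finset.range (N + 1), ∑ j ∈ Finset.range (M + 1),
        TensorProduct.map (f ∘ₗ S.proj i) (g ∘ₗ S.proj j) := by
      have h1 := congrArg₂ (fun a b => TensorProduct.mapBilinear (.id K) S.A S.A K K a b)
        (S.eq_sum_proj hN) (S.eq_sum_proj hM)
      simp only [map_sum, LinearMap.sum_apply] at h1
      rw [Finset.sum_comm] at h1
      exact h1
    rw [e]
    simp only [LinearMap.sum_apply]
    refine Finset.sum_eq_zero fun i hi => Finset.sum_eq_zero fun j hj => ?_
    have := Finset.mem_range.1 hi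
    have := Finset.mem_range.1 hj
    rw [TensorProduct.map_comp, LinearMap.comp_apply, S.map_proj_comulA (by omega) hx, map_zero]
  have h2 : (WithConv.toConv f * WithConv.toConv g).ofConv x
      = LinearMap.mul' K K (TensorProduct.map f g (S.comulA x)) := rfl
  rw [h2, h, map_zero]

theorem HopfSDSE.mul'_map_counit (S : HopfSDSE K I) (f : S.A →ₗ[K] K) (x : S.A) :
    LinearMap.mul' K K (TensorProduct.map f S.counitA.toLinearMap (S.comulA x)) = f x := by
  have h := congrArg (fun f : WithConv (S.A →ₗ[K] K) => f.ofConv x) (mul_one (WithConv.toConv f))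
  simp only [LinearMap.convOne_def, LinearMap.convMul_def] at h
  exact h

theorem HopfSDSE.mul'_counit_map (S : HopfSDSE K I) (f : S.A →ₗ[K] K) (x : S.A) :
    LinearMap.mul' K K (TensorProduct.map S.counitA.toLinearMap f (S.comulA x)) = f x := by
  have h := congrArg (fun f : WithConv (S.A →ₗ[K] K) => f.ofConv x) (one_mul (WithConv.toConv f))
  simp only [LinearMap.convOne_def, LinearMap.convMul_def] at h
  exact h

theorem HopfSDSE.IsPrimitive.conv_apply {S : HopfSDSE K I} {f g : S.A →ₗ[K] K}
    (hf : S.IsPrimitive f) (hg : S.IsPrimitive g) (x y : S.A) :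
    (WithConv.toConv f * WithConv.toConv g).ofConv (x * y) =
      (WithConv.toConv f * WithConv.toConv g).ofConv x * S.counitA y + f x * g y +
        g x * f y + S.counitA x * (WithConv.toConv f * WithConv.toConv g).ofConv y := by
  have h := map_mul_of_primitive (ε := S.counitA.toLinearMap) hf hg (S.comulA x) (S.comulA y)
  rw [← map_mul, S.mul'_map_counit, S.mul'_map_counit, S.mul'_map_counit, S.mul'_counit_map,
    S.mul'_counit_map, S.mul'_map_counit] at h
  exact h

attribute [local instance] LieRing.ofAssociativeRing

/-- The Lie algebra `Prim(H*)` of primitive elements of the graded dual `H*` of the Hopf algebra `H`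
of the system. The product of `H*` is the convolution product, dual to the coproduct of `H`, and the
Lie bracket is `[f, g] = f * g - g * f`. -/
noncomputable def HopfSDSE.lieAlg (S : HopfSDSE K I) : LieSubalgebra K (WithConv (S.A →ₗ[K] K)) where
  carrier := {f | S.IsPrimitive f.ofConv ∧ S.IsGradedDual f.ofConv}
  add_mem' := by
    rintro ⟨f⟩ ⟨g⟩ ⟨hf, N, hN⟩ ⟨hg, M, hM⟩
    refine ⟨fun x y => ?_, max N M, fun n hn x hx => ?_⟩
    · have h1 := hf x y
      have h2 := hg x y
      change f (x * y) + g (x * y) = (f x + g x) * _ + _ * (f y + g y)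
      rw [h1, h2]
      ring
    · change f x + g x = 0
      rw [hN n (lt_of_le_of_lt (le_max_left _ _) hn) x hx,
        hM n (lt_of_le_of_lt (le_max_right _ _) hn) x hx, add_zero]
  zero_mem' := ⟨fun x y => by simp, 0, fun n _ x _ => by simp⟩
  smul_mem' := by
    rintro c ⟨f⟩ ⟨hf, N, hN⟩
    refine ⟨fun x y => ?_, N, fun n hn x hx => ?_⟩
    · have h1 := hf x y
      change c * f (x * y) = (c * f x) * _ + _ * (c * f y)
      rw [h1]
      ring
    · change c * f x = 0
      rw [hN n hn x hx, mul_zero]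
  lie_mem' := by
    rintro ⟨f⟩ ⟨g⟩ ⟨hf, hf'⟩ ⟨hg, hg'⟩
    refine ⟨fun x y => ?_, ?_⟩
    · have h1 := hf.conv_apply hg x y
      have h2 := hg.conv_apply hf x y
      change (WithConv.toConv f * WithConv.toConv g).ofConv (x * y) -
        (WithConv.toConv g * WithConv.toConv f).ofConv (x * y) =
        ((WithConv.toConv f * WithConv.toConv g).ofConv x -
          (WithConv.toConv g * WithConv.toConv f).ofConv x) * S.counitA y +
        S.counitA x * ((WithConv.toConv f * WithConv.toConv g).ofConv y -
          (WithConv.toConv g * WithConv.toConv f).ofConv y)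
      rw [h1, h2]
      ring
    · obtain ⟨N, hN⟩ := hf'.conv hg'
      obtain ⟨M, hM⟩ := hg'.conv hf'
      refine ⟨max N M, fun n hn x hx => ?_⟩
      change (WithConv.toConv f * WithConv.toConv g).ofConv x -
        (WithConv.toConv g * WithConv.toConv f).ofConv x = 0
      rw [hN n (lt_of_le_of_lt (le_max_left _ _) hn) x hx,
        hM n (lt_of_le_of_lt (le_max_right _ _) hn) x hx, sub_zero]

end LieAlgebra
/-! ## Connected, fundamental and abelian systems -/

section Fundamental

variable {K : Type u} [Field K] {I : Type v}

/-- The oriented graph of the system: there is an edge from `i` to `j` if `∂F_i/∂h_j ≠ 0`. -/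
def SDSE.Edge (S : SDSE K I) (i j : I) : Prop :=
  MvPowerSeries.pderiv K j (S.F i) ≠ 0

/-- The system is connected if its graph is connected (as a non-oriented graph). -/
def SDSE.Connected (S : SDSE K I) : Prop :=
  (SimpleGraph.fromRel S.Edge).Connected

/-- The linear form `f_{•j}` on the algebra of trees: the coefficient of the tree with a
single vertex, decorated by `j`. -/
noncomputable def dotForm (K : Type u) [Field K] (j : I) : TreeAlg K I →ₗ[K] K :=
  MvPolynomial.lcoeff K (Finsupp.single (RTree.node j 0) 1)

/-- `c` is the structure coefficient `λ_n^{(i,j)}` of the system: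
`(f_{•j} ⊗ Id) ∘ Δ (X_i(n+1)) = c X_i(n)`. -/
def SDSE.IsStructCoeff [Finite I] (S : SDSE K I) (i j : I) (n : ℕ) (c : K) : Prop :=
  TensorProduct.lid K (TreeAlg K I)
      (LinearMap.rTensor (TreeAlg K I) (dotForm K j) (comulHom K I (S.X i (n + 1)))) = c • S.X i n

/-- The structure coefficients `λ_n^{(i,j)}` are of the form `b (n - 1) + a` for `n` large enough. -/
def SDSE.HasSlope [Finite I] (S : SDSE K I) (i j : I) (b : K) : Prop :=
  ∃ (a : K) (n₀ : ℕ), ∀ n : ℕ, 1 ≤ n → n₀ ≤ n → S.IsStructCoeff i j n (b * ((n : K) - 1) + a)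

/-- The system is abelian if the slopes `b_j` of the structure coefficients all vanish. -/
def SDSE.IsAbelian [Finite I] (S : SDSE K I) : Prop :=
  ∀ (i j : I) (b : K), S.HasSlope i j b → b = 0

/-- The formal series `∑_k a (a + β) ⋯ (a + (k-1) β) / k! hᵏ`. For `a ≠ 0`, this is `f_{β/a}(a h)`,
where `f_γ(h) = ∑_k (1 + γ) ⋯ (1 + (k-1) γ) / k! hᵏ`, that is to say `(1 - γ h)^{-1/γ}` if `γ ≠ 0`,
and `exp(h)` if `γ = 0`. For `a = 0`, this is the constant `1`. -/
noncomputable def fSeries (a β : K) : PowerSeries K :=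
  PowerSeries.mk fun k => (∏ m ∈ Finset.range k, (a + m * β)) / (k.factorial : K)

/-- The formal series `∑_{k ≥ 1} β^{k-1} / k hᵏ`, that is to say `-(1/β) ln(1 - β h)` if `β ≠ 0`,
and `h` if `β = 0`. -/
noncomputable def logSeries (β : K) : PowerSeries K :=
  PowerSeries.mk fun k => if k = 0 then 0 else β ^ (k - 1) / (k : K)

/-- The five kinds of vertices of the basic fundamental systems. -/
inductive Kind
  | I0 | J0 | K0 | I1 | J1

/-- The parameters of a basic fundamental system with set of vertices `V`: a partition of `V` into
five parts `I₀`, `J₀`, `K₀`, `I₁`, `J₁`, and scalars. `β i` is used for `i ∈ I₀`, `ν i` for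
`i ∈ I₁ ∪ J₁`, `a i j = a_j^{(i)}` for `i ∈ I₁` and `j ∈ I₀ ∪ J₀ ∪ K₀`, or `i ∈ J₁` and `j ∈ I₁`,
`b i j = b_j^{(i)}` for `i ∈ J₁` and `j ∈ I₀ ∪ J₀ ∪ K₀`. -/
structure FundData (K : Type u) (V : Type v) where
  kind : V → Kind
  β : V → K
  ν : V → K
  a : V → V → K
  b : V → V → K

variable {V : Type v}

/-- The series `f(h_j)`. -/
noncomputable def inVar (j : V) (f : PowerSeries K) : MvPowerSeries V K :=
  PowerSeries.subst (MvPowerSeries.X j : MvPowerSeries V K) f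

section

variable [Fintype V] [DecidableEq V]

open Classical in
/-- The set of vertices of a given kind. -/
noncomputable def FundData.part (P : FundData K V) (κ : Kind) : Finset V :=
  Finset.univ.filter fun j => P.kind j = κ

/-- For `i ∈ J₁`, the set `I₁^{(i)}` of the `j ∈ I₁` such that `a_j^{(i)} ≠ 0`. -/
noncomputable def FundData.part₁ (P : FundData K V) (i : V) : Finset V :=
  open Classical in (P.part Kind.I1).filter fun j => P.a i j ≠ 0

/-- The conditions on the parameters. -/
structure FundData.IsValid (P : FundData K V) : Prop where
  nonempty : (P.part Kind.I0 ∪ P.part Kind.J0).Nonempty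
  I1 : ∀ i ∈ P.part Kind.I1, P.ν i ≠ 1 ∨ (∃ j ∈ P.part Kind.I0, P.a i j ≠ 1 + P.β j) ∨
    (∃ j ∈ P.part Kind.J0, P.a i j ≠ 1) ∨ (∃ j ∈ P.part Kind.K0, P.a i j ≠ 0)
  J1_ν : ∀ i ∈ P.part Kind.J1, P.ν i ≠ 0
  J1_nonempty : ∀ i ∈ P.part Kind.J1, (P.part₁ i).Nonempty
  J1_ν_eq : ∀ i ∈ P.part Kind.J1, ∀ j ∈ P.part₁ i, P.ν j = 1
  /-- All the `F_j`, with `j ∈ I₁^{(i)}`, have the same coefficients `a_t^{(j)} = b_t^{(i)}`. -/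
  J1_b : ∀ i ∈ P.part Kind.J1, ∀ j ∈ P.part₁ i,
    ∀ t ∈ P.part Kind.I0 ∪ P.part Kind.J0 ∪ P.part Kind.K0, P.b i t = P.a j t

open Classical in
/-- The formal series of a basic fundamental system. -/
noncomputable def FundData.F (P : FundData K V) (i : V) : MvPowerSeries V K :=
  match P.kind i with
  | Kind.I0 =>
      inVar i (fSeries 1 (P.β i)) *
        (∏ j ∈ (P.part Kind.I0).erase i, inVar j (fSeries (1 + P.β j) (P.β j))) *
        ∏ j ∈ P.part Kind.J0, inVar j (fSeries 1 1)
  | Kind.J0 =>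
      (∏ j ∈ P.part Kind.I0, inVar j (fSeries (1 + P.β j) (P.β j))) *
        ∏ j ∈ (P.part Kind.J0).erase i, inVar j (fSeries 1 1)
  | Kind.K0 =>
      (∏ j ∈ P.part Kind.I0, inVar j (fSeries (1 + P.β j) (P.β j))) *
        ∏ j ∈ P.part Kind.J0, inVar j (fSeries 1 1)
  | Kind.I1 =>
      if P.ν i = 0 then
        (∑ j ∈ P.part Kind.I0, P.a i j • inVar j (logSeries (P.β j))) +
          (∑ j ∈ P.part Kind.J0, P.a i j • inVar j (logSeries 1)) +
          (∑ j ∈ P.part Kind.K0, P.a i j • MvPowerSeries.X j) + 1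
      else
        (P.ν i)⁻¹ • ((∏ j ∈ P.part Kind.I0, inVar j (fSeries (P.ν i * P.a i j) (P.β j))) *
          (∏ j ∈ P.part Kind.J0, inVar j (fSeries (P.ν i * P.a i j) 1)) *
          ∏ j ∈ P.part Kind.K0, inVar j (fSeries (P.ν i * P.a i j) 0)) +
        MvPowerSeries.C (1 - (P.ν i)⁻¹)
  | Kind.J1 =>
      (P.ν i)⁻¹ • ((∏ j ∈ P.part Kind.I0, inVar j (fSeries (P.b i j - 1 - P.β j) (P.β j))) *
          (∏ j ∈ P.part Kind.J0, inVar j (fSeries (P.b i j - 1) 1)) *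
          ∏ j ∈ P.part Kind.K0, inVar j (fSeries (P.b i j) 0)) +
        (∑ j ∈ P.part₁ i, P.a i j • MvPowerSeries.X j) +
        MvPowerSeries.C (1 - (P.ν i)⁻¹)

end

/-- The dilatation, along a map `π : I → V`, of a family of formal series: the vertex `v` is replaced
by the set of vertices `π⁻¹(v)`, and `F'_x = F_{π(x)}(∑_{y ∈ π⁻¹(v)} h_y, v ∈ V)`. -/
noncomputable def dilate {V : Type*} (π : I → V) (F : V → MvPowerSeries V K) (x : I) :
    MvPowerSeries I K :=
  MvPowerSeries.subst (fun v => ∑ᶠ (y : I) (_ : π y = v), (MvPowerSeries.X y : MvPowerSeries I K))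
    (F (π x))

/-- The change of variables `μ_x F_x(κ_y h_y, y ∈ I)`. -/
noncomputable def changeVar (κ μ : I → K) (F : I → MvPowerSeries I K) (x : I) :
    MvPowerSeries I K :=
  μ x • MvPowerSeries.subst (fun y => κ y • (MvPowerSeries.X y : MvPowerSeries I K)) (F x)

/-- The system is fundamental if, up to a change of variables, it is a dilatation of a
basic fundamental system. -/
def SDSE.IsFundamental (S : SDSE K I) : Prop :=
  ∃ (n : ℕ) (P : FundData K (Fin n)) (π : I → Fin n) (κ μ : I → K),
    P.IsValid ∧ Function.Surjective π ∧ (∀ x, κ x ≠ 0) ∧ (∀ x, μ x ≠ 0) ∧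
      S.F = changeVar κ μ (dilate π P.F)

end Fundamental
/-! ## Iterated semi-direct products over the Faà di Bruno Lie algebra -/

section Target

variable {K : Type u} [Field K]

/-- The bilinear map sending `(x(k), y(l))` to `c(k, l) z(k + l)`, where `x(k)`, `y(k)` and `z(k)`,
`k ≥ 1`, are three copies of the basis of the space of finitely supported sequences. -/
noncomputable def shift (c : ℕ+ → ℕ+ → K) : (ℕ+ →₀ K) →ₗ[K] (ℕ+ →₀ K) →ₗ[K] (ℕ+ →₀ K) :=
  Finsupp.lsum K fun k => LinearMap.toSpanSingleton K ((ℕ+ →₀ K) →ₗ[K] (ℕ+ →₀ K))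
    (Finsupp.lsum K fun l => c k l • Finsupp.lsingle (k + l))

theorem shift_single (c : ℕ+ → ℕ+ → K) (k l : ℕ+) (a b : K) :
    shift c (Finsupp.single k a) (Finsupp.single l b) = Finsupp.single (k + l) (a * (c k l * b)) := by
  simp only [shift, Finsupp.lsum_single, LinearMap.toSpanSingleton_apply, LinearMap.smul_apply,
    Finsupp.lsingle_apply, Finsupp.smul_single, smul_eq_mul]

theorem shift_comp {c A B C D E : ℕ+ → ℕ+ → K}
    (h : ∀ k l m, c k l * A (k + l) m = B l m * C k (l + m) - D k m * E l (k + m))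
    (x y v : ℕ+ →₀ K) :
    shift A (shift c x y) v = shift C x (shift B y v) - shift E y (shift D x v) := by
  induction x using Finsupp.induction_linear with
  | zero => simp
  | add x x' hx hx' => simp only [map_add, LinearMap.add_apply, hx, hx']; abel
  | single k a =>
    induction y using Finsupp.induction_linear with
    | zero => simp
    | add y y' hy hy' => simp only [map_add, LinearMap.add_apply, hy, hy']; abel
    | single l b =>
      induction v using Finsupp.induction_linear with
      | zero => simp
      | add v v' hv hv' => simp only [map_add, hv, hv']; abel
      | single m d =>
        simp only [shift_single]
        rw [← add_assoc, add_left_comm l k m, ← add_assoc, ← Finsupp.single_sub]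
        congr 1
        linear_combination (a * b * d) * h k l m

theorem shift_comm {A B C D : ℕ+ → ℕ+ → K}
    (h : ∀ k l m, B l m * C k (l + m) = D k m * A l (k + m)) (x y v : ℕ+ →₀ K) :
    shift C x (shift B y v) = shift A y (shift D x v) := by
  have := shift_comp (c := fun _ _ => 0) (A := fun _ _ => 0) (B := B) (C := C) (D := D) (E := A)
    (fun k l m => by rw [h]; ring) x y v
  have h0 : ∀ x y : ℕ+ →₀ K, shift (fun _ _ => (0 : K)) x y = 0 := by
    intro x y
    have : shift (fun _ _ => (0 : K)) = 0 := by
      ext k l : 4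
      simp [shift_single]
    rw [this]; rfl
  rw [h0] at this
  exact (sub_eq_zero.1 this.symm)

/-- The Faà di Bruno Lie algebra, with basis `e(k)`, `k ≥ 1`. -/
def FdB (K : Type u) [Field K] : Type u := ℕ+ →₀ K

noncomputable instance : AddCommGroup (FdB K) := inferInstanceAs (AddCommGroup (ℕ+ →₀ K))

noncomputable instance : Module K (FdB K) := inferInstanceAs (Module K (ℕ+ →₀ K))

/-- The sequence of the coordinates in the basis `e(k)`, `k ≥ 1`. -/
noncomputable def FdB.coord (K : Type u) [Field K] : FdB K →ₗ[K] (ℕ+ →₀ K) := LinearMap.id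

/-- The bilinear map `[e(k), e(l)] = (l - k) e(k + l)`. -/
noncomputable def fdbBracket (K : Type u) [Field K] :
    (ℕ+ →₀ K) →ₗ[K] (ℕ+ →₀ K) →ₗ[K] (ℕ+ →₀ K) :=
  shift fun k l => ((l : ℕ) : K) - ((k : ℕ) : K)

theorem fdbBracket_skew (x y : ℕ+ →₀ K) : fdbBracket K x y + fdbBracket K y x = 0 := by
  induction x using Finsupp.induction_linear with
  | zero => simp
  | add x x' hx hx' =>
    simp only [map_add, LinearMap.add_apply]
    rw [add_add_add_comm, hx, hx', add_zero]
  | single k a =>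
    induction y using Finsupp.induction_linear with
    | zero => simp
    | add y y' hy hy' =>
      simp only [map_add, LinearMap.add_apply]
      rw [add_add_add_comm, hy, hy', add_zero]
    | single l b =>
      rw [fdbBracket, shift_single, shift_single, add_comm l k, ← Finsupp.single_add,
        ← Finsupp.single_zero (k + l)]
      congr 1
      ring

theorem fdbBracket_self (x : ℕ+ →₀ K) : fdbBracket K x x = 0 := by
  induction x using Finsupp.induction_linear with
  | zero => simp
  | add x y hx hy =>
    simp only [map_add, LinearMap.add_apply]
    rw [hx, hy, zero_add, add_zero, add_comm]
    exact fdbBracket_skew _ _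
  | single k a => rw [fdbBracket, shift_single]; simp

theorem fdbBracket_jacobi (x y z : ℕ+ →₀ K) :
    fdbBracket K (fdbBracket K x y) z =
      fdbBracket K x (fdbBracket K y z) - fdbBracket K y (fdbBracket K x z) :=
  shift_comp (fun k l m => by simp only [PNat.add_coe, Nat.cast_add]; ring) x y z

/-- The bracket of the Faà di Bruno Lie algebra is `[e(k), e(l)] = (l - k) e(k + l)`. -/
noncomputable instance : LieRing (FdB K) where
  bracket x y := fdbBracket K x y
  add_lie x y z := congrArg (fun f => f z) (map_add (fdbBracket K) x y)
  lie_add x y z := map_add (fdbBracket K x) y z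
  lie_self x := fdbBracket_self x
  leibniz_lie x y z := eq_add_of_sub_eq (fdbBracket_jacobi x y z).symm

noncomputable instance : LieAlgebra K (FdB K) where
  lie_smul t x y := map_smul (fdbBracket K x) t y

/-- A module `V` over the Lie algebra `L`. -/
structure Rep (K : Type u) [Field K] (L : Type*) [LieRing L] [LieAlgebra K L]
    (V : Type*) [AddCommGroup V] [Module K V] where
  /-- The action of `L` on `V`. -/
  act : L →ₗ[K] V →ₗ[K] V
  act_lie : ∀ x y v, act ⁅x, y⁆ v = act x (act y v) - act y (act x v)

/-- The space `V`, seen as an abelian Lie algebra. -/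
def Ab (V : Type*) : Type _ := V

section

variable {L : Type*} [LieRing L] [LieAlgebra K L] {V : Type*} [AddCommGroup V] [Module K V]

instance : AddCommGroup (Ab V) := inferInstanceAs (AddCommGroup V)

instance : Module K (Ab V) := inferInstanceAs (Module K V)

instance : LieRing (Ab V) where
  bracket _ _ := 0
  add_lie _ _ _ := (add_zero 0).symm
  lie_add _ _ _ := (add_zero 0).symm
  lie_self _ := rfl
  leibniz_lie _ _ _ := (add_zero 0).symm

instance : LieAlgebra K (Ab V) where
  lie_smul t _ _ := (smul_zero t).symm

/-- The action of `L` on the abelian Lie algebra `V`, by derivations. -/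
def Rep.toDer (ρ : Rep K L V) : L →ₗ⁅K⁆ LieDerivation K (Ab V) (Ab V) where
  toFun x :=
    { toLinearMap := ρ.act x
      leibniz' := fun _ _ => (map_zero (ρ.act x)).trans (sub_zero (0 : V)).symm }
  map_add' x y := LieDerivation.ext fun v => congrArg (fun f => f v) (map_add ρ.act x y)
  map_smul' t x := LieDerivation.ext fun v => congrArg (fun f => f v) (map_smul ρ.act t x)
  map_lie' {x y} := LieDerivation.ext fun v => by
    rw [LieDerivation.lie_apply]
    exact ρ.act_lie x y v

/-- The semi-direct product of the Lie algebra `L` by the `L`-module `V`: the space `V × L`, with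
`[(v, x), (w, y)] = (x.w - y.v, [x, y])`. -/
abbrev Rep.SemiDirect (ρ : Rep K L V) : Type _ := LieAlgebra.SemiDirectSum (Ab V) L ρ.toDer

/-- The direct sum of a finite family of modules. -/
def Rep.sum {n : ℕ} (ρ : Fin n → Rep K L V) : Rep K L (Fin n → V) where
  act := LinearMap.mk₂ K (fun x v r => (ρ r).act x (v r))
    (fun _ _ _ => by ext; simp) (fun _ _ _ => by ext; simp)
    (fun _ _ _ => by ext; simp) (fun _ _ _ => by ext; simp)
  act_lie x y v := funext fun r => (ρ r).act_lie x y (v r)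

/-- A module `W` over the semi-direct product of `L` by the `n`-th direct sum `V₁ ⊕ ⋯ ⊕ V_n`,
given by an action of `L` and actions of the `V_j`'s:
`(v₁, …, v_n, x).w = x.w + v₁.w + ⋯ + v_n.w`. -/
def Rep.extend {n : ℕ} {ρ : Fin n → Rep K L V} {W : Type*} [AddCommGroup W] [Module K W]
    (σ : Rep K L W) (τ : Fin n → V →ₗ[K] W →ₗ[K] W)
    (h₁ : ∀ i j v v' w, τ i v (τ j v' w) = τ j v' (τ i v w))
    (h₂ : ∀ j x v w, τ j ((ρ j).act x v) w = σ.act x (τ j v w) - τ j v (σ.act x w)) :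
    Rep K (Rep.sum ρ).SemiDirect W where
  act := LinearMap.mk₂ K (fun x w => σ.act x.right w + ∑ j, τ j ((x.left : Fin n → V) j) w)
    (fun x y w => by
      change σ.act (x.right + y.right) w +
        ∑ j, τ j ((x.left : Fin n → V) j + (y.left : Fin n → V) j) w = _
      simp only [map_add, LinearMap.add_apply, Finset.sum_add_distrib]
      abel)
    (fun t x w => by
      change σ.act (t • x.right) w + ∑ j, τ j (t • (x.left : Fin n → V) j) w = _
      simp only [map_smul, LinearMap.smul_apply, smul_add, Finset.smul_sum])
    (fun x v w => by simp only [map_add, Finset.sum_add_distrib]; abel)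
    (fun t x w => by simp only [map_smul, smul_add, Finset.smul_sum])
  act_lie x y w := by
    obtain ⟨v, x⟩ := x
    obtain ⟨v', y⟩ := y
    change σ.act ⁅x, y⁆ w + ∑ j, τ j (0 + (ρ j).act x ((v' : Fin n → V) j) -
      (ρ j).act y ((v : Fin n → V) j)) w = 
      (σ.act x (σ.act y w + ∑ j, τ j ((v' : Fin n → V) j) w) + ∑ i, τ i ((v : Fin n → V) i)
        (σ.act y w + ∑ j, τ j ((v' : Fin n → V) j) w)) -
      (σ.act y (σ.act x w + ∑ j, τ j ((v : Fin n → V) j) w) + ∑ i, τ i ((v' : Fin n → V) i)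
        (σ.act x w + ∑ j, τ j ((v : Fin n → V) j) w))
    have e : ∑ i, ∑ j, τ i ((v : Fin n → V) i) (τ j ((v' : Fin n → V) j) w) =
        ∑ i, ∑ j, τ i ((v' : Fin n → V) i) (τ j ((v : Fin n → V) j) w) := by
      rw [Finset.sum_comm]
      exact Finset.sum_congr rfl fun i _ => Finset.sum_congr rfl fun j _ => h₁ _ _ _ _ _
    simp only [zero_add, map_sub, LinearMap.sub_apply, h₂, σ.act_lie, map_add, map_sum,
      Finset.sum_add_distrib, Finset.sum_sub_distrib, e]
    abel

end

/-- The module over the Faà di Bruno Lie algebra with basis `f(l)`, `l ≥ 1`, and action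
`e(k).f(l) = α(l) f(k + l)`. -/
noncomputable def fdbRep (α : ℕ+ → K)
    (h : ∀ k l m : ℕ+, (((l : ℕ) : K) - ((k : ℕ) : K)) * α m = α m * α (l + m) - α m * α (k + m)) :
    Rep K (FdB K) (ℕ+ →₀ K) where
  act := (shift fun _ l => α l) ∘ₗ FdB.coord K
  act_lie x y v := shift_comp (c := fun k l => ((l : ℕ) : K) - ((k : ℕ) : K))
    (A := fun _ l => α l) (B := fun _ l => α l) (C := fun _ l => α l) (D := fun _ l => α l)
    (E := fun _ l => α l) (fun k l m => h k l m) x y v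

/-- The module `V₀` over the Faà di Bruno Lie algebra, with basis `f(l)`, `l ≥ 1`, and action
`e(k).f(l) = l f(k + l)`. -/
noncomputable def V0 (K : Type u) [Field K] : Rep K (FdB K) (ℕ+ →₀ K) :=
  fdbRep (fun l => (l : ℕ)) fun k l m => by
    simp only [PNat.add_coe, Nat.cast_add]; ring

/-- The direct sum `V₀^M`. -/
noncomputable def V0Pow (K : Type u) [Field K] (M : ℕ) :
    Rep K (FdB K) (Fin M → (ℕ+ →₀ K)) := Rep.sum fun _ => V0 K

/-- The Lie algebra `V₀^M ⋊ g_FdB`, with basis `f^{(i)}(k)`, `e(k)`. -/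
abbrev L1 (K : Type u) [Field K] (M : ℕ) : Type u := (V0Pow K M).SemiDirect

/-- The module over `V₀^M ⋊ g_FdB` with basis `h(l)`, `l ≥ 1`, and action
`e(k).h(l) = α(l) h(k + l)` and `f^{(i)}(k).h(l) = φ_i(l) h(k + l)`. -/
noncomputable def rep1 {M : ℕ} (α : ℕ+ → K) (φ : Fin M → ℕ+ → K)
    (hα : ∀ k l m : ℕ+, (((l : ℕ) : K) - ((k : ℕ) : K)) * α m = α m * α (l + m) - α m * α (k + m))
    (hφ : ∀ i i' (k l m : ℕ+), φ i' m * φ i (l + m) = φ i m * φ i' (k + m))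
    (hφα : ∀ i (k l m : ℕ+), ((l : ℕ) : K) * φ i m = φ i m * α (l + m) - α m * φ i (k + m)) :
    Rep K (L1 K M) (ℕ+ →₀ K) :=
  Rep.extend (fdbRep α hα) (fun i => shift fun _ l => φ i l)
    (fun i i' v v' w => shift_comm (fun k l m => hφ i i' k l m) v v' w)
    (fun i x v w => shift_comp (c := fun _ l => ((l : ℕ) : K)) (A := fun _ l => φ i l)
      (B := fun _ l => φ i l) (C := fun _ l => α l) (D := fun _ l => α l) (E := fun _ l => φ i l)
      (fun k l m => hφα i k l m) x v w)

/-- The module `W_{c,υ}` over `V₀^M ⋊ g_FdB`, with basis `g(l)`, `l ≥ 1`, and action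
`e(k).g(l) = (l + c) g(k + l)` and `f^{(i)}(k).g(l) = υ_i g(k + l)`. -/
noncomputable def W {M : ℕ} (c : K) (υ : Fin M → K) : Rep K (L1 K M) (ℕ+ →₀ K) :=
  rep1 (fun l => (l : ℕ) + c) (fun i _ => υ i)
    (fun k l m => by simp only [PNat.add_coe, Nat.cast_add]; ring)
    (fun i i' k l m => mul_comm _ _)
    (fun i k l m => by simp only [PNat.add_coe, Nat.cast_add]; ring)

/-- The direct sum of the modules `W_{c_j,υ^{(j)}}`, `1 ≤ j ≤ N`. -/
noncomputable def WSum {M N : ℕ} (c : Fin N → K) (υ : Fin N → Fin M → K) :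
    Rep K (L1 K M) (Fin N → (ℕ+ →₀ K)) := Rep.sum fun j => W (c j) (υ j)

/-- The Lie algebra `(W_{c_1,υ^{(1)}} ⊕ ⋯ ⊕ W_{c_N,υ^{(N)}}) ⋊ (V₀^M ⋊ g_FdB)`, with basis
`g^{(j)}(k)`, `f^{(i)}(k)`, `e(k)`. -/
abbrev L2 {M N : ℕ} (c : Fin N → K) (υ : Fin N → Fin M → K) : Type u := (WSum c υ).SemiDirect

section Top

variable {M N : ℕ} {c : Fin N → K} {υ : Fin N → Fin M → K}

theorem pnat_add_ne_one (k m : ℕ+) : k + m ≠ 1 := by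
  intro h
  have := congrArg PNat.val h
  have h1 := k.pos
  have h2 := m.pos
  simp at this
  omega

/-- The module `W'_{ν,0}`, with basis `h(l)`, `l ≥ 1`, and action `e(k).h(l) = (l - 1) h(k + l)`,
`f^{(i)}(k).h(1) = ν_i h(k + 1)`, `f^{(i)}(k).h(l) = 0` if `l ≥ 2`, and `g^{(j)}(k).h(l) = 0`. -/
noncomputable def WPrime0 (c : Fin N → K) (υ : Fin N → Fin M → K) (ν : Fin M → K) :
    Rep K (L2 c υ) (ℕ+ →₀ K) :=
  Rep.extend
    (rep1 (fun l => ((l : ℕ) : K) - 1) (fun i l => if l = 1 then ν i else 0)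
      (fun k l m => by simp only [PNat.add_coe, Nat.cast_add]; ring)
      (fun i i' k l m => by simp [pnat_add_ne_one])
      (fun i k l m => by
        rw [if_neg (pnat_add_ne_one k m), PNat.add_coe, Nat.cast_add]
        split_ifs with hm
        · subst hm; simp; ring
        · simp))
    (fun _ => 0) (fun _ _ _ _ _ => rfl) (fun _ _ _ _ => by simp)

/-- The module `W'_{ν,1}`, with basis `h(l)`, `l ≥ 1`, and action `e(k).h(1) = h(k + 1)`,
`e(k).h(l) = (l - 1) h(k + l)` if `l ≥ 2`, `f^{(i)}(k).h(1) = ν_i h(k + 1)`, `f^{(i)}(k).h(l) = 0` if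
`l ≥ 2`, and `g^{(j)}(k).h(l) = 0`. -/
noncomputable def WPrime1 (c : Fin N → K) (υ : Fin N → Fin M → K) (ν : Fin M → K) :
    Rep K (L2 c υ) (ℕ+ →₀ K) :=
  Rep.extend
    (rep1 (fun l => if l = 1 then 1 else ((l : ℕ) : K) - 1) (fun i l => if l = 1 then ν i else 0)
      (fun k l m => by
        rw [if_neg (pnat_add_ne_one k m), if_neg (pnat_add_ne_one l m)]
        simp only [PNat.add_coe, Nat.cast_add]; ring)
      (fun i i' k l m => by simp [pnat_add_ne_one])
      (fun i k l m => by
        rw [if_neg (pnat_add_ne_one k m), if_neg (pnat_add_ne_one l m), PNat.add_coe, Nat.cast_add]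
        split_ifs with hm
        · subst hm; simp; ring
        · simp))
    (fun _ => 0) (fun _ _ _ _ _ => rfl) (fun _ _ _ _ => by simp)

theorem wSecond_compat {c' d μ : K} {ν ξ : Fin M → K} (h : μ ≠ 0 → c' = d - 1 ∧ ν = ξ)
    (e : ℕ+ →₀ K) (f : Fin M → (ℕ+ →₀ K)) (v w : ℕ+ →₀ K) :
    shift (fun _ l => if l = 1 then μ else 0)
        (shift (fun _ l => ((l : ℕ) : K) + d) e v + ∑ i, shift (fun _ _ => ξ i) (f i) v) w =
      (shift (fun _ l => ((l : ℕ) : K) + c') e (shift (fun _ l => if l = 1 then μ else 0) v w) +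
        ∑ i, shift (fun _ _ => ν i) (f i) (shift (fun _ l => if l = 1 then μ else 0) v w)) -
      shift (fun _ l => if l = 1 then μ else 0) v
        (shift (fun _ l => ((l : ℕ) : K) + c') e w + ∑ i, shift (fun _ _ => ν i) (f i) w) := by
  have h1 := shift_comp (c := fun _ l => ((l : ℕ) : K) + d) (A := fun _ l => if l = 1 then μ else 0)
    (B := fun _ l => if l = 1 then μ else 0) (C := fun _ l => ((l : ℕ) : K) + c')
    (D := fun _ l => ((l : ℕ) : K) + c') (E := fun _ l => if l = 1 then μ else 0)
    (fun k l m => by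
      rw [if_neg (pnat_add_ne_one k m), PNat.add_coe, Nat.cast_add]
      split_ifs with hm
      · subst hm
        by_cases hμ : μ = 0
        · simp [hμ]
        · rw [(h hμ).1]; simp; ring
      · simp) e v w
  have h2 : ∀ i, _ := fun i => shift_comp (c := fun _ _ => ξ i)
    (A := fun _ l => if l = 1 then μ else 0)
    (B := fun _ l => if l = 1 then μ else 0) (C := fun _ _ => ν i)
    (D := fun _ _ => ν i) (E := fun _ l => if l = 1 then μ else 0)
    (fun k l m => by
      rw [if_neg (pnat_add_ne_one k m)]
      split_ifs with hm
      · by_cases hμ : μ = 0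
        · simp [hμ]
        · rw [(h hμ).2]; ring
      · simp) (f i) v w
  simp only [map_add, map_sum, LinearMap.add_apply, LinearMap.sum_apply, h1, h2,
    Finset.sum_sub_distrib]
  abel

/-- The module `W''_{c',ν,μ}`, with basis `h(l)`, `l ≥ 1`, and action
`e(k).h(l) = (l + c') h(k + l)`, `f^{(i)}(k).h(l) = ν_i h(k + l)`, `g^{(j)}(k).h(1) = μ_j h(k + 1)`,
and `g^{(j)}(k).h(l) = 0` if `l ≥ 2`. These formulas define a module if, and only if, `c' = c_j - 1`
and `ν = υ^{(j)}` for all `j` such that `μ_j ≠ 0`. -/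
noncomputable def WSecond (c' : K) (ν : Fin M → K) (μ : Fin N → K)
    (h : ∀ j, μ j ≠ 0 → c' = c j - 1 ∧ ν = υ j) : Rep K (L2 c υ) (ℕ+ →₀ K) :=
  Rep.extend
    (rep1 (fun l => (l : ℕ) + c') (fun i _ => ν i)
      (fun k l m => by simp only [PNat.add_coe, Nat.cast_add]; ring)
      (fun i i' k l m => mul_comm _ _)
      (fun i k l m => by simp only [PNat.add_coe, Nat.cast_add]; ring))
    (fun j => shift fun _ l => if l = 1 then μ j else 0)
    (fun i j v v' w => shift_comm (fun k l m => by simp [pnat_add_ne_one]) v v' w)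
    (fun j x v w => by
      obtain ⟨f, e⟩ := x
      exact wSecond_compat (c' := c') (ν := ν) (h j) e f v w)

/-- The parameters of the modules `W'_{ν,0}`, `W'_{ν,1}` and `W''_{c',ν,μ}`. -/
inductive TopParam (c : Fin N → K) (υ : Fin N → Fin M → K) : Type u
  | wPrime0 (ν : Fin M → K)
  | wPrime1 (ν : Fin M → K)
  | wSecond (c' : K) (ν : Fin M → K) (μ : Fin N → K) (h : ∀ j, μ j ≠ 0 → c' = c j - 1 ∧ ν = υ j)

/-- The module with given parameters. -/
noncomputable def TopParam.rep : TopParam c υ → Rep K (L2 c υ) (ℕ+ →₀ K)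
  | .wPrime0 ν => WPrime0 c υ ν
  | .wPrime1 ν => WPrime1 c υ ν
  | .wSecond c' ν μ h => WSecond c' ν μ h

/-- The direct sum of a finite family of such modules. -/
noncomputable def TopSum {R : ℕ} (w : Fin R → TopParam c υ) :
    Rep K (L2 c υ) (Fin R → (ℕ+ →₀ K)) := Rep.sum fun r => (w r).rep

/-- The Lie algebra `W ⋊ ((W_{c_1,υ^{(1)}} ⊕ ⋯ ⊕ W_{c_N,υ^{(N)}}) ⋊ (V₀^M ⋊ g_FdB))`, where `W` is a
direct sum of modules `W'_{ν,0}`, `W'_{ν,1}` and `W''_{c',ν,μ}`. -/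
abbrev L3 {R : ℕ} (w : Fin R → TopParam c υ) : Type u := (TopSum w).SemiDirect

end Top

end Target

end DysonSchwinger

/-!
The Lie algebra `𝔤` of a Hopf system `X_x = B⁺_x(F_x(X))` has a basis dual to the generators as soon
as no generator `X_x(n)` vanishes. For a fundamental system this holds because a non-constant series
`F_x` has a nonzero linear part (`FundPres.X_ne_zero`). As the trees of `X_x(n)` have `n` vertices
and a root decorated by `x`, the coefficient of a tree of `X_x(n)` vanishes on all the other
generators; divided by its value on `X_x(n)`, it gives the element `p_x(n)` of the dual basis
(`FundPres.prim`).

The bracket of these elements is computed from the derivations `(f ⊗ Id) ∘ Δ` of the algebra of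
trees. By the cocycle property of grafting, the derivation attached to `p_y(k)` satisfies the
linearized system. The series `Φ_{a,β}` solve `(1 - β h) Φ' = a Φ`, so the logarithmic derivatives of
products of them are linear in their exponents, and this determines the solution of the linearized
system: `X_x(k + l)` is sent to `λ_l^{(x,y)} X_x(l)`, with explicit coefficients which depend only on
the classes `π(x)`, `π(y)`, apart from the factors of the change of variables
(`FundData.structCoeff`, `FundData.map_derivation_eval`, `FundPres.formDer_X`). Therefore
`[p_y(k), p_x(l)] = λ_l^{(x,y)} p_x(k + l) - λ_k^{(y,x)} p_y(k + l)` (`FundPres.lie_prim`).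

If all the slopes vanish, the system is abelian. Otherwise a vertex `x₀` of `I₀ ∪ J₀ ∪ K₀` has a
nonzero slope, which becomes `1` after rescaling the basis. Then the `p_{x₀}(k)` span the Faà di Bruno
Lie algebra; subtracting multiples of them from the elements of the other classes of
`I₀ ∪ J₀ ∪ K₀` gives copies of `V₀`; the differences inside a class, and the vertices of `I₁` with
`ν ≠ 0`, give the modules `W_{c,υ}`; the vertices of `I₁` with `ν = 0` give the modules `W'`, and those
of `J₁` the modules `W''` (`IsAdapted.exists_lieEquiv`). The family so obtained is triangular with
respect to the basis `p`, so the morphism from the iterated semi-direct product which it defines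
(`exists_lieHom`) is bijective.
-/

namespace DysonSchwinger

universe u v

/-! ### Derivations of rings of formal series -/

section PowerSeriesDerivations

open PowerSeries

variable {K : Type*} [Field K] {R : Type*} [CommRing R] [Algebra K R]

/-- The derivation of `R⟦T⟧` which applies a derivation of `R` to each coefficient. -/
noncomputable def coeffDer (δ : Derivation K R R) : Derivation K R⟦X⟧ R⟦X⟧ :=
  Derivation.mk'
    { toFun := fun f => PowerSeries.mk fun n => δ (coeff n f)
      map_add' := fun f g => by ext n; simp
      map_smul' := fun c f => by
        ext n
        simp }
    fun f g => by
      ext n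
      simp only [LinearMap.coe_mk, AddHom.coe_mk, coeff_mk, coeff_mul, map_sum, Derivation.leibniz,
        smul_eq_mul, map_add, Finset.sum_add_distrib]
      congr 1
      rw [Finset.Nat.sum_antidiagonal_swap
        (f := fun p : ℕ × ℕ => coeff p.1 g * δ (coeff p.2 f)) |>.symm]
      rfl

@[simp] theorem coeff_coeffDer (δ : Derivation K R R) (f : R⟦X⟧) (n : ℕ) :
    coeff n (coeffDer δ f) = δ (coeff n f) := by
  simp [coeffDer]

/-- The Euler derivation `T d/dT`. -/
noncomputable def eulerDer (K : Type*) [Field K] (R : Type*) [CommRing R] [Algebra K R] :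
    Derivation K R⟦X⟧ R⟦X⟧ :=
  (X : R⟦X⟧) • (PowerSeries.derivative R).restrictScalars K

theorem coeff_eulerDer (f : R⟦X⟧) (n : ℕ) : coeff n (eulerDer K R f) = (n : R) * coeff n f := by
  have h : eulerDer K R f = X * PowerSeries.derivative R f := rfl
  rw [h]
  cases n with
  | zero => simp
  | succ n => rw [coeff_succ_X_mul, coeff_derivative]; push_cast; ring

/-- The chain rule. No continuity of the derivation is needed: a power of `u` can be factored out of
the tail of `φ(u)`. -/
theorem derivation_subst (δ : Derivation K R⟦X⟧ R⟦X⟧) {u : R⟦X⟧}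
    (hu : PowerSeries.constantCoeff u = 0) (φ : K⟦X⟧) :
    δ (φ.subst u) = (PowerSeries.derivative K φ).subst u * δ u := by
  have hs : HasSubst u := HasSubst.of_constantCoeff_zero' hu
  have hX : (X : R⟦X⟧) ∣ u := X_dvd_iff.2 hu
  ext n
  obtain ⟨ψ, hψ⟩ : (X : K⟦X⟧) ^ (n + 2) ∣ φ - (trunc (n + 2) φ : K⟦X⟧) := by
    rw [X_pow_dvd_iff]
    intro m hm
    rw [map_sub, Polynomial.coeff_coe, coeff_trunc, if_pos hm, sub_self]
  rw [sub_eq_iff_eq_add'] at hψ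
  have hz : ∀ y, coeff n (u ^ (n + 1) * y) = 0 := fun y =>
    X_pow_dvd_iff.1 ((pow_dvd_pow_of_dvd hX (n + 1)).mul_right y) n (Nat.lt_succ_self n)
  have hd : PowerSeries.derivative K ((X : K⟦X⟧) ^ (n + 2) * ψ) =
      X ^ (n + 1) * (((n + 2 : ℕ) : K⟦X⟧) * ψ + X * PowerSeries.derivative K ψ) := by
    rw [Derivation.leibniz, Derivation.leibniz_pow, derivative_X]
    simp only [smul_eq_mul, nsmul_eq_mul, Nat.add_one_sub_one]
    push_cast
    ring
  have h1 : δ (((X : K⟦X⟧) ^ (n + 2) * ψ).subst u) = u ^ (n + 1) *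
      (u * δ (ψ.subst u) + ((n + 2 : ℕ) : R⟦X⟧) * (ψ.subst u * δ u)) := by
    rw [subst_mul hs, subst_pow hs, subst_X hs, Derivation.leibniz, Derivation.leibniz_pow]
    simp only [smul_eq_mul, nsmul_eq_mul, Nat.add_one_sub_one]
    push_cast
    ring
  have h2 : δ ((trunc (n + 2) φ : K⟦X⟧).subst u) =
      (PowerSeries.derivative K (trunc (n + 2) φ : K⟦X⟧)).subst u * δ u := by
    rw [derivative_coe, subst_coe hs, subst_coe hs, Derivation.map_aeval, smul_eq_mul]
  rw [hψ, subst_add hs, map_add, map_add, h1, h2, hz, map_add (PowerSeries.derivative K), hd,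
    subst_add hs, subst_mul hs, subst_pow hs, subst_X hs, add_mul, map_add,
    mul_assoc (u ^ (n + 1)), hz]

theorem fSeries_ode [CharZero K] (a r : K) :
    (1 - r • (X : K⟦X⟧)) * PowerSeries.derivative K (fSeries a r) = a • fSeries a r := by
  ext n
  rw [sub_mul, one_mul, smul_mul_assoc, map_sub, PowerSeries.coeff_smul, PowerSeries.coeff_smul]
  have h : ∀ n, coeff n (PowerSeries.derivative K (fSeries a r)) =
      (∏ m ∈ Finset.range (n + 1), (a + m * r)) / (n.factorial : K) := by
    intro n
    rw [coeff_derivative, fSeries, coeff_mk, Nat.factorial_succ]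
    have h1 : ((n : K) + 1) ≠ 0 := Nat.cast_add_one_ne_zero n
    have h2 : (n.factorial : K) ≠ 0 := Nat.cast_ne_zero.2 n.factorial_ne_zero
    push_cast
    generalize ∏ m ∈ Finset.range (n + 1), (a + (m : K) * r) = y
    field_simp
  cases n with
  | zero => rw [coeff_zero_X_mul, h, fSeries, coeff_mk]; simp
  | succ n =>
    rw [coeff_succ_X_mul, h, h, Finset.prod_range_succ, fSeries, coeff_mk, Nat.factorial_succ]
    have h1 : ((n : K) + 1) ≠ 0 := Nat.cast_add_one_ne_zero n
    have h2 : (n.factorial : K) ≠ 0 := Nat.cast_ne_zero.2 n.factorial_ne_zero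
    push_cast
    simp only [smul_eq_mul]
    generalize ∏ m ∈ Finset.range (n + 1), (a + (m : K) * r) = y
    field_simp
    ring

theorem logSeries_ode [CharZero K] (r : K) :
    (1 - r • (X : K⟦X⟧)) * PowerSeries.derivative K (logSeries r) = 1 := by
  ext n
  rw [sub_mul, one_mul, smul_mul_assoc, map_sub, PowerSeries.coeff_smul]
  have h : ∀ n, coeff n (PowerSeries.derivative K (logSeries r)) = r ^ n := by
    intro n
    rw [coeff_derivative, logSeries, coeff_mk, if_neg n.succ_ne_zero]
    have h1 : ((n : K) + 1) ≠ 0 := Nat.cast_add_one_ne_zero n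
    push_cast
    field_simp
  cases n with
  | zero => simp [h]
  | succ n => rw [coeff_succ_X_mul, h, h, coeff_one, if_neg n.succ_ne_zero, smul_eq_mul]; ring

theorem constantCoeff_fSeries (a r : K) : PowerSeries.constantCoeff (fSeries a r) = 1 := by
  rw [← coeff_zero_eq_constantCoeff_apply, fSeries, coeff_mk]; simp

theorem fSeries_zero (r : K) : fSeries 0 r = 1 := by
  ext n
  rw [fSeries, coeff_mk, coeff_one]
  split_ifs with h
  · subst h; simp
  · rw [Finset.prod_eq_zero (i := 0) (Finset.mem_range.2 (Nat.pos_of_ne_zero h)) (by simp), zero_div]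

theorem logSeries_zero : logSeries (0 : K) = X := by
  ext n
  rw [logSeries, coeff_mk, coeff_X]
  rcases n with _ | _ | n <;> simp

section Quotient

variable [CharZero K] {Q : Type*} [CommRing Q] [Algebra K Q] (q : R⟦X⟧ →ₐ[K] Q)
  (δ : Derivation K R⟦X⟧ R⟦X⟧) {r : K} {θ : Q}

/-- The series `Φ_{a,r}` satisfies `(1 - r h) Φ' = a Φ`, so its logarithmic derivative along `δ` is
`a θ`, where `θ` stands for `δ u / (1 - r u)`. The identities are read through a morphism `q`, later
a truncation or the reduction of the coefficients, and no division is needed. -/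
theorem map_derivation_fSeries {u : R⟦X⟧} (hu : PowerSeries.constantCoeff u = 0)
    (h : q (δ u) = q (1 - r • u) * θ) (a : K) :
    q (δ ((fSeries a r).subst u)) = a • θ * q ((fSeries a r).subst u) := by
  have hs : HasSubst u := HasSubst.of_constantCoeff_zero' hu
  have h1 : (1 - r • u) * (PowerSeries.derivative K (fSeries a r)).subst u =
      a • (fSeries a r).subst u := by
    have := congrArg (PowerSeries.subst u) (fSeries_ode a r)
    rwa [subst_mul hs, subst_sub hs, subst_smul hs, subst_smul hs, subst_X hs,
      ← coe_substAlgHom hs, map_one, coe_substAlgHom hs] at this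
  rw [derivation_subst δ hu, map_mul, h, ← mul_assoc, ← map_mul, mul_comm _ (1 - r • u), h1,
    map_smul, smul_mul_assoc, smul_mul_assoc, mul_comm]

theorem map_derivation_logSeries {u : R⟦X⟧} (hu : PowerSeries.constantCoeff u = 0)
    (h : q (δ u) = q (1 - r • u) * θ) : q (δ ((logSeries r).subst u)) = θ := by
  have hs : HasSubst u := HasSubst.of_constantCoeff_zero' hu
  have h1 : (1 - r • u) * (PowerSeries.derivative K (logSeries r)).subst u = 1 := by
    have := congrArg (PowerSeries.subst u) (logSeries_ode r)
    rwa [subst_mul hs, subst_sub hs, subst_smul hs, subst_X hs,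
      ← coe_substAlgHom hs, map_one, coe_substAlgHom hs] at this
  rw [derivation_subst δ hu, map_mul, h, ← mul_assoc, ← map_mul, mul_comm _ (1 - r • u), h1,
    map_one, one_mul]

/-- The logarithmic derivative of a product of series `Φ_{p_j, r_j}(u_j)` is linear in the
exponents `p_j`. -/
theorem map_derivation_prod {ι : Type*} (s : Finset ι) {u : ι → R⟦X⟧} {r : ι → K} {θ : ι → Q}
    (hu : ∀ j, PowerSeries.constantCoeff (u j) = 0)
    (h : ∀ j ∈ s, q (δ (u j)) = q (1 - r j • u j) * θ j) (p : ι → K) :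
    q (δ (∏ j ∈ s, (fSeries (p j) (r j)).subst (u j))) =
      (∑ j ∈ s, p j • θ j) * q (∏ j ∈ s, (fSeries (p j) (r j)).subst (u j)) := by
  classical
  induction s using Finset.induction_on with
  | empty => simp
  | insert j s hj ih =>
    rw [Finset.prod_insert hj, Finset.sum_insert hj, Derivation.leibniz, smul_eq_mul, smul_eq_mul,
      map_add, map_mul, map_mul, ih fun i hi => h i (Finset.mem_insert_of_mem hi),
      map_derivation_fSeries q δ (hu j) (h j (Finset.mem_insert_self _ _)), map_mul]
    ring

end Quotient

end PowerSeriesDerivations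

/-! ### Rooted trees and infinitesimal forms -/

section TreeStructure

variable {D : Type v}

/-- The decoration of the root of a plane tree. -/
def PlaneTree.root : PlaneTree D → D
  | PlaneTree.node d _ => d

/-- The forest obtained by deleting the root of a plane tree. -/
def PlaneTree.children : PlaneTree D → Multiset (RTree D)
  | PlaneTree.node _ l => (l.map RTree.mk : List (RTree D))

theorem PlaneTree.Step.root_eq {t t' : PlaneTree D} (h : PlaneTree.Step t t') :
    t.root = t'.root := by
  cases h <;> rfl

theorem PlaneTree.Step.children_eq {t t' : PlaneTree D} (h : PlaneTree.Step t t') :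
    t.children = t'.children := by
  cases h with
  | perm d h => exact Multiset.coe_eq_coe.2 (h.map _)
  | child d l₁ l₂ h => simp [PlaneTree.children, h.mk_eq]

/-- The decoration of the root of a rooted tree. -/
def RTree.root (t : RTree D) : D := Quot.lift PlaneTree.root (fun _ _ h => h.root_eq) t

/-- The forest obtained by deleting the root of a rooted tree. -/
def RTree.children (t : RTree D) : Multiset (RTree D) :=
  Quot.lift PlaneTree.children (fun _ _ h => h.children_eq) t

theorem RTree.children_node (d : D) (s : Multiset (RTree D)) : (RTree.node d s).children = s := by
  change (((s.toList.map RTree.out).map RTree.mk : List (RTree D)) : Multiset (RTree D)) = s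
  rw [List.map_map]
  have : RTree.mk ∘ RTree.out = (id : RTree D → RTree D) := funext RTree.mk_out
  rw [this, List.map_id, Multiset.coe_toList]

theorem RTree.node_inj {d : D} {s s' : Multiset (RTree D)} :
    RTree.node d s = RTree.node d s' ↔ s = s' :=
  ⟨fun h => by rw [← RTree.children_node d s, h, RTree.children_node], fun h => by rw [h]⟩

end TreeStructure

section TreeForms

variable {K : Type u} [Field K] {D : Type v}

open MvPolynomial

theorem coeff_graft_node (d : D) (m : RTree D →₀ ℕ) (z : TreeAlg K D) :
    coeff (Finsupp.single (RTree.node d (Finsupp.toMultiset m)) 1) (graft K d z) = coeff m z := by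
  classical
  induction z using treeAlg_induction with
  | hm s =>
    rw [graft_monomial, coeff_X, coeff_monomial]
    congr 1
    rw [Finsupp.single_left_inj one_ne_zero, RTree.node_inj,
      (Function.LeftInverse.injective Finsupp.toMultiset_toFinsupp).eq_iff]
  | ha x y hx hy => rw [map_add, coeff_add, coeff_add, hx, hy]
  | hs c x hx => rw [map_smul, coeff_smul, coeff_smul, hx]

/-- The coefficients of `B⁺_d(z)` are those of the trees with root decorated by `d`. -/
theorem coeff_graft_ne_zero {d : D} {u : RTree D →₀ ℕ} {z : TreeAlg K D}
    (h : coeff u (graft K d z) ≠ 0) : ∃ t : RTree D, t.root = d ∧ u = Finsupp.single t 1 := by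
  classical
  by_contra hu
  refine h ?_
  clear h
  induction z using treeAlg_induction with
  | hm s =>
    rw [graft_monomial, coeff_X, if_neg]
    rintro rfl
    exact hu ⟨_, rfl, rfl⟩
  | ha x y hx hy => rw [map_add, coeff_add, hx, hy, add_zero]
  | hs c x hx => rw [map_smul, coeff_smul, hx, smul_zero]

theorem graft_ne_zero (d : D) {z : TreeAlg K D} (hz : z ≠ 0) : graft K d z ≠ 0 := by
  obtain ⟨m, hm⟩ := MvPolynomial.ne_zero_iff.1 hz
  exact MvPolynomial.ne_zero_iff.2 ⟨_, (coeff_graft_node d m z).symm ▸ hm⟩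

/-- The linear forms which vanish on `1` and on the products of two elements of the augmentation
ideal, that is to say the derivations `H → K` over the counit. -/
def IsInfinitesimal (f : TreeAlg K D →ₗ[K] K) : Prop :=
  ∀ x y, f (x * y) = f x * counitHom K D y + counitHom K D x * f y

/-- The coefficient of a tree is the derivation over the counit given by a partial derivative. -/
theorem lcoeff_eq_counit_pderiv (t : RTree D) (x : TreeAlg K D) :
    lcoeff K (Finsupp.single t 1) x = counitHom K D (pderiv t x) := by
  have h : counitHom K D (pderiv t x) = coeff 0 (pderiv t x) := by
    rw [counitHom, ← constantCoeff_eq]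
    change aeval (0 : RTree D → K) _ = _
    rw [aeval_zero]; rfl
  rw [h, lcoeff_apply, coeff_pderiv]
  simp

theorem isInfinitesimal_lcoeff (t : RTree D) :
    IsInfinitesimal (lcoeff K (Finsupp.single t 1) : TreeAlg K D →ₗ[K] K) := by
  intro x y
  simp only [lcoeff_eq_counit_pderiv, Derivation.leibniz, map_add, smul_eq_mul, map_mul]
  ring

theorem IsInfinitesimal.smul {f : TreeAlg K D →ₗ[K] K} (hf : IsInfinitesimal f) (c : K) :
    IsInfinitesimal (c • f) := by
  intro x y
  simp only [LinearMap.smul_apply, hf x y, smul_eq_mul]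
  ring

/-- `f ⊗ Id` is a derivation over `ε ⊗ Id`. -/
theorem rTensor_mul_of_isInfinitesimal {f : TreeAlg K D →ₗ[K] K} (hf : IsInfinitesimal f)
    (a b : TreeAlg K D ⊗[K] TreeAlg K D) :
    TensorProduct.lid K _ (LinearMap.rTensor (TreeAlg K D) f (a * b)) =
      TensorProduct.lid K _ (LinearMap.rTensor (TreeAlg K D) f a) *
        TensorProduct.lid K _ (LinearMap.rTensor (TreeAlg K D) (counitHom K D).toLinearMap b) +
      TensorProduct.lid K _ (LinearMap.rTensor (TreeAlg K D) (counitHom K D).toLinearMap a) *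
        TensorProduct.lid K _ (LinearMap.rTensor (TreeAlg K D) f b) := by
  induction a with
  | zero => simp
  | add a a' ha ha' => simp only [add_mul, map_add, ha, ha']; ring
  | tmul a a' =>
    induction b with
    | zero => simp
    | add b b' hb hb' => simp only [mul_add, map_add, hb, hb']; ring
    | tmul b b' =>
      simp only [Algebra.TensorProduct.tmul_mul_tmul, LinearMap.rTensor_tmul,
        TensorProduct.lid_tmul, hf a b, AlgHom.toLinearMap_apply, smul_mul_smul_comm, add_smul]

/-- For an infinitesimal form `f`, the derivation `(f ⊗ Id) ∘ Δ` of the algebra of trees. -/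
noncomputable def formDer {f : TreeAlg K D →ₗ[K] K} (hf : IsInfinitesimal f) :
    Derivation K (TreeAlg K D) (TreeAlg K D) :=
  Derivation.mk'
    ((TensorProduct.lid K (TreeAlg K D)).toLinearMap ∘ₗ LinearMap.rTensor (TreeAlg K D) f ∘ₗ
      (comulHom K D).toLinearMap)
    fun x y => by
      simp only [LinearMap.comp_apply, LinearEquiv.coe_coe, AlgHom.toLinearMap_apply, map_mul,
        rTensor_mul_of_isInfinitesimal hf, counit_rTensor, TensorProduct.lid_tmul, one_smul,
        smul_eq_mul]
      ring

theorem formDer_apply {f : TreeAlg K D →ₗ[K] K} (hf : IsInfinitesimal f) (x : TreeAlg K D) :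
    formDer hf x = TensorProduct.lid K (TreeAlg K D)
      (LinearMap.rTensor (TreeAlg K D) f (comulHom K D x)) := rfl

/-- The cocycle property of grafting, read on the derivation of an infinitesimal form. -/
theorem formDer_graft {f : TreeAlg K D →ₗ[K] K} (hf : IsInfinitesimal f) (d : D)
    (x : TreeAlg K D) :
    formDer hf (graft K d x) = f (graft K d x) • 1 + graft K d (formDer hf x) := by
  rw [formDer_apply, comulHom_graft, map_add, map_add, LinearMap.rTensor_tmul,
    TensorProduct.lid_tmul, formDer_apply]
  congr 1
  generalize comulHom K D x = w
  induction w with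
  | zero => simp
  | add a b ha hb => simp only [map_add, ha, hb]
  | tmul a b => simp

end TreeForms

/-! ### The series of a basic fundamental system -/

section FundamentalSeries

namespace FundData

theorem mem_part {K : Type*} {V : Type*} [Fintype V] (P : FundData K V) {κ : Kind} {v : V} :
    v ∈ P.part κ ↔ P.kind v = κ := by
  simp [part]

theorem subst_inVar {K : Type*} [Field K] {V : Type*} {R : Type*} [CommRing R] [Algebra K R]
    {τ : Type*} {U : V → MvPowerSeries τ R} (hU : MvPowerSeries.HasSubst U) (j : V)
    (f : PowerSeries K) : MvPowerSeries.subst U (inVar j f) = f.subst (U j) := by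
  rw [inVar, PowerSeries.subst, MvPowerSeries.subst_comp_subst_apply
    (PowerSeries.HasSubst.X j).const hU]
  rw [MvPowerSeries.subst_X hU]
  rfl

theorem subst_fSeries_zero {K : Type*} [Field K] {R : Type*} [CommRing R] [Algebra K R]
    {τ : Type*} {u : MvPowerSeries τ R} (hu : PowerSeries.HasSubst u) (r : K) :
    (fSeries 0 r).subst u = 1 := by
  rw [fSeries_zero, ← PowerSeries.coe_substAlgHom hu, map_one]

variable {K : Type*} [Field K] {V : Type*} [Fintype V] [DecidableEq V]

/-- The set `I₀ ∪ J₀ ∪ K₀` of the vertices whose variables occur in the products of a basic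
fundamental system. -/
noncomputable def base (P : FundData K V) : Finset V :=
  P.part Kind.I0 ∪ P.part Kind.J0 ∪ P.part Kind.K0

/-- The exponent with which the variable of `v ∈ I₀ ∪ J₀ ∪ K₀` occurs in the series of the other
vertices of `I₀ ∪ J₀ ∪ K₀`. It turns out to be the slope `b_v`. -/
noncomputable def slope (P : FundData K V) (v : V) : K :=
  match P.kind v with
  | Kind.I0 => 1 + P.β v
  | Kind.J0 => 1
  | _ => 0

/-- The parameter `r` such that the variable of `v ∈ I₀ ∪ J₀ ∪ K₀` occurs in series `Φ_{p,r}`. The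
exponent of the variable of `v` in the series of `v` itself is `P.slope v - P.rate v`. -/
noncomputable def rate (P : FundData K V) (v : V) : K :=
  match P.kind v with
  | Kind.I0 => P.β v
  | Kind.J0 => 1
  | _ => 0

variable (P : FundData K V)

omit [Field K] in
theorem mem_base {v : V} : v ∈ P.base ↔
    P.kind v = Kind.I0 ∨ P.kind v = Kind.J0 ∨ P.kind v = Kind.K0 := by
  simp [base, mem_part]

omit [Field K] in
theorem notMem_base_of_I1 {v : V} (h : P.kind v = Kind.I1) : v ∉ P.base := by
  rw [mem_base, h]; simp

omit [Field K] in
theorem notMem_base_of_J1 {v : V} (h : P.kind v = Kind.J1) : v ∉ P.base := by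
  rw [mem_base, h]; simp

omit [Field K] in
theorem kind_cases {P : FundData K V} (w : V) :
    w ∈ P.base ∨ P.kind w = Kind.I1 ∨ P.kind w = Kind.J1 := by
  rw [mem_base]
  cases P.kind w <;> simp

theorem slope_of_notMem {v : V} (h : v ∉ P.base) : P.slope v = 0 := by
  rw [mem_base] at h
  unfold slope
  cases hv : P.kind v <;> simp_all

omit [Field K] in
theorem prod_base {M : Type*} [CommMonoid M] (f : V → M) : ∏ v ∈ P.base, f v =
    (∏ v ∈ P.part Kind.I0, f v) * (∏ v ∈ P.part Kind.J0, f v) * ∏ v ∈ P.part Kind.K0, f v := by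
  rw [base, Finset.prod_union, Finset.prod_union]
  · rw [Finset.disjoint_left]
    intro v h h'
    rw [mem_part] at h h'
    simp [h] at h'
  · rw [Finset.disjoint_left]
    intro v h h'
    rw [Finset.mem_union, mem_part, mem_part] at h
    rw [mem_part] at h'
    simp [h'] at h

omit [DecidableEq V] in
theorem mem_part₁ {v w : V} : v ∈ P.part₁ w ↔ P.kind v = Kind.I1 ∧ P.a w v ≠ 0 := by
  classical
  simp [part₁, mem_part]

omit [Field K] in
theorem sum_base {M : Type*} [AddCommMonoid M] (f : V → M) : ∑ v ∈ P.base, f v =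
    (∑ v ∈ P.part Kind.I0, f v) + (∑ v ∈ P.part Kind.J0, f v) + ∑ v ∈ P.part Kind.K0, f v :=
  P.prod_base (M := Multiplicative M) f

section Eval

variable {R : Type*} [CommRing R] [Algebra K R] {τ : Type*}

/-- The product of the series `Φ_{p_j, r_j}(U_j)`, for `j ∈ I₀ ∪ J₀ ∪ K₀`. -/
noncomputable def baseProd (U : V → MvPowerSeries τ R) (p : V → K) : MvPowerSeries τ R :=
  ∏ j ∈ P.base, (fSeries (p j) (P.rate j)).subst (U j)

theorem baseProd_eq (U : V → MvPowerSeries τ R) (p : V → K) : P.baseProd U p =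
    (∏ v ∈ P.part Kind.I0, (fSeries (p v) (P.β v)).subst (U v)) *
      (∏ v ∈ P.part Kind.J0, (fSeries (p v) 1).subst (U v)) *
      ∏ v ∈ P.part Kind.K0, (fSeries (p v) 0).subst (U v) := by
  rw [baseProd, prod_base]
  congr 1
  · congr 1
    all_goals
      refine Finset.prod_congr rfl fun v hv => ?_
      rw [mem_part] at hv
      simp only [rate, hv]
  · refine Finset.prod_congr rfl fun v hv => ?_
    rw [mem_part] at hv
    simp only [rate, hv]

variable {U : V → MvPowerSeries τ R}

/-- On `I₀ ∪ J₀ ∪ K₀` the three formulas for the series become one, since `Φ_{0,r} = 1`. -/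
theorem subst_F_base (hU : MvPowerSeries.HasSubst U) {w : V} (hw : w ∈ P.base) :
    MvPowerSeries.subst U (P.F w) =
    P.baseProd U fun j => P.slope j - if j = w then P.rate j else 0 := by
  have hu : ∀ v, PowerSeries.HasSubst (U v) := fun v => hU.const_coeff v
  rw [mem_base] at hw
  have hK : ∏ v ∈ P.part Kind.K0, (fSeries (P.slope v - if v = w then P.rate v else 0) 0).subst
      (U v) = 1 := by
    refine Finset.prod_eq_one fun v hv => ?_
    rw [mem_part] at hv
    simp [slope, rate, hv, subst_fSeries_zero (hu v)]
  have hI : ∀ v ∈ P.part Kind.I0, v ≠ w → (P.slope v - if v = w then P.rate v else 0) =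
      1 + P.β v := by
    intro v hv hvw
    rw [mem_part] at hv
    simp [slope, hv, hvw]
  have hJ : ∀ v ∈ P.part Kind.J0, v ≠ w → (P.slope v - if v = w then P.rate v else 0) = 1 := by
    intro v hv hvw
    rw [mem_part] at hv
    simp [slope, hv, hvw]
  rw [baseProd_eq, hK, mul_one, ← MvPowerSeries.coe_substAlgHom hU]
  rcases hw with hw | hw | hw
  · simp only [F, hw, map_mul, map_prod]
    simp only [MvPowerSeries.coe_substAlgHom hU, subst_inVar hU]
    congr 1
    · rw [← Finset.mul_prod_erase _ _ (P.mem_part.2 hw)]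
      congr 1
      · simp [slope, rate, hw]
      · refine Finset.prod_congr (by congr) fun v hv => ?_
        rw [Finset.mem_erase] at hv
        rw [hI v hv.2 hv.1]
    · refine Finset.prod_congr rfl fun v hv => ?_
      rw [hJ v hv]
      rintro rfl
      simp [mem_part, hw] at hv
  · simp only [F, hw, map_mul, map_prod]
    simp only [MvPowerSeries.coe_substAlgHom hU, subst_inVar hU]
    congr 1
    · refine Finset.prod_congr rfl fun v hv => ?_
      rw [hI v hv]
      rintro rfl
      simp [mem_part, hw] at hv
    · rw [← Finset.mul_prod_erase (P.part Kind.J0) _ (P.mem_part.2 hw)]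
      have : (fSeries (P.slope w - if w = w then P.rate w else 0) (1 : K)).subst (U w) = 1 := by
        simp [slope, rate, hw, subst_fSeries_zero (hu w)]
      rw [this, one_mul]
      refine Finset.prod_congr (by congr) fun v hv => ?_
      rw [Finset.mem_erase] at hv
      rw [hJ v hv.2 hv.1]
  · simp only [F, hw, map_mul, map_prod]
    simp only [MvPowerSeries.coe_substAlgHom hU, subst_inVar hU]
    congr 1
    · refine Finset.prod_congr rfl fun v hv => ?_
      rw [hI v hv]
      rintro rfl
      simp [mem_part, hw] at hv
    · refine Finset.prod_congr rfl fun v hv => ?_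
      rw [hJ v hv]
      rintro rfl
      simp [mem_part, hw] at hv

theorem subst_F_I1 (hU : MvPowerSeries.HasSubst U) {w : V} (hw : P.kind w = Kind.I1)
    (hν : P.ν w ≠ 0) :
    MvPowerSeries.subst U (P.F w) =
      (P.ν w)⁻¹ • P.baseProd U (fun j => P.ν w * P.a w j) + (1 - (P.ν w)⁻¹) • 1 := by
  rw [baseProd_eq, ← MvPowerSeries.coe_substAlgHom hU]
  simp only [F, hw, if_neg hν, map_add, map_smul, map_mul, map_prod]
  have hC : MvPowerSeries.substAlgHom hU (MvPowerSeries.C (1 - (P.ν w)⁻¹)) =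
      (1 - (P.ν w)⁻¹) • (1 : MvPowerSeries τ R) := by
    rw [← Algebra.algebraMap_eq_smul_one]
    exact (MvPowerSeries.substAlgHom hU).commutes _
  rw [hC]
  simp only [MvPowerSeries.coe_substAlgHom hU, subst_inVar hU]

theorem subst_F_I1_of_eq_zero (hU : MvPowerSeries.HasSubst U) {w : V} (hw : P.kind w = Kind.I1)
    (hν : P.ν w = 0) :
    MvPowerSeries.subst U (P.F w) =
      (∑ j ∈ P.base, P.a w j • (logSeries (P.rate j)).subst (U j)) + 1 := by
  rw [sum_base, ← MvPowerSeries.coe_substAlgHom hU]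
  simp only [F, hw, if_pos hν, map_add, map_smul, map_sum, map_one]
  simp only [MvPowerSeries.coe_substAlgHom hU, subst_inVar hU, MvPowerSeries.subst_X hU]
  congr 2
  · congr 1
    all_goals
      refine Finset.sum_congr rfl fun v hv => ?_
      rw [mem_part] at hv
      simp only [rate, hv]
  · refine Finset.sum_congr rfl fun v hv => ?_
    rw [mem_part] at hv
    simp only [rate, hv, logSeries_zero]
    rw [PowerSeries.subst_X (hU.const_coeff v)]

theorem subst_F_J1 (hU : MvPowerSeries.HasSubst U) {w : V} (hw : P.kind w = Kind.J1) :
    MvPowerSeries.subst U (P.F w) =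
      (P.ν w)⁻¹ • P.baseProd U (fun j => P.b w j - P.slope j) +
        (∑ j ∈ P.part₁ w, P.a w j • U j) + (1 - (P.ν w)⁻¹) • 1 := by
  rw [baseProd_eq, ← MvPowerSeries.coe_substAlgHom hU]
  simp only [F, hw, map_add, map_smul, map_mul, map_prod, map_sum]
  have hC : MvPowerSeries.substAlgHom hU (MvPowerSeries.C (1 - (P.ν w)⁻¹)) =
      (1 - (P.ν w)⁻¹) • (1 : MvPowerSeries τ R) := by
    rw [← Algebra.algebraMap_eq_smul_one]
    exact (MvPowerSeries.substAlgHom hU).commutes _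
  rw [hC]
  simp only [MvPowerSeries.coe_substAlgHom hU, subst_inVar hU, MvPowerSeries.subst_X hU]
  congr 4
  · congr 1
    all_goals
      refine Finset.prod_congr rfl fun v hv => ?_
      rw [mem_part] at hv
      simp only [slope, hv, sub_sub]
  · refine Finset.prod_congr rfl fun v hv => ?_
    rw [mem_part] at hv
    simp only [slope, hv, sub_zero]

end Eval

end FundData

end FundamentalSeries

/-! ### The linearized fundamental system -/

section FundamentalDerivations

open PowerSeries

namespace FundData

variable {K : Type*} [Field K] {V : Type*} [Fintype V] [DecidableEq V] (P : FundData K V)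
  {R : Type*} [CommRing R] [Algebra K R] {Q : Type*} [CommRing Q] [Algebra K Q]

/-- The value at `U` of the series of the vertex `w`. -/
noncomputable def eval (U : V → R⟦X⟧) (w : V) : R⟦X⟧ := MvPowerSeries.subst U (P.F w)

theorem hasSubst_of_constantCoeff {V : Type*} [Finite V] {U : V → R⟦X⟧}
    (hU : ∀ v, constantCoeff (U v) = 0) : MvPowerSeries.HasSubst U :=
  MvPowerSeries.hasSubst_of_constantCoeff_zero hU

theorem map_subst_eq {u : R⟦X⟧} (hu : constantCoeff u = 0) (q : R⟦X⟧ →ₐ[K] Q) (hq : q u = 0)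
    (φ : K⟦X⟧) : q (φ.subst u) = algebraMap K Q (constantCoeff φ) := by
  have hs : HasSubst u := HasSubst.of_constantCoeff_zero' hu
  obtain ⟨ψ, hψ⟩ : (X : K⟦X⟧) ∣ φ - C (constantCoeff φ) := by
    rw [X_dvd_iff]; simp
  rw [sub_eq_iff_eq_add'] at hψ
  rw [hψ, subst_add hs, subst_mul hs, subst_X hs, map_add, map_mul, hq, zero_mul, add_zero,
    ← coe_substAlgHom hs]
  simp only [map_add, map_mul, constantCoeff_X, zero_mul, add_zero, constantCoeff_C]
  exact (congrArg q ((substAlgHom hs).commutes (constantCoeff φ))).trans (q.commutes _)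

theorem map_baseProd {U : V → R⟦X⟧} (hU : ∀ v, constantCoeff (U v) = 0) (q : R⟦X⟧ →ₐ[K] Q)
    (hq : ∀ v, q (U v) = 0) (p : V → K) : q (P.baseProd U p) = 1 := by
  rw [baseProd, map_prod]
  refine Finset.prod_eq_one fun v _ => ?_
  rw [map_subst_eq (hU v) q (hq v), constantCoeff_fSeries, map_one]

/-- All the series of a basic fundamental system have constant term `1`. As `q` need not be
continuous, only finite algebraic identities are transported along it. -/
theorem map_eval {U : V → R⟦X⟧} (hU : ∀ v, constantCoeff (U v) = 0) (q : R⟦X⟧ →ₐ[K] Q)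
    (hq : ∀ v, q (U v) = 0) (w : V) : q (P.eval U w) = 1 := by
  have hs := hasSubst_of_constantCoeff hU
  rcases kind_cases (P := P) w with hw | hw | hw
  · rw [eval, P.subst_F_base hs hw]
    exact P.map_baseProd hU q hq _
  · by_cases hν : P.ν w = 0
    · rw [eval, P.subst_F_I1_of_eq_zero hs hw hν]
      change q (∑ j ∈ P.base, P.a w j • (logSeries (P.rate j)).subst (U j) + 1) = 1
      rw [map_add, map_sum, map_one, Finset.sum_eq_zero, zero_add]
      intro v _
      rw [map_smul, map_subst_eq (hU v) q (hq v), ← coeff_zero_eq_constantCoeff_apply, logSeries,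
        coeff_mk, if_pos rfl, map_zero, smul_zero]
    · rw [eval, P.subst_F_I1 hs hw hν]
      change q (_ • _ + _ • (1 : R⟦X⟧)) = 1
      rw [map_add, map_smul, map_smul, map_one]
      have := P.map_baseProd hU q hq fun j => P.ν w * P.a w j
      rw [this, ← add_smul, add_sub_cancel, one_smul]
  · rw [eval, P.subst_F_J1 hs hw]
    change q (_ • _ + ∑ j ∈ P.part₁ w, P.a w j • U j + _ • (1 : R⟦X⟧)) = 1
    have := P.map_baseProd hU q hq fun j => P.b w j - P.slope j
    rw [map_add, map_add, map_smul, map_smul, map_one, map_sum, Finset.sum_eq_zero, this, add_zero,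
      ← add_smul, add_sub_cancel, one_smul]
    intro v _
    rw [map_smul, hq, smul_zero]

theorem constantCoeff_eval {U : V → R⟦X⟧} (hU : ∀ v, constantCoeff (U v) = 0) (w : V) :
    constantCoeff (P.eval U w) = 1 := by
  have h := P.map_eval hU (Ideal.Quotient.mkₐ K (Ideal.span {(X : R⟦X⟧)}))
    (fun v => Ideal.Quotient.eq_zero_iff_mem.2 (Ideal.mem_span_singleton.2 (X_dvd_iff.2 (hU v)))) w
  have h' : Ideal.Quotient.mk (Ideal.span {(X : R⟦X⟧)}) (P.eval U w) = Ideal.Quotient.mk _ 1 := h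
  rw [Ideal.Quotient.eq, Ideal.mem_span_singleton, X_dvd_iff, map_sub, map_one, sub_eq_zero] at h'
  exact h'

/-- The series obtained by multiplying the coefficient of `Tⁿ` by `c n`. -/
noncomputable def coeffMul (c : ℕ → K) (f : R⟦X⟧) : R⟦X⟧ := PowerSeries.mk fun n => c n • coeff n f

theorem coeffMul_eq {c : ℕ → K} {α γ : K} (h : ∀ n, n ≠ 0 → c n = α * n + γ) (f : R⟦X⟧) :
    coeffMul c f = α • eulerDer K R f + γ • f + (c 0 - γ) • C (constantCoeff f) := by
  ext n
  rw [coeffMul, coeff_mk, map_add, map_add, PowerSeries.coeff_smul, PowerSeries.coeff_smul,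
    PowerSeries.coeff_smul, coeff_eulerDer, coeff_C]
  cases n with
  | zero => simp [← add_smul]
  | succ n =>
    rw [h _ n.succ_ne_zero, if_neg n.succ_ne_zero, smul_zero, add_zero, add_smul, mul_smul]
    congr 2
    rw [Algebra.smul_def, map_natCast]

section Derivation

theorem derivation_smul (δ : Derivation K R⟦X⟧ R⟦X⟧) (c : K) (f : R⟦X⟧) : δ (c • f) = c • δ f :=
  δ.map_smul c f

variable [CharZero K] (q : R⟦X⟧ →ₐ[K] Q) (δ : Derivation K R⟦X⟧ R⟦X⟧) {U : V → R⟦X⟧} {θ : V → Q}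

/-! The next three statements express `δ(F_w(U))` through `F_w(U)` itself and the quantities
`θ_j = δ U_j / (1 - r_j U_j)`, for `j` in `I₀ ∪ J₀ ∪ K₀`, and also through the `δ U_j`, `j ∈ I₁`,
if `w ∈ J₁`. -/

theorem map_derivation_eval_base (hU : ∀ v, constantCoeff (U v) = 0)
    (h : ∀ j ∈ P.base, q (δ (U j)) = q (1 - P.rate j • U j) * θ j) {w : V} (hw : w ∈ P.base) :
    q (δ (P.eval U w)) =
      (∑ j ∈ P.base, (P.slope j - if j = w then P.rate j else 0) • θ j) * q (P.eval U w) := by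
  rw [eval, P.subst_F_base (hasSubst_of_constantCoeff hU) hw]
  exact map_derivation_prod q δ P.base hU h _

theorem map_derivation_eval_I1 (hU : ∀ v, constantCoeff (U v) = 0)
    (h : ∀ j ∈ P.base, q (δ (U j)) = q (1 - P.rate j • U j) * θ j) {w : V}
    (hw : P.kind w = Kind.I1) :
    q (δ (P.eval U w)) =
      (∑ j ∈ P.base, P.a w j • θ j) * (P.ν w • q (P.eval U w) + (1 - P.ν w) • 1) := by
  have hs := hasSubst_of_constantCoeff hU
  by_cases hν : P.ν w = 0
  · rw [eval, P.subst_F_I1_of_eq_zero hs hw hν, hν]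
    change q (δ (∑ j ∈ P.base, P.a w j • (logSeries (P.rate j)).subst (U j) + 1)) = _
    rw [map_add, map_sum, Derivation.map_one_eq_zero, add_zero, map_sum, zero_smul, zero_add,
      sub_zero, one_smul, mul_one]
    refine Finset.sum_congr rfl fun v hv => ?_
    rw [derivation_smul, map_smul, map_derivation_logSeries q δ (hU v) (h v hv)]
  · rw [eval, P.subst_F_I1 hs hw hν]
    set B : R⟦X⟧ := P.baseProd U fun j => P.ν w * P.a w j with hB
    have hd : q (δ B) = (∑ j ∈ P.base, (P.ν w * P.a w j) • θ j) * q B :=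
      map_derivation_prod q δ P.base hU h _
    change q (δ ((P.ν w)⁻¹ • B + (1 - (P.ν w)⁻¹) • (1 : R⟦X⟧))) =
      _ * (P.ν w • q ((P.ν w)⁻¹ • B + (1 - (P.ν w)⁻¹) • (1 : R⟦X⟧)) + (1 - P.ν w) • 1)
    simp only [mul_smul, ← Finset.smul_sum] at hd
    rw [map_add, map_add, derivation_smul, derivation_smul, map_smul, Derivation.map_one_eq_zero,
      smul_zero, map_zero, add_zero, hd, smul_mul_assoc, inv_smul_smul₀ hν, map_add, map_smul,
      map_smul, map_one, smul_add, smul_inv_smul₀ hν, add_assoc, smul_smul, ← add_smul, mul_sub,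
      mul_inv_cancel₀ hν]
    simp

theorem map_derivation_eval_J1 (hU : ∀ v, constantCoeff (U v) = 0)
    (h : ∀ j ∈ P.base, q (δ (U j)) = q (1 - P.rate j • U j) * θ j) {w : V}
    (hw : P.kind w = Kind.J1) :
    q (δ (P.eval U w)) = (∑ j ∈ P.base, (P.b w j - P.slope j) • θ j) *
        (q (P.eval U w) - (∑ j ∈ P.part₁ w, P.a w j • q (U j)) - (1 - (P.ν w)⁻¹) • 1) +
      ∑ j ∈ P.part₁ w, P.a w j • q (δ (U j)) := by
  have hs := hasSubst_of_constantCoeff hU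
  rw [eval, P.subst_F_J1 hs hw]
  set B : R⟦X⟧ := P.baseProd U fun j => P.b w j - P.slope j with hB
  have hd : q (δ B) = (∑ j ∈ P.base, (P.b w j - P.slope j) • θ j) * q B :=
    map_derivation_prod q δ P.base hU h _
  change q (δ ((P.ν w)⁻¹ • B + ∑ j ∈ P.part₁ w, P.a w j • U j + (1 - (P.ν w)⁻¹) • (1 : R⟦X⟧))) =
    _ * (q ((P.ν w)⁻¹ • B + ∑ j ∈ P.part₁ w, P.a w j • U j + (1 - (P.ν w)⁻¹) • (1 : R⟦X⟧)) - _ - _)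
      + _
  simp only [map_add, map_smul, derivation_smul, Derivation.map_one_eq_zero, map_sum, map_one,
    smul_zero, add_zero, hd]
  rw [add_sub_right_comm _ _ (∑ j ∈ P.part₁ w, P.a w j • q (U j)), add_sub_cancel_right,
    add_sub_cancel_right, mul_smul_comm]

/-- If the series of a vertex is not constant, then its linear part is not zero. The linear part is
described here by its effect on derivations, read through a morphism which vanishes on `U`. -/
theorem exists_linear_part (hP : P.IsValid) {w : V} (hw : P.F w ≠ 1) (q : R⟦X⟧ →ₐ[K] Q) :
    ∃ ℓ : V → K, (∃ v, ℓ v ≠ 0) ∧ ∀ (δ : Derivation K R⟦X⟧ R⟦X⟧) (U : V → R⟦X⟧),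
      (∀ v, constantCoeff (U v) = 0) → (∀ v, q (U v) = 0) →
        q (δ (P.eval U w)) = ∑ v, ℓ v • q (δ (U v)) := by
  have key : ∀ (δ : Derivation K R⟦X⟧ R⟦X⟧) (U : V → R⟦X⟧), (∀ v, q (U v) = 0) → ∀ j ∈ P.base,
      q (δ (U j)) = q (1 - P.rate j • U j) * q (δ (U j)) := by
    intro δ U hq j _
    rw [map_sub, map_one, map_smul, hq, smul_zero, sub_zero, one_mul]
  have hX : MvPowerSeries.HasSubst (MvPowerSeries.X : V → MvPowerSeries V K) :=
    MvPowerSeries.HasSubst.X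
  have hself : MvPowerSeries.subst (MvPowerSeries.X : V → MvPowerSeries V K) (P.F w) = P.F w := by
    rw [MvPowerSeries.subst_self]; rfl
  have hone : ∀ p : V → K, (∀ j ∈ P.base, p j = 0) →
      P.baseProd (MvPowerSeries.X : V → MvPowerSeries V K) p = 1 := by
    intro p hp
    refine Finset.prod_eq_one fun j hj => ?_
    rw [hp j hj, subst_fSeries_zero (PowerSeries.HasSubst.X j)]
  have hsum : ∀ (ℓ : V → K) (f : V → Q), ∑ v, (if v ∈ P.base then ℓ v else 0) • f v =
      ∑ v ∈ P.base, ℓ v • f v := by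
    intro ℓ f
    simp only [ite_smul, zero_smul]
    rw [Finset.sum_ite_mem, Finset.univ_inter]
  rcases kind_cases (P := P) w with hk | hk | hk
  · refine ⟨fun j => if j ∈ P.base then P.slope j - if j = w then P.rate j else 0 else 0, ?_, ?_⟩
    · by_contra! h
      refine hw ?_
      rw [← hself, P.subst_F_base hX hk]
      exact hone _ fun j hj => by simpa [hj] using h j
    · intro δ U hU hq
      rw [P.map_derivation_eval_base q δ hU (key δ U hq) hk, P.map_eval hU q hq, mul_one]
      exact (hsum (fun j => P.slope j - if j = w then P.rate j else 0) _).symm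
  · refine ⟨fun j => if j ∈ P.base then P.a w j else 0, ?_, ?_⟩
    · by_contra! h
      have h' : ∀ j ∈ P.base, P.a w j = 0 := fun j hj => by simpa [hj] using h j
      refine hw ?_
      by_cases hν : P.ν w = 0
      · rw [← hself, P.subst_F_I1_of_eq_zero hX hk hν, Finset.sum_eq_zero, zero_add]
        intro j hj
        rw [h' j hj, zero_smul]
      · rw [← hself, P.subst_F_I1 hX hk hν, hone _ fun j hj => by rw [h' j hj, mul_zero], ← add_smul,
          add_sub_cancel, one_smul]
    · intro δ U hU hq
      rw [P.map_derivation_eval_I1 q δ hU (key δ U hq) hk, P.map_eval hU q hq, ← add_smul,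
        add_sub_cancel, one_smul, mul_one]
      exact (hsum (P.a w) _).symm
  · refine ⟨fun j => (if j ∈ P.base then (P.ν w)⁻¹ * (P.b w j - P.slope j) else 0) +
      if j ∈ P.part₁ w then P.a w j else 0, ?_, ?_⟩
    · obtain ⟨v, hv⟩ := hP.J1_nonempty w (P.mem_part.2 hk)
      refine ⟨v, ?_⟩
      have hv' := hv
      rw [mem_part₁] at hv'
      have hv2 := P.notMem_base_of_I1 hv'.1
      simpa [hv, hv2] using hv'.2
    · intro δ U hU hq
      rw [P.map_derivation_eval_J1 q δ hU (key δ U hq) hk, P.map_eval hU q hq]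
      simp only [add_smul, Finset.sum_add_distrib]
      rw [hsum]
      congr 1
      · rw [Finset.sum_eq_zero (s := P.part₁ w) fun j _ => by rw [hq, smul_zero], sub_zero]
        simp only [mul_smul]
        rw [← Finset.smul_sum, sub_smul, one_smul, sub_sub_cancel, mul_smul_comm, mul_one]
      · simp only [ite_smul, zero_smul]
        rw [Finset.sum_ite_mem, Finset.univ_inter]

/-- The structure coefficients `λ_n^{(w,u)}`, `n ≥ 1`, of a basic fundamental system. Those of the
dilated system are the `λ_n^{(π(x),π(y))}`, up to the factors of the change of variables. -/
noncomputable def structCoeff (w u : V) (n : ℕ) : K :=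
  open Classical in
  if u ∈ P.base then
    if w ∈ P.base then P.slope u * n - if w = u then P.rate u else 0
    else if P.kind w = Kind.I1 then
      if n = 1 then P.a w u else P.slope u * (n - 1) + P.ν w * P.a w u
    else
      if n = 1 then (P.b w u - P.slope u) * (P.ν w)⁻¹ else P.slope u * (n - 2) + P.b w u
  else if P.kind w = Kind.J1 ∧ u ∈ P.part₁ w ∧ n = 1 then P.a w u else 0

/-- The structure coefficients solve the linearized system. The terms in the slope cancel because
`D - b_u c (T d/dT)` is a derivation, whose value at `U_j`, for `j` in `I₀ ∪ J₀ ∪ K₀`, vanishes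
unless `j = u`. -/
theorem map_derivation_eval (hP : P.IsValid) (hU : ∀ v, constantCoeff (U v) = 0)
    (D : Derivation K R⟦X⟧ R⟦X⟧) (c : R⟦X⟧) (u : V)
    (h : ∀ v, q (D (U v)) =
      q (c * ((if v = u then 1 else 0) + coeffMul (P.structCoeff v u) (U v)))) (w : V) :
    q (D (P.eval U w)) = q (c * coeffMul (fun n => P.structCoeff w u (n + 1)) (P.eval U w)) := by
  -- for `n` large the coefficients are affine in `n`, and their linear part is an Euler derivation
  set δ : Derivation K R⟦X⟧ R⟦X⟧ := D - (P.slope u • c) • eulerDer K R with hδ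
  have hD : ∀ f, q (D f) = q (δ f) + P.slope u • (q c * q (eulerDer K R f)) := by
    intro f
    have : D f = δ f + P.slope u • (c * eulerDer K R f) := by
      rw [hδ, Derivation.sub_apply, Derivation.smul_apply, smul_eq_mul, smul_mul_assoc,
        sub_add_cancel]
    rw [this, map_add, map_smul, map_mul]
  have hC : ∀ v, C (constantCoeff (U v)) = (0 : R⟦X⟧) := fun v => by rw [hU, map_zero]
  have h1 : ∀ j ∈ P.base, q (δ (U j)) =
      q (1 - P.rate j • U j) * (if j = u then q c else 0) := by
    intro j hj
    have hj1 := hD (U j)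
    by_cases hu : u ∈ P.base
    · rw [h j, coeffMul_eq (α := P.slope u) (γ := - if j = u then P.rate u else 0)
        (fun n _ => by simp [structCoeff, hu, hj, sub_eq_add_neg]), hC] at hj1
      rw [← sub_eq_iff_eq_add] at hj1
      rw [← hj1]
      split_ifs with e
      · subst e
        simp only [map_add, map_mul, map_smul, map_one, map_sub, smul_zero, add_zero]
        simp only [Algebra.smul_def, map_neg]
        ring
      · simp only [map_mul, map_smul, smul_zero, add_zero, zero_add, neg_zero,
          zero_smul, mul_zero, mul_smul_comm, sub_self]
    · have hju : j ≠ u := fun e => hu (e ▸ hj)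
      have hkj : P.kind j ≠ Kind.J1 := by rw [mem_base] at hj; rintro e; simp [e] at hj
      rw [h j, if_neg hju, P.slope_of_notMem hu, zero_smul, add_zero] at hj1
      rw [← hj1, if_neg hju, mul_zero]
      have : coeffMul (P.structCoeff j u) (U j) = 0 := by
        ext n
        simp [coeffMul, structCoeff, hu, hkj]
      rw [this, add_zero, mul_zero, map_zero]
  have hsum : ∀ p : V → K, ∑ j ∈ P.base, p j • (if j = u then q c else 0) =
      if u ∈ P.base then p u • q c else 0 := by
    intro p
    simp only [smul_ite, smul_zero]
    rw [Finset.sum_ite_eq']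
  have h1' : (C (constantCoeff (P.eval U w)) : R⟦X⟧) = 1 := by
    rw [P.constantCoeff_eval hU, map_one]
  rw [hD]
  rcases kind_cases (P := P) w with hk | hk | hk
  · rw [P.map_derivation_eval_base q δ hU h1 hk, hsum]
    by_cases hu : u ∈ P.base
    · rw [coeffMul_eq (α := P.slope u) (γ := P.slope u - if w = u then P.rate u else 0)
        (fun n _ => by simp only [structCoeff, hu, hk, if_true]; push_cast; ring), if_pos hu]
      have : P.structCoeff w u (0 + 1) - (P.slope u - if w = u then P.rate u else 0) = 0 := by
        simp [structCoeff, hu, hk]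
      rw [this, zero_smul, add_zero, map_mul, map_add, map_smul, map_smul]
      simp only [Algebra.smul_def, eq_comm (a := u)]
      ring
    · have hkw : P.kind w ≠ Kind.J1 := by rw [mem_base] at hk; rintro e; simp [e] at hk
      have : coeffMul (fun n => P.structCoeff w u (n + 1)) (P.eval U w) = 0 := by
        ext n
        simp [coeffMul, structCoeff, hu, hkw]
      rw [this, if_neg hu, P.slope_of_notMem hu]
      simp
  · have hw := P.notMem_base_of_I1 hk
    rw [P.map_derivation_eval_I1 q δ hU h1 hk, hsum]
    by_cases hu : u ∈ P.base
    · rw [coeffMul_eq (α := P.slope u) (γ := P.ν w * P.a w u)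
        (fun n hn => by simp [structCoeff, hu, hw, hk, hn]), if_pos hu, h1']
      have : P.structCoeff w u (0 + 1) = P.a w u := by simp [structCoeff, hu, hk, hw]
      rw [this, map_mul, map_add, map_add, map_smul, map_smul, map_smul, map_one]
      simp only [Algebra.smul_def, map_sub, map_mul, map_one]
      ring
    · have : coeffMul (fun n => P.structCoeff w u (n + 1)) (P.eval U w) = 0 := by
        ext n
        simp [coeffMul, structCoeff, hu, hk]
      rw [this, if_neg hu, P.slope_of_notMem hu]
      simp
  · have hw := P.notMem_base_of_J1 hk
    rw [P.map_derivation_eval_J1 q δ hU h1 hk, hsum]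
    have hmem : ∀ v, v ∈ P.part₁ w → P.kind v = Kind.I1 := fun v hv => (P.mem_part₁.1 hv).1
    have hnb : ∀ v, v ∈ P.part₁ w → v ∉ P.base := fun v hv => P.notMem_base_of_I1 (hmem v hv)
    by_cases hu : u ∈ P.base
    · rw [coeffMul_eq (α := P.slope u) (γ := P.b w u - P.slope u)
        (fun n hn => by simp [structCoeff, hu, hw, hk, hn]; ring), if_pos hu, h1']
      have : P.structCoeff w u (0 + 1) = (P.b w u - P.slope u) * (P.ν w)⁻¹ := by
        simp [structCoeff, hu, hk, hw]
      -- the coefficients `λ_n^{(v,u)}`, `v ∈ I₁^{(w)}`, are affine in `n` because `ν_v = 1`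
      have hv : ∀ v ∈ P.part₁ w, q (δ (U v)) = (P.b w u - P.slope u) • (q c * q (U v)) := by
        intro v hv
        have hv1 := hD (U v)
        have hvu : v ≠ u := fun e => hnb v hv (e ▸ hu)
        have hb : P.b w u = P.a v u := hP.J1_b w (P.mem_part.2 hk) v hv u hu
        have hν : P.ν v = 1 := hP.J1_ν_eq w (P.mem_part.2 hk) v hv
        have hs : ∀ n, n ≠ 0 → P.structCoeff v u n = P.slope u * n + (P.b w u - P.slope u) := by
          intro n _
          simp only [structCoeff, hu, hnb v hv, hmem v hv, if_true, if_false, hν, hb]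
          split_ifs with e
          · subst e; simp
          · ring
        rw [h v, if_neg hvu, zero_add, coeffMul_eq hs, hC, smul_zero, add_zero,
          ← sub_eq_iff_eq_add] at hv1
        rw [← hv1, map_mul, map_add, map_smul, map_smul]
        simp only [Algebra.smul_def]
        ring
      have hv' : ∑ v ∈ P.part₁ w, P.a w v • q (δ (U v)) =
          (P.b w u - P.slope u) • (q c * ∑ v ∈ P.part₁ w, P.a w v • q (U v)) := by
        rw [Finset.mul_sum, Finset.smul_sum]
        refine Finset.sum_congr rfl fun v hv' => ?_
        rw [hv v hv', smul_comm, ← mul_smul_comm]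
      rw [this, hv', map_mul, map_add, map_add, map_smul, map_smul, map_smul, map_one]
      simp only [Algebra.smul_def, map_sub, map_mul, map_one]
      ring
    · have hv : ∀ v ∈ P.part₁ w, P.a w v • q (δ (U v)) = if v = u then P.a w u • q c else 0 := by
        intro v hv
        have hv1 := hD (U v)
        rw [P.slope_of_notMem hu, zero_smul, add_zero, h v] at hv1
        have : coeffMul (P.structCoeff v u) (U v) = 0 := by
          ext n
          simp [coeffMul, structCoeff, hu, hmem v hv]
        rw [← hv1, this, add_zero]
        split_ifs with e
        · rw [mul_one, e]
        · simp
      rw [if_neg hu, zero_mul, zero_add, P.slope_of_notMem hu, zero_smul, add_zero,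
        Finset.sum_congr rfl hv, Finset.sum_ite_eq']
      split_ifs with hu1
      · rw [coeffMul_eq (α := 0) (γ := 0) (fun n hn => by simp [structCoeff, hu, hn]), h1']
        have : P.structCoeff w u (0 + 1) = P.a w u := by simp [structCoeff, hu, hk, hu1]
        rw [this]
        simp
      · have : coeffMul (fun n => P.structCoeff w u (n + 1)) (P.eval U w) = 0 := by
          ext n
          simp [coeffMul, structCoeff, hu, hu1]
        rw [this]
        simp

end Derivation

end FundData

end FundamentalDerivations

/-! ### The generators of a fundamental system and their derivations -/

section Presentation

open PowerSeries

/-- A presentation of a system as obtained from a basic fundamental system by a dilatation and a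
change of variables. -/
structure FundPres {K : Type*} [Field K] {I : Type*} (S : SDSE K I) (V : Type*) [Fintype V]
    [DecidableEq V] where
  P : FundData K V
  π : I → V
  κ : I → K
  μ : I → K
  valid : P.IsValid
  surj : Function.Surjective π
  κ_ne : ∀ x, κ x ≠ 0
  μ_ne : ∀ x, μ x ≠ 0
  F_eq : S.F = changeVar κ μ (dilate π P.F)

namespace FundPres

variable {K : Type*} [Field K] {I : Type*} [Fintype I] {S : SDSE K I} {V : Type*} [Fintype V]
  [DecidableEq V] (T : FundPres S V)

/-- The series `U_v = ∑_{π(y) = v} κ_y X_y` which the variable `h_v` of the basic fundamental system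
stands for. -/
noncomputable def U (v : V) : (TreeAlg K I)⟦X⟧ :=
  ∑ y, if T.π y = v then T.κ y • PowerSeries.mk (S.X y) else 0

theorem coeff_U (v : V) (n : ℕ) :
    coeff n (T.U v) = ∑ y, if T.π y = v then T.κ y • S.X y n else 0 := by
  rw [U, map_sum]
  refine Finset.sum_congr rfl fun y _ => ?_
  split_ifs <;> simp

theorem constantCoeff_U (v : V) : constantCoeff (T.U v) = 0 := by
  rw [← coeff_zero_eq_constantCoeff_apply, coeff_U]
  simp [S.isSolution_X.zero]

theorem hasSubst_dilate : MvPowerSeries.HasSubst fun v =>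
    ∑ᶠ (y : I) (_ : T.π y = v), (MvPowerSeries.X y : MvPowerSeries I K) := by
  refine MvPowerSeries.hasSubst_of_constantCoeff_zero fun v => ?_
  rw [finsum_eq_sum_of_fintype, map_sum]
  refine Finset.sum_eq_zero fun y _ => ?_
  rw [finsum_eq_if]
  split_ifs <;> simp

theorem hasSubst_changeVar :
    MvPowerSeries.HasSubst fun y => T.κ y • (MvPowerSeries.X y : MvPowerSeries I K) :=
  MvPowerSeries.hasSubst_of_constantCoeff_zero fun v => by simp

theorem evalSeries_eq (x : I) :
    evalSeries (S.F x) S.X = T.μ x • T.P.eval T.U (T.π x) := by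
  have hX := hasSubst_mk S.isSolution_X.zero
  have h1 := T.hasSubst_dilate
  have h2 := T.hasSubst_changeVar
  have h3 : MvPowerSeries.HasSubst fun v => MvPowerSeries.subst
      (fun y => T.κ y • (MvPowerSeries.X y : MvPowerSeries I K))
      (∑ᶠ (y : I) (_ : T.π y = v), (MvPowerSeries.X y : MvPowerSeries I K)) := by
    simpa only [MvPowerSeries.coe_substAlgHom] using h1.comp h2
  rw [evalSeries, T.F_eq, changeVar, dilate, MvPowerSeries.subst_smul hX,
    MvPowerSeries.subst_comp_subst_apply h1 h2,
    MvPowerSeries.subst_comp_subst_apply h3 hX, FundData.eval]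
  congr 2
  funext v
  rw [finsum_eq_sum_of_fintype, ← MvPowerSeries.coe_substAlgHom h2, map_sum,
    ← MvPowerSeries.coe_substAlgHom hX, map_sum, U]
  refine Finset.sum_congr rfl fun y _ => ?_
  rw [finsum_eq_if]
  split_ifs
  · rw [MvPowerSeries.substAlgHom_X, map_smul, MvPowerSeries.substAlgHom_X]
  · rw [map_zero, map_zero]

theorem X_succ (x : I) (n : ℕ) :
    S.X x (n + 1) = T.μ x • graft K x (coeff n (T.P.eval T.U (T.π x))) := by
  rw [S.isSolution_X.succ, T.evalSeries_eq, PowerSeries.coeff_smul, map_smul]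

theorem F_ne_one (x : I) : T.P.F (T.π x) ≠ 1 := by
  intro h
  have h1 := T.hasSubst_dilate
  have h2 := T.hasSubst_changeVar
  refine S.nonconstant x (T.μ x) ?_
  rw [T.F_eq, changeVar, dilate, h, ← MvPowerSeries.coe_substAlgHom h1, map_one,
    ← MvPowerSeries.coe_substAlgHom h2, map_one, MvPowerSeries.smul_eq_C_mul, mul_one]

end FundPres

namespace SDSE

variable {K : Type*} [Field K] {I : Type*} [Finite I] (S : SDSE K I)

theorem exists_root_of_coeff_X_ne_zero {x : I} {n : ℕ} {u : RTree I →₀ ℕ}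
    (h : MvPolynomial.coeff u (S.X x n) ≠ 0) :
    ∃ t : RTree I, t.root = x ∧ u = Finsupp.single t 1 := by
  cases n with
  | zero => rw [S.isSolution_X.zero] at h; simp at h
  | succ n => rw [S.isSolution_X.succ] at h; exact coeff_graft_ne_zero h

theorem coeff_X_of_root_ne {x : I} {n : ℕ} {t : RTree I} (h : t.root ≠ x) :
    MvPolynomial.coeff (Finsupp.single t 1) (S.X x n) = 0 := by
  by_contra hc
  obtain ⟨t', h1, h2⟩ := S.exists_root_of_coeff_X_ne_zero hc
  rw [Finsupp.single_left_inj one_ne_zero] at h2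
  exact h (h2 ▸ h1)

theorem counit_X (x : I) (n : ℕ) : counitHom K I (S.X x n) = 0 := by
  cases n with
  | zero => rw [S.isSolution_X.zero, map_zero]
  | succ n => rw [S.isSolution_X.succ, counitHom_graft]

end SDSE

namespace FundPres

variable {K : Type*} [Field K] [CharZero K] {I : Type*} [Fintype I] {S : SDSE K I} {V : Type*}
  [Fintype V] [DecidableEq V]

/-- No generator `X_x(n)` of a fundamental system vanishes: the linear part of `F_x` is not zero,
and a tree `t` of `X_y(n)` gives, grafted on a root decorated by `x`, a tree of `X_x(n + 1)`. -/
theorem X_ne_zero (T : FundPres S V) (n : ℕ) (x : I) : S.X x (n + 1) ≠ 0 := by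
  induction n generalizing x with
  | zero =>
    rw [T.X_succ, coeff_zero_eq_constantCoeff_apply, T.P.constantCoeff_eval T.constantCoeff_U]
    exact smul_ne_zero (T.μ_ne x) (graft_ne_zero x one_ne_zero)
  | succ n ih =>
    rw [T.X_succ]
    refine smul_ne_zero (T.μ_ne x) (graft_ne_zero x fun h0 => ?_)
    -- apply to the coefficients the form `ε ∘ ∂/∂t`, the coefficient of the tree `t`
    let q : (TreeAlg K I)⟦X⟧ →ₐ[K] K⟦X⟧ := PowerSeries.mapAlgHom (counitHom K I)
    have hq : ∀ f n, coeff n (q f) = counitHom K I (coeff n f) := fun f n => by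
      rw [PowerSeries.mapAlgHom_apply, coeff_map]; rfl
    obtain ⟨ℓ, ⟨v, hv⟩, hℓ⟩ := T.P.exists_linear_part (R := TreeAlg K I) T.valid (T.F_ne_one x) q
    obtain ⟨y, rfl⟩ := T.surj v
    obtain ⟨u, hu⟩ := MvPolynomial.ne_zero_iff.1 (ih y)
    obtain ⟨t, ht, rfl⟩ := S.exists_root_of_coeff_X_ne_zero hu
    have h := hℓ (coeffDer (MvPolynomial.pderiv t)) T.U T.constantCoeff_U ?_
    · have h' := congrArg (coeff (n + 1)) h
      have hz : ∀ z, counitHom K I (MvPolynomial.pderiv t (S.X z (n + 1))) =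
          MvPolynomial.coeff (Finsupp.single t 1) (S.X z (n + 1)) := fun z => by
        rw [← lcoeff_eq_counit_pderiv, MvPolynomial.lcoeff_apply]
      have hU : ∀ v, counitHom K I (MvPolynomial.pderiv t (coeff (n + 1) (T.U v))) =
          if T.π y = v then T.κ y * MvPolynomial.coeff (Finsupp.single t 1) (S.X y (n + 1))
            else 0 := by
        intro v
        rw [coeff_U, map_sum, map_sum, Finset.sum_eq_single y]
        · split_ifs
          · rw [(MvPolynomial.pderiv t).map_smul, map_smul, hz, smul_eq_mul]
          · simp
        · intro z _ hzy
          split_ifs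
          · rw [(MvPolynomial.pderiv t).map_smul, map_smul, hz,
              S.coeff_X_of_root_ne (by rw [ht]; exact hzy.symm), smul_zero]
          · simp
        · simp
      rw [hq, coeff_coeffDer, h0, map_zero, map_zero, map_sum] at h'
      simp only [PowerSeries.coeff_smul, hq, coeff_coeffDer, hU,
        smul_eq_mul, mul_ite, mul_zero, Finset.sum_ite_eq, Finset.mem_univ, if_true] at h'
      exact mul_ne_zero hv (mul_ne_zero (T.κ_ne y) hu) h'.symm
    · intro v
      ext n
      rw [hq, coeff_U, map_sum, map_zero]
      refine Finset.sum_eq_zero fun y _ => ?_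
      split_ifs
      · rw [map_smul, S.counit_X, smul_zero]
      · rw [map_zero]

/-- The structure coefficients of a fundamental system give the derivation `(f ⊗ Id) ∘ Δ`, for an
infinitesimal form `f` whose only nonzero value on the generators is its value `a` on `X_j(k)`. -/
theorem formDer_X (T : FundPres S V) {f : TreeAlg K I →ₗ[K] K} (hf : IsInfinitesimal f) {a : K}
    {j : I} {k : ℕ} (hk : k ≠ 0) (hj : f (S.X j k) = a)
    (h0 : ∀ x n, (x ≠ j ∨ n ≠ k) → f (S.X x n) = 0)
    (x : I) (n : ℕ) : formDer hf (S.X x n) =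
      f (S.X x n) • 1 +
        if k < n then (a * (T.κ j * T.P.structCoeff (T.π x) (T.π j) (n - k))) • S.X x (n - k)
          else 0 := by
  classical
  set c : (TreeAlg K I)⟦X⟧ := (a * T.κ j) • X ^ k with hc
  have hcoeff : ∀ (g : (TreeAlg K I)⟦X⟧) m, coeff m (c * g) =
      if k ≤ m then (a * T.κ j) • coeff (m - k) g else 0 := by
    intro g m
    rw [hc, smul_mul_assoc, PowerSeries.coeff_smul, coeff_X_pow_mul']
    split_ifs <;> simp
  set D := coeffDer (formDer hf) with hD
  suffices H : ∀ N x, ∀ n < N, formDer hf (S.X x n) = f (S.X x n) • 1 +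
      if k < n then (a * (T.κ j * T.P.structCoeff (T.π x) (T.π j) (n - k))) • S.X x (n - k)
        else 0 from H (n + 1) x n (Nat.lt_succ_self n)
  intro N
  induction N with
  | zero => intro x n hn; omega
  | succ N ih =>
    intro x n hn
    cases n with
    | zero => rw [S.isSolution_X.zero]; simp
    | succ n =>
      have hnN : n < N := by omega
      -- the induction hypothesis holds modulo `T ^ N`, and grafting gains one degree
      let q := Ideal.Quotient.mkₐ K (Ideal.span {(X : (TreeAlg K I)⟦X⟧) ^ N})
      have hq : ∀ g g', q g = q g' ↔ ∀ m < N, coeff m g = coeff m g' := by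
        intro g g'
        have : q g = q g' ↔ (X : (TreeAlg K I)⟦X⟧) ^ N ∣ g - g' := by
          rw [← Ideal.mem_span_singleton, ← Ideal.Quotient.eq]; rfl
        rw [this, X_pow_dvd_iff]
        simp only [map_sub, sub_eq_zero]
      have hU : ∀ v, q (D (T.U v)) = q (c * ((if v = T.π j then 1 else 0) +
          FundData.coeffMul (T.P.structCoeff v (T.π j)) (T.U v))) := by
        intro v
        rw [hq]
        intro m hm
        rw [hcoeff, map_add, FundData.coeffMul, coeff_mk, hD, coeff_coeffDer, coeff_U, coeff_U,
          map_sum]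
        have e : ∀ y, formDer hf (if T.π y = v then T.κ y • S.X y m else 0) =
            (if T.π y = v then T.κ y * f (S.X y m) else 0) • 1 +
              if k < m then (a * (T.κ j * T.P.structCoeff v (T.π j) (m - k))) •
                (if T.π y = v then T.κ y • S.X y (m - k) else 0) else 0 := by
          intro y
          split_ifs with h1 h2
          · rw [(formDer hf).map_smul, ih y m hm, if_pos h2, smul_add, smul_smul, h1, smul_comm]
          · rw [(formDer hf).map_smul, ih y m hm, if_neg h2, smul_add, smul_smul, smul_zero]
          · simp
          · simp
        have e1 : ∑ y, (if T.π y = v then T.κ y * f (S.X y m) else 0) =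
            if v = T.π j ∧ m = k then a * T.κ j else 0 := by
          rw [Finset.sum_eq_single j]
          · by_cases hm : m = k
            · rw [hm, hj, mul_comm]
              simp only [and_true, eq_comm]
            · rw [h0 j m (Or.inr hm), mul_zero, ite_self, if_neg fun h => hm h.2]
          · intro y _ hy
            rw [h0 y m (Or.inl hy), mul_zero, ite_self]
          · simp
        rw [Finset.sum_congr rfl fun y _ => e y, Finset.sum_add_distrib, ← Finset.sum_smul, e1]
        rcases lt_trichotomy m k with hmk | rfl | hmk
        · simp [hmk.not_gt, hmk.ne, hmk.not_ge]
        · simp only [and_true, lt_irrefl, Finset.sum_const_zero, add_zero, le_refl, if_true,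
            Nat.sub_self, S.isSolution_X.zero, smul_zero, ite_self]
          split_ifs <;> simp
        · have : coeff (m - k) (if v = T.π j then 1 else 0 : (TreeAlg K I)⟦X⟧) = 0 := by
            split_ifs
            · rw [coeff_one, if_neg (by omega)]
            · exact map_zero _
          rw [if_neg fun h => hmk.ne' h.2, this]
          simp only [hmk, hmk.le, if_true, zero_smul, zero_add]
          rw [← Finset.smul_sum, smul_smul, mul_assoc]
      have h := (hq _ _).1 (T.P.map_derivation_eval q T.valid T.constantCoeff_U D c (T.π j) hU
        (T.π x)) n hnN
      rw [hcoeff, FundData.coeffMul, coeff_mk, hD, coeff_coeffDer] at h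
      have e : S.X x (n + 1) = graft K x (T.μ x • coeff n (T.P.eval T.U (T.π x))) := by
        rw [T.X_succ, map_smul]
      rw [e, formDer_graft, ← e, (formDer hf).map_smul, h]
      congr 1
      by_cases hkn : k ≤ n
      · rw [if_pos hkn, if_pos (by omega), show n + 1 - k = n - k + 1 by omega, T.X_succ]
        simp only [map_smul, smul_smul]
        congr 1
        ring
      · rw [if_neg hkn, if_neg (by omega), smul_zero, map_zero]

end FundPres

end Presentation

/-! ### The basis of the Lie algebra dual to the generators -/

section DualBasis

namespace HopfSDSE

variable {K : Type*} [Field K] {I : Type*} [Finite I] (S : HopfSDSE K I)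

/-- The generators `X_x(n)` of the Hopf algebra of the system. -/
noncomputable def gen (x : I) (n : ℕ) : S.A :=
  ⟨S.X x n, Algebra.subset_adjoin ⟨(x, n), rfl⟩⟩

theorem gen_zero (x : I) : S.gen x 0 = 0 := Subtype.ext (S.isSolution_X.zero x)

/-- A primitive form vanishes on products of elements of the augmentation ideal, and is determined
by its values on the generators. -/
theorem eq_zero_of_gen {f : S.A →ₗ[K] K} (hf : S.IsPrimitive f)
    (h : ∀ x n, f (S.gen x n) = 0) : f = 0 := by
  have h1 : f 1 = 0 := by
    have h2 := hf 1 1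
    have h3 : Coalgebra.counit (R := K) (1 : S.A) = 1 := map_one S.counitA
    rw [mul_one, h3, mul_one, one_mul] at h2
    simpa using h2
  have key : ∀ (x : TreeAlg K I) (hx : x ∈ S.subalgebra), f ⟨x, hx⟩ = 0 := by
    intro x hx
    induction hx using Algebra.adjoin_induction with
    | mem x hx => obtain ⟨⟨x, n⟩, rfl⟩ := hx; exact h x n
    | algebraMap c =>
      have : (⟨algebraMap K _ c, Subalgebra.algebraMap_mem _ c⟩ : S.A) = c • 1 :=
        Subtype.ext (Algebra.algebraMap_eq_smul_one c)
      exact (congrArg f this).trans (by rw [map_smul, h1, smul_zero])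
    | add x y hx hy hx' hy' =>
      exact (map_add f ⟨x, hx⟩ ⟨y, hy⟩).trans (by rw [hx', hy', add_zero])
    | mul x y hx hy hx' hy' =>
      exact (hf ⟨x, hx⟩ ⟨y, hy⟩).trans (by rw [hx', hy', zero_mul, mul_zero, add_zero])
  exact LinearMap.ext fun x => key x x.2

/-- The value of an element of the Lie algebra on a generator `X_x(n)`. -/
noncomputable def coord (x : I) (n : ℕ) : S.lieAlg →ₗ[K] K where
  toFun f := f.1.ofConv (S.gen x n)
  map_add' _ _ := rfl
  map_smul' _ _ := rfl

theorem lieAlg_ext {f g : S.lieAlg}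
    (h : ∀ x n, f.1.ofConv (S.gen x n) = g.1.ofConv (S.gen x n)) : f = g := by
  rw [← sub_eq_zero]
  refine Subtype.ext ?_
  have h0 : (f - g : S.lieAlg).1.ofConv = 0 :=
    S.eq_zero_of_gen (f - g).2.1 fun x n => sub_eq_zero.2 (h x n)
  exact congrArg WithConv.toConv h0

/-- The primitive element of the graded dual given by an infinitesimal form on the algebra of
trees. -/
noncomputable def ofForm (f : TreeAlg K I →ₗ[K] K) (hf : IsInfinitesimal f)
    (hf' : ∃ N : ℕ, ∀ n > N, ∀ x ∈ homog K I n, f x = 0) : S.lieAlg :=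
  ⟨WithConv.toConv (f ∘ₗ S.A.val.toLinearMap), fun x y => hf x y, by
    obtain ⟨N, hN⟩ := hf'
    exact ⟨N, fun n hn x hx => hN n hn x hx⟩⟩

/-- The convolution product `f * g` is `g ∘ (f ⊗ Id) ∘ Δ`. -/
theorem mul'_map_comulA (f g : TreeAlg K I →ₗ[K] K) (x : S.A) :
    LinearMap.mul' K K (TensorProduct.map (f ∘ₗ S.A.val.toLinearMap) (g ∘ₗ S.A.val.toLinearMap)
      (S.comulA x)) = g (TensorProduct.lid K (TreeAlg K I)
        (LinearMap.rTensor (TreeAlg K I) f (comulHom K I x))) := by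
  rw [← S.tensorSq_comulA]
  generalize S.comulA x = u
  induction u with
  | zero => simp
  | add u v hu hv => simp only [map_add, hu, hv]
  | tmul a b => simp [tensorSq]

theorem lie_ofForm_apply {f g : TreeAlg K I →ₗ[K] K} (hf : IsInfinitesimal f)
    (hg : IsInfinitesimal g) (hf' : ∃ N : ℕ, ∀ n > N, ∀ x ∈ homog K I n, f x = 0)
    (hg' : ∃ N : ℕ, ∀ n > N, ∀ x ∈ homog K I n, g x = 0) (x : I) (n : ℕ) :
    (⁅S.ofForm f hf hf', S.ofForm g hg hg'⁆ : S.lieAlg).1.ofConv (S.gen x n) =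
      g (formDer hf (S.X x n)) - f (formDer hg (S.X x n)) :=
  congrArg₂ (· - ·) (S.mul'_map_comulA f g (S.gen x n)) (S.mul'_map_comulA g f (S.gen x n))

end HopfSDSE

section Basis

variable {K : Type*} [Field K] [CharZero K] {I : Type*} [Fintype I] {V : Type*}
  [Fintype V] [DecidableEq V]

/-- The linear forms dual to the generators are multiples of coefficients of trees, since the root
and the number of vertices of a tree determine the only generator in which it can occur. -/
theorem FundPres.exists_dual {S : SDSE K I} (T : FundPres S V) (x : I) (k : ℕ+) :
    ∃ f : TreeAlg K I →ₗ[K] K, IsInfinitesimal f ∧ f (S.X x k) = 1 ∧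
      (∀ n ≠ (k : ℕ), ∀ z ∈ homog K I n, f z = 0) ∧
        ∀ y n, (y ≠ x ∨ n ≠ (k : ℕ)) → f (S.X y n) = 0 := by
  obtain ⟨n, hn⟩ : ∃ n, (k : ℕ) = n + 1 := Nat.exists_eq_succ_of_ne_zero k.ne_zero
  obtain ⟨u, hu⟩ := MvPolynomial.ne_zero_iff.1 (T.X_ne_zero n x)
  rw [← hn] at hu
  obtain ⟨t, ht, rfl⟩ := S.exists_root_of_coeff_X_ne_zero hu
  have hw := (S.isSolution_X.homog x k) hu
  have hdeg : ∀ n ≠ (k : ℕ), ∀ z ∈ homog K I n, MvPolynomial.coeff (Finsupp.single t 1) z = 0 := by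
    intro n hn z hz
    by_contra hc
    exact hn ((hz hc).symm.trans hw)
  refine ⟨(MvPolynomial.coeff (Finsupp.single t 1) (S.X x k))⁻¹ •
    MvPolynomial.lcoeff K (Finsupp.single t 1), (isInfinitesimal_lcoeff t).smul _, ?_, ?_, ?_⟩
  · rw [LinearMap.smul_apply, MvPolynomial.lcoeff_apply, smul_eq_mul, inv_mul_cancel₀ hu]
  · intro n hn z hz
    rw [LinearMap.smul_apply, MvPolynomial.lcoeff_apply, hdeg n hn z hz, smul_zero]
  · rintro y n (h | h)
    · rw [LinearMap.smul_apply, MvPolynomial.lcoeff_apply,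
        S.coeff_X_of_root_ne (fun e => h (e.symm.trans ht)), smul_zero]
    · rw [LinearMap.smul_apply, MvPolynomial.lcoeff_apply,
        hdeg n h _ (S.isSolution_X.homog y n), smul_zero]

namespace FundPres

variable {S : HopfSDSE K I} (T : FundPres S.toSDSE V)

/-- A linear form on the algebra of trees whose value is `1` on `X_x(k)` and `0` on the other
generators. -/
noncomputable def dual (x : I) (k : ℕ+) : TreeAlg K I →ₗ[K] K := (T.exists_dual x k).choose

theorem isInfinitesimal_dual (x : I) (k : ℕ+) : IsInfinitesimal (T.dual x k) :=
  (T.exists_dual x k).choose_spec.1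

theorem dual_X_self (x : I) (k : ℕ+) : T.dual x k (S.X x k) = 1 :=
  (T.exists_dual x k).choose_spec.2.1

theorem dual_X_of_ne {x y : I} {k : ℕ+} {n : ℕ} (h : y ≠ x ∨ n ≠ (k : ℕ)) :
    T.dual x k (S.X y n) = 0 :=
  (T.exists_dual x k).choose_spec.2.2.2 y n h

theorem dual_one (x : I) (k : ℕ+) : T.dual x k 1 = 0 :=
  (T.exists_dual x k).choose_spec.2.2.1 0 k.ne_zero.symm 1 (one_mem_homog K)

/-- The element `f_x(k)` of the basis of the Lie algebra dual to the generators `X_x(k)`. -/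
noncomputable def prim (x : I) (k : ℕ+) : S.lieAlg :=
  S.ofForm (T.dual x k) (T.isInfinitesimal_dual x k)
    ⟨k, fun n hn => (T.exists_dual x k).choose_spec.2.2.1 n hn.ne'⟩

/-- The bracket in the basis dual to the generators is given by the structure coefficients. -/
theorem lie_prim (x y : I) (k l : ℕ+) : ⁅T.prim y k, T.prim x l⁆ =
    (T.κ y * T.P.structCoeff (T.π x) (T.π y) l) • T.prim x (k + l) -
      (T.κ x * T.P.structCoeff (T.π y) (T.π x) k) • T.prim y (k + l) := by
  have key : ∀ (x y : I) (k l : ℕ+) p n,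
      T.dual x l (formDer (T.isInfinitesimal_dual y k) (S.X p n)) =
        (T.κ y * T.P.structCoeff (T.π x) (T.π y) l) * T.dual x (k + l) (S.X p n) := by
    intro x y k l p n
    rw [T.formDer_X (T.isInfinitesimal_dual y k) k.ne_zero (T.dual_X_self y k)
      (fun _ _ h => T.dual_X_of_ne h), map_add, map_smul, T.dual_one, smul_zero, zero_add, one_mul]
    by_cases h : p = x ∧ n = ((k + l : ℕ+) : ℕ)
    · obtain ⟨rfl, rfl⟩ := h
      have hl := l.pos
      have e : ((k + l : ℕ+) : ℕ) - k = l := by rw [PNat.add_coe]; omega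
      rw [T.dual_X_self, if_pos (by rw [PNat.add_coe]; omega), e, map_smul, T.dual_X_self,
        smul_eq_mul]
    · rw [T.dual_X_of_ne (not_and_or.1 h), mul_zero]
      split_ifs with hkn
      · rw [map_smul, T.dual_X_of_ne, smul_zero]
        rw [not_and_or] at h
        refine h.imp_right fun h1 h2 => h1 ?_
        rw [PNat.add_coe]; omega
      · exact map_zero _
  refine S.lieAlg_ext fun p n => ?_
  refine (S.lie_ofForm_apply _ _ _ _ p n).trans ?_
  rw [key, key, add_comm l k]
  rfl

open Classical in
theorem coord_prim (x y : I) (n k : ℕ+) :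
    S.coord y n (T.prim x k) = if y = x ∧ n = k then 1 else 0 := by
  change T.dual x k (S.X y n) = _
  split_ifs with h
  · obtain ⟨rfl, rfl⟩ := h; exact T.dual_X_self _ _
  · rw [not_and_or] at h
    exact T.dual_X_of_ne (h.imp_right fun h1 h2 => h1 (PNat.coe_injective h2))

theorem coord_sum_prim (v : I → ℕ+ →₀ K) (y : I) (n : ℕ+) :
    S.coord y n (∑ x, Finsupp.linearCombination K (T.prim x) (v x)) = v y n := by
  classical
  rw [map_sum, Finset.sum_eq_single y]
  · rw [Finsupp.linearCombination_apply, Finsupp.sum, map_sum]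
    simp only [map_smul, T.coord_prim, true_and, smul_eq_mul, mul_ite, mul_one, mul_zero]
    rw [Finset.sum_ite_eq]
    split_ifs with hn
    · rfl
    · exact (Finsupp.notMem_support_iff.1 hn).symm
  · intro x _ hx
    rw [Finsupp.linearCombination_apply, Finsupp.sum, map_sum]
    refine Finset.sum_eq_zero fun k _ => ?_
    rw [map_smul, T.coord_prim, if_neg fun h => hx h.1.symm, smul_zero]
  · simp

theorem exists_eq_sum_prim (f : S.lieAlg) :
    ∃ v : I → ℕ+ →₀ K, f = ∑ x, Finsupp.linearCombination K (T.prim x) (v x) := by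
  obtain ⟨N, hN⟩ := f.2.2
  have hfin : ∀ x, {n : ℕ+ | f.1.ofConv (S.gen x n) ≠ 0}.Finite := by
    intro x
    refine ((Set.finite_le_nat N).preimage PNat.coe_injective.injOn).subset fun n hn => ?_
    by_contra h
    exact hn (hN n (not_le.1 h) _ (S.isSolution_X.homog x n))
  refine ⟨fun x => Finsupp.ofSupportFinite (fun n => f.1.ofConv (S.gen x n)) (hfin x),
    S.lieAlg_ext fun y n => ?_⟩
  obtain rfl | hn := Nat.eq_zero_or_pos n
  · rw [S.gen_zero, map_zero, map_zero]
  · lift n to ℕ+ using hn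
    refine Eq.trans ?_ (T.coord_sum_prim _ y n).symm
    rfl

theorem eq_top_of_prim_mem {U : Submodule K S.lieAlg} (h : ∀ x k, T.prim x k ∈ U) : U = ⊤ := by
  rw [eq_top_iff]
  rintro f -
  obtain ⟨v, rfl⟩ := T.exists_eq_sum_prim f
  refine sum_mem fun x _ => ?_
  rw [Finsupp.linearCombination_apply]
  exact sum_mem fun k _ => U.smul_mem _ (h x k)

/-- The system is abelian as soon as all the slopes vanish. -/
theorem isAbelian_of_slope_eq_zero (h : ∀ v, T.P.slope v = 0) : S.IsAbelian := by
  intro i j b ⟨a, n₀, hb⟩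
  have hz : ∀ x n, (x ≠ j ∨ n ≠ 1) →
      MvPolynomial.lcoeff K (Finsupp.single (RTree.node j 0) 1) (S.X x n) = 0 := by
    rintro x n (h | h)
    · exact S.coeff_X_of_root_ne h.symm
    · by_contra hc
      have hw := S.isSolution_X.homog x n hc
      rw [Finsupp.weight_single, RTree.weight_node] at hw
      simp at hw
      exact h hw.symm
  have hdot : ∀ n, 1 ≤ n → ∀ c, S.IsStructCoeff i j n c →
      c = dotForm K j (S.X j 1) * (T.κ j * T.P.structCoeff (T.π i) (T.π j) n) := by
    intro n hn c hc
    have hform := T.formDer_X (isInfinitesimal_lcoeff (K := K) (RTree.node j 0)) (j := j) (k := 1)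
      one_ne_zero rfl ?_ i (n + 1)
    · rw [formDer_apply] at hform
      unfold SDSE.IsStructCoeff at hc
      have h2 : (TensorProduct.lid K (TreeAlg K I)) (LinearMap.rTensor (TreeAlg K I) (dotForm K j)
        (comulHom K I (S.X i (n + 1)))) = _ := hform
      rw [hc, if_pos (by omega), Nat.add_sub_cancel] at h2
      rw [hz i (n + 1) (Or.inr (by omega)), zero_smul, zero_add] at h2
      obtain ⟨m, rfl⟩ := Nat.exists_eq_succ_of_ne_zero (by omega : n ≠ 0)
      exact smul_left_injective K (T.X_ne_zero m i) h2
    · exact hz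
  -- without slopes the coefficients `λ_n` are constant for `n ≥ 3`
  have hconst : ∀ n m, 3 ≤ n → 3 ≤ m → T.P.structCoeff (T.π i) (T.π j) n =
      T.P.structCoeff (T.π i) (T.π j) m := by
    intro n m hn hm
    simp only [FundData.structCoeff, h, show n ≠ 1 by omega, show m ≠ 1 by omega, zero_mul, if_false,
      and_false]
  have h1 := hdot (n₀ + 3) (by omega) _ (hb (n₀ + 3) (by omega) (by omega))
  have h2 := hdot (n₀ + 4) (by omega) _ (hb (n₀ + 4) (by omega) (by omega))
  rw [hconst (n₀ + 4) (n₀ + 3) (by omega) (by omega), ← h1] at h2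
  push_cast at h2
  linear_combination h2

end FundPres

end Basis

end DualBasis

/-! ### Morphisms from the iterated semi-direct products -/

section LieHoms

open Finsupp (linearCombination)

variable {K : Type u} [Field K] {𝔤 : Type*} [LieRing 𝔤] [LieAlgebra K 𝔤]

theorem lie_linearCombination_shift {a b z : ℕ+ → 𝔤} {c : ℕ+ → ℕ+ → K}
    (h : ∀ k l, ⁅a k, b l⁆ = c k l • z (k + l)) (v w : ℕ+ →₀ K) :
    ⁅linearCombination K a v, linearCombination K b w⁆ = linearCombination K z (shift c v w) := by
  induction v using Finsupp.induction_linear with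
  | zero => simp
  | add v v' hv hv' => simp only [map_add, add_lie, LinearMap.add_apply, hv, hv']
  | single k α =>
    induction w using Finsupp.induction_linear with
    | zero => simp
    | add w w' hw hw' => simp only [map_add, lie_add, hw, hw']
    | single l β =>
      simp only [shift_single, Finsupp.linearCombination_single, smul_lie, lie_smul, h, smul_smul]
      congr 1
      ring

theorem lie_linearCombination_eq_zero {a b : ℕ+ → 𝔤} (h : ∀ k l, ⁅a k, b l⁆ = 0)
    (v w : ℕ+ →₀ K) : ⁅linearCombination K a v, linearCombination K b w⁆ = 0 := by
  rw [lie_linearCombination_shift (c := fun _ _ => (0 : K)) (z := a)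
    (fun k l => by rw [h, zero_smul])]
  have : shift (fun _ _ => (0 : K)) = 0 := by
    ext k l : 4
    simp [shift_single]
  rw [this]
  simp

/-- A morphism from a semi-direct product, given by its restrictions to the two factors. -/
def Rep.semiDirectHom {L : Type*} [LieRing L] [LieAlgebra K L] {V : Type*} [AddCommGroup V]
    [Module K V] (ρ : Rep K L V) (φ : L →ₗ⁅K⁆ 𝔤) (ψ : V →ₗ[K] 𝔤) (h0 : ∀ v w, ⁅ψ v, ψ w⁆ = 0)
    (h : ∀ x v, ⁅φ x, ψ v⁆ = ψ (ρ.act x v)) : ρ.SemiDirect →ₗ⁅K⁆ 𝔤 where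
  toFun z := ψ z.left + φ z.right
  map_add' := by
    rintro ⟨v, x⟩ ⟨v', x'⟩
    revert v v'
    change ∀ v v' : V, ψ (v + v') + φ (x + x') = ψ v + φ x + (ψ v' + φ x')
    intro v v'
    rw [map_add, map_add]; abel
  map_smul' := by
    rintro t ⟨v, x⟩
    revert v
    change ∀ v : V, ψ (t • v) + φ (t • x) = t • (ψ v + φ x)
    intro v
    rw [map_smul, map_smul, smul_add]
  map_lie' := by
    rintro ⟨v, x⟩ ⟨v', x'⟩
    revert v v'
    change ∀ v v' : V, ψ (0 + ρ.act x v' - ρ.act x' v) + φ ⁅x, x'⁆ = ⁅ψ v + φ x, ψ v' + φ x'⁆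
    intro v v'
    rw [add_lie, lie_add, lie_add, h0, h, ← lie_skew (ψ v) (φ x'), h, zero_add, map_sub,
      LieHom.map_lie]
    abel

/-- The linear map `v ↦ ∑ i k, v_i(k) b_i(k)`. -/
noncomputable def sumComb {n : ℕ} (b : Fin n → ℕ+ → 𝔤) : (Fin n → (ℕ+ →₀ K)) →ₗ[K] 𝔤 :=
  ∑ i, linearCombination K (b i) ∘ₗ LinearMap.proj i

theorem sumComb_apply {n : ℕ} (b : Fin n → ℕ+ → 𝔤) (v : Fin n → (ℕ+ →₀ K)) :
    sumComb b v = ∑ i, linearCombination K (b i) (v i) := by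
  simp [sumComb]

theorem lie_sumComb_eq_zero {n m : ℕ} {b : Fin n → ℕ+ → 𝔤} {b' : Fin m → ℕ+ → 𝔤}
    (h : ∀ i j k l, ⁅b i k, b' j l⁆ = 0) (v : Fin n → (ℕ+ →₀ K)) (w : Fin m → (ℕ+ →₀ K)) :
    ⁅sumComb b v, sumComb b' w⁆ = 0 := by
  rw [sumComb_apply, sumComb_apply, sum_lie]
  refine Finset.sum_eq_zero fun i _ => ?_
  rw [lie_sum]
  exact Finset.sum_eq_zero fun j _ => lie_linearCombination_eq_zero (h i j) _ _

theorem lie_sumComb {n : ℕ} {L : Type*} [LieRing L] [LieAlgebra K L]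
    {ρ : Fin n → Rep K L (ℕ+ →₀ K)} {b : Fin n → ℕ+ → 𝔤} {φ : L →ₗ⁅K⁆ 𝔤}
    (h : ∀ i x v, ⁅φ x, linearCombination K (b i) v⁆ = linearCombination K (b i) ((ρ i).act x v))
    (x : L) (v : Fin n → (ℕ+ →₀ K)) : ⁅φ x, sumComb b v⁆ = sumComb b ((Rep.sum ρ).act x v) := by
  rw [sumComb_apply, sumComb_apply, lie_sum]
  exact Finset.sum_congr rfl fun i _ => h i x (v i)

/-- Equivariance for a module over a semi-direct product may be checked on the two factors. -/
theorem lie_extend {n : ℕ} {L : Type*} [LieRing L] [LieAlgebra K L]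
    {ρ : Fin n → Rep K L (ℕ+ →₀ K)} {b : Fin n → ℕ+ → 𝔤} {φ : L →ₗ⁅K⁆ 𝔤}
    {h0 : ∀ v w, ⁅sumComb b v, sumComb b w⁆ = 0}
    {h : ∀ x v, ⁅φ x, sumComb b v⁆ = sumComb b ((Rep.sum ρ).act x v)}
    {σ : Rep K L (ℕ+ →₀ K)} {τ : Fin n → (ℕ+ →₀ K) →ₗ[K] (ℕ+ →₀ K) →ₗ[K] (ℕ+ →₀ K)}
    {h₁ : ∀ i j v v' w, τ i v (τ j v' w) = τ j v' (τ i v w)}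
    {h₂ : ∀ j x v w, τ j ((ρ j).act x v) w = σ.act x (τ j v w) - τ j v (σ.act x w)}
    {z : ℕ+ → 𝔤}
    (hσ : ∀ x w, ⁅φ x, linearCombination K z w⁆ = linearCombination K z (σ.act x w))
    (hτ : ∀ j v w, ⁅linearCombination K (b j) v, linearCombination K z w⁆ =
      linearCombination K z (τ j v w)) (x : (Rep.sum ρ).SemiDirect) (w : ℕ+ →₀ K) :
    ⁅(Rep.sum ρ).semiDirectHom φ (sumComb b) h0 h x, linearCombination K z w⁆ =
      linearCombination K z ((Rep.extend σ τ h₁ h₂).act x w) := by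
  obtain ⟨v, x⟩ := x
  revert v
  change ∀ v : Fin n → (ℕ+ →₀ K), ⁅sumComb b v + φ x, _⁆ =
    linearCombination K z (σ.act x w + ∑ j, τ j (v j) w)
  intro v
  rw [add_lie, hσ, sumComb_apply, sum_lie, map_add, map_sum, add_comm]
  congr 1
  exact Finset.sum_congr rfl fun j _ => hτ j _ w

variable {M N : ℕ} {c : Fin N → K} {υ : Fin N → Fin M → K}

/-- The coefficient of `h(k + l)` in `e(k).h(l)`. -/
noncomputable def TopParam.eCoeff : TopParam c υ → ℕ+ → K
  | .wPrime0 _, l => ((l : ℕ) : K) - 1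
  | .wPrime1 _, l => if l = 1 then 1 else ((l : ℕ) : K) - 1
  | .wSecond c' _ _ _, l => (l : ℕ) + c'

/-- The coefficient of `h(k + l)` in `f^{(i)}(k).h(l)`. -/
noncomputable def TopParam.fCoeff : TopParam c υ → Fin M → ℕ+ → K
  | .wPrime0 ν, i, l => if l = 1 then ν i else 0
  | .wPrime1 ν, i, l => if l = 1 then ν i else 0
  | .wSecond _ ν _ _, i, _ => ν i

/-- The coefficient of `h(k + l)` in `g^{(j)}(k).h(l)`. -/
noncomputable def TopParam.gCoeff : TopParam c υ → Fin N → ℕ+ → K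
  | .wPrime0 _, _, _ => 0
  | .wPrime1 _, _, _ => 0
  | .wSecond _ _ μ _, j, l => if l = 1 then μ j else 0

/-- A morphism from the iterated semi-direct product, given by the images of the basis. -/
theorem exists_lieHom {R : ℕ} (w : Fin R → TopParam c υ) {e : ℕ+ → 𝔤} {f : Fin M → ℕ+ → 𝔤}
    {g : Fin N → ℕ+ → 𝔤} {h : Fin R → ℕ+ → 𝔤}
    (ee : ∀ k l, ⁅e k, e l⁆ = (((l : ℕ) : K) - ((k : ℕ) : K)) • e (k + l))
    (ef : ∀ i k l, ⁅e k, f i l⁆ = ((l : ℕ) : K) • f i (k + l))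
    (ff : ∀ i i' k l, ⁅f i k, f i' l⁆ = 0)
    (eg : ∀ j k l, ⁅e k, g j l⁆ = (((l : ℕ) : K) + c j) • g j (k + l))
    (fg : ∀ i j k l, ⁅f i k, g j l⁆ = υ j i • g j (k + l))
    (gg : ∀ j j' k l, ⁅g j k, g j' l⁆ = 0)
    (eh : ∀ r k l, ⁅e k, h r l⁆ = (w r).eCoeff l • h r (k + l))
    (fh : ∀ i r k l, ⁅f i k, h r l⁆ = (w r).fCoeff i l • h r (k + l))
    (gh : ∀ j r k l, ⁅g j k, h r l⁆ = (w r).gCoeff j l • h r (k + l))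
    (hh : ∀ r r' k l, ⁅h r k, h r' l⁆ = 0) :
    ∃ Θ : L3 w →ₗ⁅K⁆ 𝔤, ∀ z, Θ z = sumComb h z.left + (sumComb g z.right.left +
      (sumComb f z.right.right.left + linearCombination K e (FdB.coord K z.right.right.right))) := by
  let φ0 : FdB K →ₗ⁅K⁆ 𝔤 :=
    { toLinearMap := linearCombination K e ∘ₗ FdB.coord K
      map_lie' := fun {x y} => (lie_linearCombination_shift ee x y).symm }
  -- extend the morphism step by step to the iterated semi-direct products
  let φ1 : L1 K M →ₗ⁅K⁆ 𝔤 := (V0Pow K M).semiDirectHom φ0 (sumComb f) (lie_sumComb_eq_zero ff)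
    (lie_sumComb fun i x v => lie_linearCombination_shift (ef i) x v)
  have h1 : ∀ {α : ℕ+ → K} {φ : Fin M → ℕ+ → K} {hα hφ hφα} {z : ℕ+ → 𝔤},
      (∀ k l, ⁅e k, z l⁆ = α l • z (k + l)) → (∀ i k l, ⁅f i k, z l⁆ = φ i l • z (k + l)) →
        ∀ x v, ⁅φ1 x, linearCombination K z v⁆ =
          linearCombination K z ((rep1 α φ hα hφ hφα).act x v) := by
    intro α φ hα hφ hφα z he hf x v
    have hσ : ∀ (x : FdB K) v, ⁅φ0 x, linearCombination K z v⁆ =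
        linearCombination K z ((fdbRep α hα).act x v) := fun x v =>
      lie_linearCombination_shift (c := fun _ l => α l) he (FdB.coord K x) v
    exact lie_extend hσ
      (fun i v w => lie_linearCombination_shift (hf i) v w) x v
  let φ2 : L2 c υ →ₗ⁅K⁆ 𝔤 := (WSum c υ).semiDirectHom φ1 (sumComb g) (lie_sumComb_eq_zero gg)
    (lie_sumComb fun j x v => h1 (eg j) (fun i k l => fg i j k l) x v)
  have h2 : ∀ r x v, ⁅φ2 x, linearCombination K (h r) v⁆ =
      linearCombination K (h r) ((w r).rep.act x v) := by
    intro r x v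
    have eh := eh r
    have fh := fun i => fh i r
    have gh := fun j => gh j r
    cases hw : w r with
    | wPrime0 ν =>
      simp only [hw] at eh fh gh
      refine lie_extend (h₁ := fun _ _ _ _ _ => rfl) (h₂ := fun _ _ _ _ => by simp)
        (h1 eh fh) (fun j v w => ?_) x v
      exact (lie_linearCombination_eq_zero (fun k l => (gh j k l).trans (zero_smul K _)) v w).trans
        (map_zero _).symm
    | wPrime1 ν =>
      simp only [hw] at eh fh gh
      refine lie_extend (h₁ := fun _ _ _ _ _ => rfl) (h₂ := fun _ _ _ _ => by simp)
        (h1 eh fh) (fun j v w => ?_) x v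
      exact (lie_linearCombination_eq_zero (fun k l => (gh j k l).trans (zero_smul K _)) v w).trans
        (map_zero _).symm
    | wSecond c' ν μ hμ =>
      simp only [hw] at eh fh gh
      exact lie_extend
        (h₁ := fun _ _ v v' w => shift_comm (fun k l m => by simp [pnat_add_ne_one, TopParam.gCoeff])
          v v' w)
        (h₂ := fun j ⟨f, e⟩ v w => wSecond_compat (c' := c') (ν := ν) (hμ j) e f v w)
        (h1 eh fh) (fun j v w => lie_linearCombination_shift (gh j) v w) x v
  exact ⟨(TopSum w).semiDirectHom φ2 (sumComb h) (lie_sumComb_eq_zero hh) (lie_sumComb h2),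
    fun z => rfl⟩

end LieHoms

/-! ### Lie algebras with an adapted basis -/

section Structure

open Finsupp (linearCombination)

theorem exists_fin_enum {I : Type*} [Finite I] (p : I → Prop) :
    ∃ (n : ℕ) (m : Fin n → I), Function.Injective m ∧ ∀ x, p x ↔ ∃ i, m i = x := by
  obtain ⟨n, ⟨e⟩⟩ := Finite.exists_equiv_fin {x // p x}
  refine ⟨n, fun i => (e.symm i).1, Subtype.val_injective.comp e.symm.injective, fun x => ?_⟩
  constructor
  · intro hx
    exact ⟨e ⟨x, hx⟩, by simp⟩
  · rintro ⟨i, rfl⟩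
    exact (e.symm i).2

/-- The relations, up to a common scalar factor in the structure constants, between the elements of
the basis dual to the generators of a fundamental system. The vertex `x₀` belongs to
`I₀ ∪ J₀ ∪ K₀`, and the slope of its class is normalized to `1`. The scalars `s`, `r`, `a`, `b` are
the slopes, the rates and the parameters `a`, `b` of the system divided by the slope of `x₀`, and
`m i j` is the quotient of `a_j^{(i)}` for `i ∈ J₁` and `j ∈ I₁^{(i)}`. -/
structure IsAdapted {K : Type u} [Field K] {V : Type*} [Fintype V] [DecidableEq V]
    (P : FundData K V) {I : Type*} (π : I → V) (x₀ : I) (s r : V → K) (a b m : V → V → K)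
    {𝔤 : Type*} [LieRing 𝔤] [LieAlgebra K 𝔤] (p : I → ℕ+ → 𝔤) : Prop where
  base : π x₀ ∈ P.base
  slope : s (π x₀) = 1
  ν_ne : ∀ w, P.kind w = Kind.J1 → P.ν w ≠ 0
  m_ne : ∀ w u, P.kind w = Kind.J1 → m w u ≠ 0 → P.ν u = 1 ∧ ∀ t ∈ P.base, b w t = a u t
  lie_base : ∀ x y k l, π x ∈ P.base → π y ∈ P.base → ⁅p y k, p x l⁆ =
    (s (π y) * (l : ℕ) - if π x = π y then r (π y) else 0) • p x (k + l) -
      (s (π x) * (k : ℕ) - if π x = π y then r (π x) else 0) • p y (k + l)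
  lie_I1 : ∀ x y k l, P.kind (π x) = Kind.I1 → π y ∈ P.base → ⁅p y k, p x l⁆ =
    (if l = 1 then a (π x) (π y) else s (π y) * ((l : ℕ) - 1) + P.ν (π x) * a (π x) (π y)) •
      p x (k + l)
  lie_J1 : ∀ x y k l, P.kind (π x) = Kind.J1 → π y ∈ P.base → ⁅p y k, p x l⁆ =
    (if l = 1 then (b (π x) (π y) - s (π y)) * (P.ν (π x))⁻¹
      else s (π y) * ((l : ℕ) - 2) + b (π x) (π y)) • p x (k + l)
  lie_I1_J1 : ∀ x y k l, P.kind (π x) = Kind.J1 → P.kind (π y) = Kind.I1 → ⁅p y k, p x l⁆ =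
    (if l = 1 then m (π x) (π y) else 0) • p x (k + l)
  lie_eq_zero : ∀ x y k l, π x ∉ P.base → P.kind (π x) = P.kind (π y) → ⁅p y k, p x l⁆ = 0

namespace IsAdapted

variable {K : Type u} [Field K] {V : Type*} [Fintype V] [DecidableEq V]
    {P : FundData K V} {I : Type*} {π : I → V} {x₀ : I} {s r : V → K} {a b m : V → V → K}
    {𝔤 : Type*} [LieRing 𝔤] [LieAlgebra K 𝔤] {p : I → ℕ+ → 𝔤}
    (A : IsAdapted P π x₀ s r a b m p)

/-- The elements `f(k)` spanning copies of `V₀`. -/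
def fElt (s : V → K) (π : I → V) (p : I → ℕ+ → 𝔤) (x₀ x : I) (k : ℕ+) : 𝔤 :=
  p x k - s (π x) • p x₀ k

/-- The differences of the elements attached to a vertex and to the representative of its class. -/
def dElt (p : I → ℕ+ → 𝔤) (z x : I) (k : ℕ+) : 𝔤 := p x k - p z k

/-- The elements of a family, the first of which is rescaled. -/
def scaleOne (t : K) (q : ℕ+ → 𝔤) (k : ℕ+) : 𝔤 := (if k = 1 then t else 1) • q k

include A

theorem lie_e_e (k l : ℕ+) :
    ⁅p x₀ k, p x₀ l⁆ = (((l : ℕ) : K) - ((k : ℕ) : K)) • p x₀ (k + l) := by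
  rw [A.lie_base _ _ _ _ A.base A.base, A.slope]
  module

theorem lie_e_f {x : I} (hx : π x ∈ P.base) (h : π x ≠ π x₀) (k l : ℕ+) :
    ⁅p x₀ k, fElt s π p x₀ x l⁆ = ((l : ℕ) : K) • fElt s π p x₀ x (k + l) := by
  rw [fElt, fElt, lie_sub, lie_smul, A.lie_e_e, A.lie_base _ _ _ _ hx A.base, A.slope, if_neg h,
    if_neg h]
  module

theorem lie_f_f {x y : I} (hx : π x ∈ P.base) (h : π x ≠ π x₀) (hy : π y ∈ P.base)
    (h' : π y ≠ π x₀) (hxy : π x = π y → x = y) (k l : ℕ+) :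
    ⁅fElt s π p x₀ x k, fElt s π p x₀ y l⁆ = 0 := by
  by_cases e : x = y
  · subst e
    simp only [fElt, lie_sub, sub_lie, lie_smul, smul_lie, A.lie_e_e,
      A.lie_base _ _ _ _ hx A.base, A.lie_base _ _ _ _ A.base hx, A.lie_base _ _ _ _ hx hx, A.slope,
      if_neg h, if_neg h.symm]
    module
  · have e' : π x ≠ π y := fun h => e (hxy h)
    simp only [fElt, lie_sub, sub_lie, lie_smul, smul_lie, A.lie_e_e,
      A.lie_base _ _ _ _ hy A.base, A.lie_base _ _ _ _ A.base hx, A.lie_base _ _ _ _ hy hx, A.slope,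
      if_neg h.symm, if_neg h', if_neg e'.symm]
    module

theorem lie_e_d {x z : I} (hx : π x ∈ P.base) (hz : π z = π x) (k l : ℕ+) :
    ⁅p x₀ k, dElt p z x l⁆ = (((l : ℕ) : K) + if π x = π x₀ then -r (π x₀) else 0) •
      dElt p z x (k + l) := by
  simp only [dElt, lie_sub, A.lie_base _ _ _ _ hx A.base, A.lie_base z _ _ _ (hz ▸ hx) A.base,
    A.slope, hz]
  split_ifs <;> module

theorem lie_f_d {x y z : I} (hx : π x ∈ P.base) (hz : π z = π x) (hy : π y ∈ P.base)
    (h' : π y ≠ π x₀) (k l : ℕ+) :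
    ⁅fElt s π p x₀ y k, dElt p z x l⁆ = (if π x = π x₀ then s (π y) * r (π x₀) else
      if π x = π y then - r (π y) else 0) • dElt p z x (k + l) := by
  rw [fElt, sub_lie, smul_lie, A.lie_e_d hx hz]
  simp only [dElt, lie_sub, A.lie_base _ _ _ _ hx hy, A.lie_base z _ _ _ (hz ▸ hx) hy, hz]
  by_cases h1 : π x = π x₀
  · have h2 : π x ≠ π y := fun e => h' (e ▸ h1)
    simp only [if_pos h1, if_neg h2]
    module
  · simp only [if_neg h1]
    split_ifs <;> module

theorem lie_d_d {x z x' z' : I} (hx : π x ∈ P.base) (hz : π z = π x) (hx' : π x' ∈ P.base)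
    (hz' : π z' = π x') (k l : ℕ+) : ⁅dElt p z x k, dElt p z' x' l⁆ = 0 := by
  simp only [dElt, lie_sub, sub_lie, A.lie_base _ _ _ _ hx' hx, A.lie_base z' _ _ _ (hz' ▸ hx') hx,
    A.lie_base _ z _ _ hx' (hz ▸ hx), A.lie_base z' z _ _ (hz' ▸ hx') (hz ▸ hx), hz, hz']
  split_ifs <;> module

theorem lie_e_I1 {x : I} (hx : P.kind (π x) = Kind.I1) (k l : ℕ+) :
    ⁅p x₀ k, scaleOne (P.ν (π x)) (p x) l⁆ =
      (((l : ℕ) : K) + (P.ν (π x) * a (π x) (π x₀) - 1)) •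
        scaleOne (P.ν (π x)) (p x) (k + l) := by
  simp only [scaleOne, lie_smul, A.lie_I1 _ _ _ _ hx A.base, A.slope, if_neg (pnat_add_ne_one k l)]
  split_ifs with h
  · subst h; simp only [PNat.one_coe, Nat.cast_one]; module
  · module

theorem lie_f_I1 {x y : I} (hx : P.kind (π x) = Kind.I1) (hy : π y ∈ P.base) (k l : ℕ+) :
    ⁅fElt s π p x₀ y k, scaleOne (P.ν (π x)) (p x) l⁆ =
      (P.ν (π x) * (a (π x) (π y) - s (π y) * a (π x) (π x₀))) •
        scaleOne (P.ν (π x)) (p x) (k + l) := by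
  rw [fElt, sub_lie, smul_lie, A.lie_e_I1 hx]
  simp only [scaleOne, lie_smul, A.lie_I1 _ _ _ _ hx hy, if_neg (pnat_add_ne_one k l)]
  split_ifs with h
  · subst h; simp only [PNat.one_coe, Nat.cast_one]; module
  · module

theorem lie_d_of_notMem {x y z : I} (hx : π x ∉ P.base) (hy : π y ∈ P.base) (hz : π z = π y)
    (t : K) (k l : ℕ+) : ⁅dElt p z y k, scaleOne t (p x) l⁆ = 0 := by
  rcases FundData.kind_cases (P := P) (π x) with h | h | h
  · exact absurd h hx
  · simp only [dElt, scaleOne, lie_smul, sub_lie, A.lie_I1 _ _ _ _ h hy,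
      A.lie_I1 _ z _ _ h (hz ▸ hy), hz, sub_self, smul_zero]
  · simp only [dElt, scaleOne, lie_smul, sub_lie, A.lie_J1 _ _ _ _ h hy,
      A.lie_J1 _ z _ _ h (hz ▸ hy), hz, sub_self, smul_zero]

theorem lie_e_I1_of_eq_zero {x : I} (hx : P.kind (π x) = Kind.I1) (hν : P.ν (π x) = 0) (t : K)
    (k l : ℕ+) : ⁅p x₀ k, scaleOne t (p x) l⁆ =
      (if l = 1 then t * a (π x) (π x₀) else ((l : ℕ) : K) - 1) • scaleOne t (p x) (k + l) := by
  simp only [scaleOne, lie_smul, A.lie_I1 _ _ _ _ hx A.base, A.slope, hν,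
    if_neg (pnat_add_ne_one k l)]
  split_ifs <;> module

theorem lie_f_I1_of_eq_zero {x y : I} (hx : P.kind (π x) = Kind.I1) (hν : P.ν (π x) = 0)
    (hy : π y ∈ P.base) (t : K) (k l : ℕ+) : ⁅fElt s π p x₀ y k, scaleOne t (p x) l⁆ =
      (if l = 1 then t * (a (π x) (π y) - s (π y) * a (π x) (π x₀)) else 0) •
        scaleOne t (p x) (k + l) := by
  rw [fElt, sub_lie, smul_lie, A.lie_e_I1_of_eq_zero hx hν]
  simp only [scaleOne, lie_smul, A.lie_I1 _ _ _ _ hx hy, hν, if_neg (pnat_add_ne_one k l)]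
  split_ifs <;> module

theorem lie_e_J1 {x : I} (hx : P.kind (π x) = Kind.J1) (k l : ℕ+) :
    ⁅p x₀ k, scaleOne (P.ν (π x)) (p x) l⁆ = (((l : ℕ) : K) + (b (π x) (π x₀) - 2)) •
        scaleOne (P.ν (π x)) (p x) (k + l) := by
  have hν := mul_inv_cancel₀ (A.ν_ne _ hx)
  simp only [scaleOne, lie_smul, A.lie_J1 _ _ _ _ hx A.base, A.slope,
    if_neg (pnat_add_ne_one k l)]
  split_ifs with h
  · subst h
    rw [smul_smul, mul_left_comm, hν]
    simp only [PNat.one_coe, Nat.cast_one]; module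
  · module

theorem lie_f_J1 {x y : I} (hx : P.kind (π x) = Kind.J1) (hy : π y ∈ P.base) (k l : ℕ+) :
    ⁅fElt s π p x₀ y k, scaleOne (P.ν (π x)) (p x) l⁆ =
      (b (π x) (π y) - s (π y) * b (π x) (π x₀)) • scaleOne (P.ν (π x)) (p x) (k + l) := by
  have hν := mul_inv_cancel₀ (A.ν_ne _ hx)
  rw [fElt, sub_lie, smul_lie, A.lie_e_J1 hx]
  simp only [scaleOne, lie_smul, A.lie_J1 _ _ _ _ hx hy, if_neg (pnat_add_ne_one k l)]
  split_ifs with h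
  · subst h
    rw [smul_smul, mul_left_comm, hν]
    simp only [PNat.one_coe, Nat.cast_one]; module
  · module

theorem lie_I1_I1 {x y : I} (hx : P.kind (π x) = Kind.I1) (hy : P.kind (π y) = Kind.I1)
    (t t' : K) (k l : ℕ+) : ⁅scaleOne t (p y) k, scaleOne t' (p x) l⁆ = 0 := by
  rw [scaleOne, scaleOne, lie_smul, smul_lie,
    A.lie_eq_zero _ _ _ _ (P.notMem_base_of_I1 hx) (hx.trans hy.symm), smul_zero, smul_zero]

theorem lie_J1_J1 {x y : I} (hx : P.kind (π x) = Kind.J1) (hy : P.kind (π y) = Kind.J1)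
    (t t' : K) (k l : ℕ+) : ⁅scaleOne t (p y) k, scaleOne t' (p x) l⁆ = 0 := by
  rw [scaleOne, scaleOne, lie_smul, smul_lie,
    A.lie_eq_zero _ _ _ _ (P.notMem_base_of_J1 hx) (hx.trans hy.symm), smul_zero, smul_zero]

theorem lie_scale_I1_J1 {x y : I} (hx : P.kind (π x) = Kind.J1) (hy : P.kind (π y) = Kind.I1)
    (t : K) (k l : ℕ+) : ⁅scaleOne (P.ν (π y)) (p y) k, scaleOne t (p x) l⁆ =
      (if l = 1 then t * m (π x) (π y) else 0) • scaleOne t (p x) (k + l) := by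
  simp only [scaleOne, lie_smul, smul_lie, A.lie_I1_J1 _ _ _ _ hx hy, if_neg (pnat_add_ne_one k l)]
  by_cases hm : m (π x) (π y) = 0
  · simp [hm]
  · rw [(A.m_ne _ _ hx hm).1]
    split_ifs <;> module

end IsAdapted

end Structure

/-! ### Triangular families -/

section Triangular

open Finsupp (linearCombination)

variable {K : Type u} [Field K] {𝔤 : Type*} [LieRing 𝔤] [LieAlgebra K 𝔤]

theorem apply_linearCombination {q : ℕ+ → 𝔤} {φ : 𝔤 →ₗ[K] K} {n : ℕ+} {d : K}
    (h : ∀ k, φ (q k) = if n = k then d else 0) (v : ℕ+ →₀ K) :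
    φ (linearCombination K q v) = d * v n := by
  rw [Finsupp.linearCombination_apply, map_finsuppSum]
  simp only [map_smul, h, smul_eq_mul, mul_ite, mul_zero, Finsupp.sum_ite_eq]
  split_ifs with h0
  · exact mul_comm _ _
  · rw [Finsupp.notMem_support_iff.1 h0, mul_zero]

theorem apply_sumComb {m : ℕ} {q : Fin m → ℕ+ → 𝔤} {φ : 𝔤 →ₗ[K] K} {n : ℕ+} {i : Fin m} {d : K}
    (h : ∀ j k, φ (q j k) = if j = i ∧ n = k then d else 0) (v : Fin m → (ℕ+ →₀ K)) :
    φ (sumComb q v) = d * v i n := by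
  rw [sumComb_apply, map_sum, Finset.sum_eq_single i]
  · exact apply_linearCombination (fun k => by simp [h]) _
  · intro j _ hj
    rw [apply_linearCombination (d := 0) (n := n) (fun k => by simp [h, hj]), zero_mul]
  · simp

theorem apply_sumComb_eq_zero {m : ℕ} {q : Fin m → ℕ+ → 𝔤} {φ : 𝔤 →ₗ[K] K}
    (h : ∀ j k, φ (q j k) = 0) (v : Fin m → (ℕ+ →₀ K)) : φ (sumComb q v) = 0 := by
  rw [sumComb_apply, map_sum]
  refine Finset.sum_eq_zero fun j _ => ?_
  rw [apply_linearCombination (d := 0) (n := 1) (fun k => by simp [h]), zero_mul]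

theorem mem_range_sumComb {m : ℕ} (q : Fin m → ℕ+ → 𝔤) (j : Fin m) (k : ℕ+) :
    q j k ∈ LinearMap.range (sumComb (K := K) q) := by
  refine ⟨Pi.single j (Finsupp.single k 1), ?_⟩
  rw [sumComb_apply, Finset.sum_eq_single j]
  · simp
  · intro i _ hi; simp [hi]
  · simp

variable {I : Type*} {p : I → ℕ+ → 𝔤} {C : I → ℕ+ → 𝔤 →ₗ[K] K} {M N R : ℕ} {x₀ : I}
  {mf : Fin M → I} {mg : Fin N → I} {mh : Fin R → I} {zg : Fin N → I} {sf : Fin M → K}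
  {dg : Fin N → ℕ+ → K} {εg : Fin N → K} {dh : Fin R → ℕ+ → K}
  {f : Fin M → ℕ+ → 𝔤} {g : Fin N → ℕ+ → 𝔤} {h : Fin R → ℕ+ → 𝔤}

open Classical in
/-- A family which is triangular with respect to a linearly independent one (witnessed by the
coordinate forms `C`) is linearly independent. -/
theorem triangular_eq_zero
    (hC : ∀ x y n k, C x n (p y k) = if x = y ∧ n = k then 1 else 0)
    (hf : ∀ i k, f i k = p (mf i) k - sf i • p x₀ k)
    (hg : ∀ j k, g j k = dg j k • p (mg j) k - εg j • p (zg j) k)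
    (hh : ∀ r k, h r k = dh r k • p (mh r) k)
    (hdg : ∀ j k, dg j k ≠ 0) (hdh : ∀ r k, dh r k ≠ 0)
    (imf : Function.Injective mf) (img : Function.Injective mg) (imh : Function.Injective mh)
    (f0 : ∀ i, mf i ≠ x₀) (g0 : ∀ j, mg j ≠ x₀) (gf : ∀ j i, mg j ≠ mf i)
    (h0 : ∀ r, mh r ≠ x₀) (hf' : ∀ r i, mh r ≠ mf i) (hg' : ∀ r j, mh r ≠ mg j)
    (hz : ∀ j, zg j = x₀ ∨ ∃ i, mf i = zg j)
    {H : Fin R → (ℕ+ →₀ K)} {G : Fin N → (ℕ+ →₀ K)} {F : Fin M → (ℕ+ →₀ K)} {E : ℕ+ →₀ K}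
    (hzero : sumComb h H + (sumComb g G + (sumComb f F + linearCombination K (p x₀) E)) = 0) :
    H = 0 ∧ G = 0 ∧ F = 0 ∧ E = 0 := by
  have gz : ∀ j j', mg j ≠ zg j' := fun j j' e => by
    rcases hz j' with h | ⟨i, h⟩
    exacts [g0 j (e.trans h), gf j i (e.trans h.symm)]
  have hz' : ∀ r j', mh r ≠ zg j' := fun r j' e => by
    rcases hz j' with h | ⟨i, h⟩
    exacts [h0 r (e.trans h), hf' r i (e.trans h.symm)]
  have hE : ∀ x n, x ≠ x₀ → C x n (linearCombination K (p x₀) E) = 0 := fun x n hx => by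
    rw [apply_linearCombination (d := 0) (n := 1) (fun k => by simp [hC, hx]), zero_mul]
  have hH : H = 0 := by
    funext r
    ext n
    have := congrArg (C (mh r) n) hzero
    rw [map_zero, map_add, map_add, map_add, hE _ _ (h0 r),
      apply_sumComb_eq_zero (q := f) (fun i k => by simp [hf, hC, hf', h0]),
      apply_sumComb_eq_zero (q := g) (fun i k => by simp [hg, hC, hg', hz']),
      apply_sumComb (i := r) (d := dh r n) (n := n), add_zero, add_zero, add_zero] at this
    · exact (mul_eq_zero.1 this).resolve_left (hdh r n)
    · intro j k
      rw [hh, map_smul, hC, imh.eq_iff, eq_comm (a := r)]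
      split_ifs with e
      · rw [e.1, e.2, smul_eq_mul, mul_one]
      · rw [smul_zero]
  have hG : G = 0 := by
    funext r
    ext n
    have := congrArg (C (mg r) n) hzero
    rw [hH, map_zero, map_zero, zero_add, map_add, map_add, hE _ _ (g0 r),
      apply_sumComb_eq_zero (q := f) (fun i k => by simp [hf, hC, gf, g0]),
      apply_sumComb (i := r) (d := dg r n) (n := n), add_zero, add_zero] at this
    · exact (mul_eq_zero.1 this).resolve_left (hdg r n)
    · intro j k
      rw [hg, map_sub, map_smul, map_smul, hC, hC,
        if_neg (fun e => gz r j e.1 : ¬ (mg r = zg j ∧ n = k)), img.eq_iff,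
        eq_comm (a := r), smul_zero, sub_zero]
      split_ifs with e
      · rw [e.1, e.2, smul_eq_mul, mul_one]
      · rw [smul_zero]
  have hF : F = 0 := by
    funext r
    ext n
    have := congrArg (C (mf r) n) hzero
    rw [hH, hG, map_zero, map_zero, zero_add, zero_add, map_zero, map_add, hE _ _ (f0 r),
      apply_sumComb (i := r) (d := 1) (n := n), add_zero, one_mul] at this
    · exact this
    · intro j k
      rw [hf, map_sub, map_smul, hC, hC,
        if_neg (fun e => f0 r e.1 : ¬ (mf r = x₀ ∧ n = k)), imf.eq_iff,
        eq_comm (a := r), smul_zero, sub_zero]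
      split_ifs <;> rfl
  refine ⟨hH, hG, hF, ?_⟩
  ext n
  have := congrArg (C x₀ n) hzero
  rw [hH, hG, hF, map_zero, map_zero, map_zero, zero_add, zero_add, zero_add, map_zero,
    apply_linearCombination (d := 1) (n := n) (fun k => by simp [hC]), one_mul] at this
  exact this

/-- A family which is triangular with respect to a spanning one is spanning. -/
theorem exists_triangular
    (hspan : ∀ U : Submodule K 𝔤, (∀ x k, p x k ∈ U) → U = ⊤)
    (hf : ∀ i k, f i k = p (mf i) k - sf i • p x₀ k)
    (hg : ∀ j k, g j k = dg j k • p (mg j) k - εg j • p (zg j) k)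
    (hh : ∀ r k, h r k = dh r k • p (mh r) k)
    (hdg : ∀ j k, dg j k ≠ 0) (hdh : ∀ r k, dh r k ≠ 0)
    (hz : ∀ j, zg j = x₀ ∨ ∃ i, mf i = zg j)
    (hx : ∀ x, x = x₀ ∨ (∃ i, mf i = x) ∨ (∃ j, mg j = x) ∨ ∃ r, mh r = x) (z : 𝔤) :
    ∃ (H : Fin R → (ℕ+ →₀ K)) (G : Fin N → (ℕ+ →₀ K)) (F : Fin M → (ℕ+ →₀ K)) (E : ℕ+ →₀ K),
      sumComb h H + (sumComb g G + (sumComb f F + linearCombination K (p x₀) E)) = z := by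
  let U : Submodule K 𝔤 := LinearMap.range (sumComb (K := K) h) ⊔
    (LinearMap.range (sumComb (K := K) g) ⊔ (LinearMap.range (sumComb (K := K) f) ⊔
      LinearMap.range (linearCombination K (p x₀))))
  have h0 : ∀ k, p x₀ k ∈ U := fun k => Submodule.mem_sup_right <| Submodule.mem_sup_right <|
    Submodule.mem_sup_right ⟨Finsupp.single k 1, by simp⟩
  have h1 : ∀ i k, p (mf i) k ∈ U := fun i k => by
    rw [eq_add_of_sub_eq (hf i k).symm]
    exact add_mem (Submodule.mem_sup_right <| Submodule.mem_sup_right <|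
      Submodule.mem_sup_left <| mem_range_sumComb f i k) (U.smul_mem _ (h0 k))
  have hz' : ∀ j k, p (zg j) k ∈ U := fun j k => by
    rcases hz j with e | ⟨i, e⟩
    · exact e ▸ h0 k
    · exact e ▸ h1 i k
  have hU : U = ⊤ := hspan U fun x k => by
    rcases hx x with rfl | ⟨i, rfl⟩ | ⟨j, rfl⟩ | ⟨r, rfl⟩
    · exact h0 k
    · exact h1 i k
    · rw [← U.smul_mem_iff (hdg j k), eq_add_of_sub_eq (hg j k).symm]
      exact add_mem (Submodule.mem_sup_right <| Submodule.mem_sup_left <| mem_range_sumComb g j k)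
        (U.smul_mem _ (hz' j k))
    · rw [← U.smul_mem_iff (hdh r k), ← hh]
      exact Submodule.mem_sup_left <| mem_range_sumComb h r k
  have hzU : z ∈ U := hU ▸ Submodule.mem_top
  obtain ⟨_, ⟨H, rfl⟩, y, hy, rfl⟩ := Submodule.mem_sup.1 hzU
  obtain ⟨_, ⟨G, rfl⟩, y', hy', rfl⟩ := Submodule.mem_sup.1 hy
  obtain ⟨_, ⟨F, rfl⟩, _, ⟨E, rfl⟩, rfl⟩ := Submodule.mem_sup.1 hy'
  exact ⟨H, G, F, E, rfl⟩

end Triangular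

/-! ### The structure of a Lie algebra with an adapted basis -/

section Structure

open Finsupp (linearCombination)

variable {K : Type u} [Field K] {V : Type*} [Fintype V] [DecidableEq V]
    {P : FundData K V} {I : Type*} {π : I → V} {x₀ : I} {s r : V → K} {a b m : V → V → K}
    {𝔤 : Type*} [LieRing 𝔤] [LieAlgebra K 𝔤] {p : I → ℕ+ → 𝔤}

open Classical in
/-- A Lie algebra with an adapted basis is one of the iterated semi-direct products. Choose in each
class of vertices a representative, which is `x₀` for its own class. The basis of the semi-direct
product consists of
* `e(k) = p_{x₀}(k)`;
* for the other representatives `x` of vertices of `I₀ ∪ J₀ ∪ K₀`, the elements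
  `f(k) = p_x(k) - s_x p_{x₀}(k)`;
* for the vertices of `I₀ ∪ J₀ ∪ K₀` which are not representatives, the differences `g(k)` with the
  representative of the class;
* for the vertices `x` of `I₁` with `ν_x ≠ 0`, the elements `g(k) = p_x(k)`, the first of which is
  multiplied by `ν_x`;
* for the vertices `x` of `I₁` with `ν_x = 0`, which give modules `W'`, and for those of `J₁`, which
  give modules `W''`, the elements `h(k) = p_x(k)`, the first of which is rescaled. -/
theorem IsAdapted.exists_lieEquiv [Finite I] (A : IsAdapted P π x₀ s r a b m p)
    (hπ : Function.Surjective π) {C : I → ℕ+ → 𝔤 →ₗ[K] K}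
    (hC : ∀ x y n k, C x n (p y k) = if x = y ∧ n = k then 1 else 0)
    (hspan : ∀ U : Submodule K 𝔤, (∀ x k, p x k ∈ U) → U = ⊤) :
    ∃ (M N R : ℕ) (c : Fin N → K) (υ : Fin N → Fin M → K) (w : Fin R → TopParam c υ),
      Nonempty (𝔤 ≃ₗ⁅K⁆ L3 w) := by
  -- a representative of each class, the one of the class of `x₀` being `x₀`
  obtain ⟨σ, hσ, hσ₀⟩ : ∃ σ : V → I, (∀ v, π (σ v) = v) ∧ σ (π x₀) = x₀ := by
    obtain ⟨σ, hσ⟩ := hπ.hasRightInverse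
    refine ⟨Function.update σ (π x₀) x₀, fun v => ?_, Function.update_self ..⟩
    by_cases h : v = π x₀
    · subst h; rw [Function.update_self]
    · rw [Function.update_of_ne h, hσ]
  obtain ⟨M, mf, imf, hmf⟩ := exists_fin_enum
    fun x => π x ∈ P.base ∧ σ (π x) = x ∧ x ≠ x₀
  obtain ⟨N, mg, img, hmg⟩ := exists_fin_enum
    fun x => (π x ∈ P.base ∧ σ (π x) ≠ x) ∨ (P.kind (π x) = Kind.I1 ∧ P.ν (π x) ≠ 0)
  obtain ⟨R, mh, imh, hmh⟩ := exists_fin_enum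
    fun x => (P.kind (π x) = Kind.I1 ∧ P.ν (π x) = 0) ∨ P.kind (π x) = Kind.J1
  have kf : ∀ i, π (mf i) ∈ P.base ∧ σ (π (mf i)) = mf i ∧ mf i ≠ x₀ := fun i =>
    (hmf _).2 ⟨i, rfl⟩
  have kg : ∀ j, (π (mg j) ∈ P.base ∧ σ (π (mg j)) ≠ mg j) ∨
      (P.kind (π (mg j)) = Kind.I1 ∧ P.ν (π (mg j)) ≠ 0) := fun j => (hmg _).2 ⟨j, rfl⟩
  have kh : ∀ r, (P.kind (π (mh r)) = Kind.I1 ∧ P.ν (π (mh r)) = 0) ∨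
      P.kind (π (mh r)) = Kind.J1 := fun r => (hmh _).2 ⟨r, rfl⟩
  have kf' : ∀ i, π (mf i) ≠ π x₀ := fun i h => (kf i).2.2 (by rw [← (kf i).2.1, h, hσ₀])
  have kh' : ∀ r, π (mh r) ∉ P.base := fun r => 
    (kh r).elim (fun h => P.notMem_base_of_I1 h.1) P.notMem_base_of_J1
  set f : Fin M → ℕ+ → 𝔤 := fun i => IsAdapted.fElt s π p x₀ (mf i) with f_def
  set g : Fin N → ℕ+ → 𝔤 := fun j => if π (mg j) ∈ P.base then
    IsAdapted.dElt p (σ (π (mg j))) (mg j) else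
      IsAdapted.scaleOne (P.ν (π (mg j))) (p (mg j)) with g_def
  -- the factor by which `p_x(1)` is rescaled; if `x ∈ I₁`, it turns `e(k).h(1)` into `h(k + 1)`
  -- or `0`
  let ρ : I → K := fun x => if P.kind (π x) = Kind.J1 then P.ν (π x) else
    if a (π x) (π x₀) = 0 then 1 else (a (π x) (π x₀))⁻¹
  have ρ_ne : ∀ x, ρ x ≠ 0 := fun x => by
    by_cases h : P.kind (π x) = Kind.J1
    · simpa [ρ, h] using A.ν_ne _ h
    · by_cases h' : a (π x) (π x₀) = 0 <;> simp [ρ, h, h']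
  set h : Fin R → ℕ+ → 𝔤 := fun r => IsAdapted.scaleOne (ρ (mh r)) (p (mh r)) with h_def
  have g_pos : ∀ j, π (mg j) ∈ P.base → g j = IsAdapted.dElt p (σ (π (mg j))) (mg j) :=
    fun j hj => if_pos hj
  have g_neg : ∀ j, π (mg j) ∉ P.base → g j = IsAdapted.scaleOne (P.ν (π (mg j))) (p (mg j)) :=
    fun j hj => if_neg hj
  let c : Fin N → K := fun j => if π (mg j) ∈ P.base then
    (if π (mg j) = π x₀ then - r (π x₀) else 0) else P.ν (π (mg j)) * a (π (mg j)) (π x₀) - 1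
  let υ : Fin N → Fin M → K := fun j i => if π (mg j) ∈ P.base then
      (if π (mg j) = π x₀ then s (π (mf i)) * r (π x₀) else
        if π (mg j) = π (mf i) then - r (π (mf i)) else 0)
    else P.ν (π (mg j)) * (a (π (mg j)) (π (mf i)) - s (π (mf i)) * a (π (mg j)) (π x₀))
  let μ : Fin R → Fin N → K := fun r j => if π (mg j) ∈ P.base then 0 else
    P.ν (π (mh r)) * m (π (mh r)) (π (mg j))
  have hμ : ∀ r, P.kind (π (mh r)) = Kind.J1 → ∀ j, μ r j ≠ 0 →
      b (π (mh r)) (π x₀) - 2 = c j - 1 ∧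
        (fun i => b (π (mh r)) (π (mf i)) - s (π (mf i)) * b (π (mh r)) (π x₀)) = υ j := by
    intro r hr j hj
    by_cases hb : π (mg j) ∈ P.base
    · simp [μ, hb] at hj
    · simp only [μ, hb, if_false] at hj
      obtain ⟨h1, h2⟩ := A.m_ne _ _ hr (right_ne_zero_of_mul hj)
      refine ⟨?_, funext fun i => ?_⟩
      · simp only [c, if_neg hb, h1, h2 _ A.base]; ring
      · simp only [υ, if_neg hb, h1, h2 _ A.base, h2 _ (kf i).1, one_mul]
  let w : Fin R → TopParam c υ := fun r => if hr : P.kind (π (mh r)) = Kind.J1 then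
      TopParam.wSecond (b (π (mh r)) (π x₀) - 2)
        (fun i => b (π (mh r)) (π (mf i)) - s (π (mf i)) * b (π (mh r)) (π x₀)) (μ r) (hμ r hr)
    else if a (π (mh r)) (π x₀) = 0 then TopParam.wPrime0 fun i => a (π (mh r)) (π (mf i))
    else TopParam.wPrime1 fun i => (a (π (mh r)) (π x₀))⁻¹ *
      (a (π (mh r)) (π (mf i)) - s (π (mf i)) * a (π (mh r)) (π x₀))
  have kJ : ∀ r, P.kind (π (mh r)) ≠ Kind.J1 → P.kind (π (mh r)) = Kind.I1 ∧ P.ν (π (mh r)) = 0 :=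
    fun r hr => (kh r).resolve_right hr
  have kI : ∀ j, π (mg j) ∉ P.base → P.kind (π (mg j)) = Kind.I1 ∧ P.ν (π (mg j)) ≠ 0 :=
    fun j hj => (kg j).resolve_left fun h => hj h.1
  have eg : ∀ j k l, ⁅p x₀ k, g j l⁆ = (((l : ℕ) : K) + c j) • g j (k + l) := by
    intro j k l
    by_cases hj : π (mg j) ∈ P.base
    · rw [g_pos j hj, A.lie_e_d hj (hσ _)]
      simp only [c, if_pos hj]
    · rw [g_neg j hj, A.lie_e_I1 (kI j hj).1]
      simp only [c, if_neg hj]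
  have fg : ∀ i j k l, ⁅f i k, g j l⁆ = υ j i • g j (k + l) := by
    intro i j k l
    by_cases hj : π (mg j) ∈ P.base
    · rw [g_pos j hj, A.lie_f_d hj (hσ _) (kf i).1 (kf' i)]
      simp only [υ, if_pos hj]
    · rw [g_neg j hj, A.lie_f_I1 (kI j hj).1 (kf i).1]
      simp only [υ, if_neg hj]
  have gg : ∀ j j' k l, ⁅g j k, g j' l⁆ = 0 := by
    intro j j' k l
    by_cases hj : π (mg j) ∈ P.base <;> by_cases hj' : π (mg j') ∈ P.base
    · rw [g_pos j hj, g_pos j' hj', A.lie_d_d hj (hσ _) hj' (hσ _)]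
    · rw [g_pos j hj, g_neg j' hj', A.lie_d_of_notMem hj' hj (hσ _)]
    · rw [g_neg j hj, g_pos j' hj', ← lie_skew, A.lie_d_of_notMem hj hj' (hσ _), neg_zero]
    · rw [g_neg j hj, g_neg j' hj', A.lie_I1_I1 (kI j' hj').1 (kI j hj).1]
  have eh : ∀ r k l, ⁅p x₀ k, h r l⁆ = (w r).eCoeff l • h r (k + l) := by
    intro r k l
    by_cases hr : P.kind (π (mh r)) = Kind.J1
    · have hw : ρ (mh r) = P.ν (π (mh r)) := if_pos hr
      simp only [h_def, hw, A.lie_e_J1 hr, w, dif_pos hr, TopParam.eCoeff]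
    · obtain ⟨h1, h2⟩ := kJ r hr
      rw [h_def, A.lie_e_I1_of_eq_zero h1 h2]
      by_cases h3 : a (π (mh r)) (π x₀) = 0
      · simp only [ρ, w, dif_neg hr, if_neg hr, h3, if_true, TopParam.eCoeff]
        split_ifs with hl
        · subst hl; simp
        · rfl
      · simp only [ρ, w, dif_neg hr, if_neg hr, if_neg h3, TopParam.eCoeff, inv_mul_cancel₀ h3]
  have fh : ∀ i r k l, ⁅f i k, h r l⁆ = (w r).fCoeff i l • h r (k + l) := by
    intro i r k l
    by_cases hr : P.kind (π (mh r)) = Kind.J1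
    · have hw : ρ (mh r) = P.ν (π (mh r)) := if_pos hr
      simp only [h_def, hw, f_def, A.lie_f_J1 hr (kf i).1, w, dif_pos hr, TopParam.fCoeff]
    · obtain ⟨h1, h2⟩ := kJ r hr
      rw [h_def, f_def, A.lie_f_I1_of_eq_zero h1 h2 (kf i).1]
      by_cases h3 : a (π (mh r)) (π x₀) = 0
      · simp only [ρ, w, dif_neg hr, if_neg hr, h3, if_true, TopParam.fCoeff, mul_zero, sub_zero,
          one_mul]
      · simp only [ρ, w, dif_neg hr, if_neg hr, if_neg h3, TopParam.fCoeff]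
  have gh : ∀ j r k l, ⁅g j k, h r l⁆ = (w r).gCoeff j l • h r (k + l) := by
    intro j r k l
    by_cases hj : π (mg j) ∈ P.base
    · have hw : (w r).gCoeff j l = 0 := by
        by_cases hr : P.kind (π (mh r)) = Kind.J1
        · simp [w, dif_pos hr, TopParam.gCoeff, μ, hj]
        · by_cases h3 : a (π (mh r)) (π x₀) = 0 <;> simp [w, dif_neg hr, h3, TopParam.gCoeff]
      rw [g_pos j hj, h_def, A.lie_d_of_notMem (kh' r) hj (hσ _), hw, zero_smul]
    · by_cases hr : P.kind (π (mh r)) = Kind.J1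
      · have hw : ρ (mh r) = P.ν (π (mh r)) := if_pos hr
        rw [g_neg j hj, h_def, A.lie_scale_I1_J1 hr (kI j hj).1]
        simp only [w, dif_pos hr, TopParam.gCoeff, μ, if_neg hj, hw]
      · have hw : (w r).gCoeff j l = 0 := by
          by_cases h3 : a (π (mh r)) (π x₀) = 0 <;> simp [w, dif_neg hr, h3, TopParam.gCoeff]
        rw [g_neg j hj, h_def, A.lie_I1_I1 (kJ r hr).1 (kI j hj).1, hw, zero_smul]
  -- for `i ∈ J₁`, the vertices `j ∈ I₁` with `a_j^{(i)} ≠ 0` satisfy `ν_j = 1 ≠ 0`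
  have hIJ : ∀ x y, P.kind (π x) = Kind.J1 → P.kind (π y) = Kind.I1 → P.ν (π y) = 0 →
      ∀ (t t' : K) (k l : ℕ+),
        ⁅IsAdapted.scaleOne t (p y) k, IsAdapted.scaleOne t' (p x) l⁆ = 0 := by
    intro x y hx hy hν t t' k l
    have hm : m (π x) (π y) = 0 := by
      by_contra hm
      exact zero_ne_one (hν ▸ (A.m_ne _ _ hx hm).1)
    simp only [IsAdapted.scaleOne, lie_smul, smul_lie, A.lie_I1_J1 _ _ _ _ hx hy, hm, ite_self,
      zero_smul, smul_zero]
  have hh : ∀ r r' k l, ⁅h r k, h r' l⁆ = 0 := by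
    intro r r' k l
    by_cases hr : P.kind (π (mh r)) = Kind.J1 <;> by_cases hr' : P.kind (π (mh r')) = Kind.J1
    · exact A.lie_J1_J1 hr' hr _ _ _ _
    · rw [← lie_skew, h_def, hIJ _ _ hr (kJ r' hr').1 (kJ r' hr').2, neg_zero]
    · exact hIJ _ _ hr' (kJ r hr).1 (kJ r hr).2 _ _ _ _
    · exact A.lie_I1_I1 (kJ r' hr').1 (kJ r hr).1 _ _ _ _
  obtain ⟨Θ, hΘ⟩ := exists_lieHom (c := c) (υ := υ) w A.lie_e_e
    (fun i => A.lie_e_f (kf i).1 (kf' i))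
    (fun i i' => A.lie_f_f (kf i).1 (kf' i) (kf i').1 (kf' i')
      fun e => by rw [← (kf i).2.1, e, (kf i').2.1]) eg fg gg eh fh gh hh
  -- the family `h`, `g`, `f`, `e` is triangular with respect to the basis `p`
  let zg : Fin N → I := fun j => if π (mg j) ∈ P.base then σ (π (mg j)) else x₀
  let εg : Fin N → K := fun j => if π (mg j) ∈ P.base then 1 else 0
  let dg : Fin N → ℕ+ → K := fun j k => if π (mg j) ∈ P.base then 1 else
    if k = 1 then P.ν (π (mg j)) else 1
  let dh : Fin R → ℕ+ → K := fun r k => if k = 1 then ρ (mh r) else 1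
  have hg' : ∀ j k, g j k = dg j k • p (mg j) k - εg j • p (zg j) k := by
    intro j k
    by_cases hj : π (mg j) ∈ P.base
    · simp [g_pos j hj, IsAdapted.dElt, dg, εg, zg, hj]
    · simp [g_neg j hj, IsAdapted.scaleOne, dg, εg, hj]
  have hdg : ∀ j k, dg j k ≠ 0 := by
    intro j k
    by_cases hj : π (mg j) ∈ P.base
    · simp [dg, hj]
    · by_cases hk : k = 1
      · simpa [dg, hj, hk] using (kI j hj).2
      · simp [dg, hj, hk]
  have hdh : ∀ r k, dh r k ≠ 0 := by
    intro r k
    by_cases hk : k = 1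
    · simpa [dh, hk] using ρ_ne _
    · simp [dh, hk]
  have hσf : ∀ v ∈ P.base, σ v = x₀ ∨ ∃ i, mf i = σ v := by
    intro v hv
    by_cases h0 : σ v = x₀
    · exact Or.inl h0
    · exact Or.inr ((hmf _).1 ⟨by rwa [hσ], by rw [hσ], h0⟩)
  have hzg : ∀ j, zg j = x₀ ∨ ∃ i, mf i = zg j := by
    intro j
    by_cases hj : π (mg j) ∈ P.base
    · simpa [zg, hj] using hσf _ hj
    · simp [zg, hj]
  have hgσ : ∀ j v, v ∈ P.base → mg j ≠ σ v := by
    intro j v hv e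
    rcases kg j with h1 | h1
    · exact h1.2 (by rw [e, hσ])
    · exact P.notMem_base_of_I1 h1.1 (by rwa [e, hσ])
  have hx : ∀ x, x = x₀ ∨ (∃ i, mf i = x) ∨ (∃ j, mg j = x) ∨ ∃ r, mh r = x := by
    intro x
    rcases FundData.kind_cases (P := P) (π x) with h1 | h1 | h1
    · by_cases h2 : σ (π x) = x
      · rw [← h2]
        exact (hσf _ h1).imp_right Or.inl
      · exact Or.inr <| Or.inr <| Or.inl <| (hmg x).1 <| Or.inl ⟨h1, h2⟩
    · by_cases h2 : P.ν (π x) = 0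
      · exact Or.inr <| Or.inr <| Or.inr <| (hmh x).1 <| Or.inl ⟨h1, h2⟩
      · exact Or.inr <| Or.inr <| Or.inl <| (hmg x).1 <| Or.inr ⟨h1, h2⟩
    · exact Or.inr <| Or.inr <| Or.inr <| (hmh x).1 <| Or.inr h1
  have inj : Function.Injective Θ := by
    rw [injective_iff_map_eq_zero]
    intro z hz0
    rw [hΘ] at hz0
    obtain ⟨hH, hG, hF, hE⟩ := triangular_eq_zero (sf := fun i => s (π (mf i))) hC
      (fun _ _ => rfl) hg' (fun _ _ => rfl) hdg hdh imf img imh (fun i => (kf i).2.2)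
      (fun j e => hgσ j _ A.base (e.trans hσ₀.symm))
      (fun j i e => hgσ j _ (kf i).1 (e.trans (kf i).2.1.symm))
      (fun r e => kh' r (e ▸ A.base)) (fun r i e => kh' r (e ▸ (kf i).1))
      (fun r j e => by
        rcases kg j with h1 | h1
        · exact kh' r (e ▸ h1.1)
        · rcases kh r with h2 | h2
          · exact h1.2 (e ▸ h2.2)
          · exact absurd (h1.1.symm.trans (e ▸ h2)) (by simp)) hzg hz0
    obtain ⟨H, G, F, E⟩ := z
    change H = 0 at hH
    change G = 0 at hG
    change F = 0 at hF
    change E = 0 at hE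
    subst hH hG hF hE
    rfl
  have surj : Function.Surjective Θ := by
    intro z
    obtain ⟨H, G, F, E, hz⟩ := exists_triangular (h := h) (sf := fun i => s (π (mf i))) hspan
      (fun _ _ => rfl) hg' (fun _ _ => rfl) hdg hdh hzg hx z
    refine ⟨(⟨H, ⟨G, ⟨F, E⟩⟩⟩ : L3 w), ?_⟩
    rw [hΘ]
    exact hz
  exact ⟨M, N, R, c, υ, w, ⟨(LieEquiv.ofBijective Θ ⟨inj, surj⟩).symm⟩⟩

end Structure

/-! ### The Lie algebra of a fundamental system -/

section Adapted

variable {K : Type*} [Field K] [CharZero K] {I : Type*} [Fintype I] {V : Type*}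
  [Fintype V] [DecidableEq V]

namespace FundPres

variable {S : HopfSDSE K I} (T : FundPres S.toSDSE V)

/-- The basis of the Lie algebra, rescaled so as to absorb the change of variables and a common
factor `q` of the structure constants. -/
noncomputable def scaledPrim (q : K) (x : I) (k : ℕ+) : S.lieAlg :=
  ((T.κ x)⁻¹ * q) • T.prim x k

theorem lie_scaledPrim (q : K) (x y : I) (k l : ℕ+) :
    ⁅T.scaledPrim q y k, T.scaledPrim q x l⁆ =
      (q * T.P.structCoeff (T.π x) (T.π y) l) • T.scaledPrim q x (k + l) -
        (q * T.P.structCoeff (T.π y) (T.π x) k) • T.scaledPrim q y (k + l) := by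
  have hx := T.κ_ne x
  have hy := T.κ_ne y
  simp only [scaledPrim, lie_smul, smul_lie, lie_prim, smul_sub, smul_smul]
  congr 2 <;> field_simp

open Classical in
/-- At a vertex `x₀` of nonzero slope, the basis divided by this slope is adapted. -/
theorem isAdapted {x₀ : I} (h : T.P.slope (T.π x₀) ≠ 0) :
    IsAdapted T.P T.π x₀ (fun v => (T.P.slope (T.π x₀))⁻¹ * T.P.slope v)
      (fun v => (T.P.slope (T.π x₀))⁻¹ * T.P.rate v)
      (fun w u => (T.P.slope (T.π x₀))⁻¹ * T.P.a w u)
      (fun w u => (T.P.slope (T.π x₀))⁻¹ * T.P.b w u)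
      (fun w u => if u ∈ T.P.part₁ w then (T.P.slope (T.π x₀))⁻¹ * T.P.a w u else 0)
      (T.scaledPrim (T.P.slope (T.π x₀))⁻¹) := by
  set q := (T.P.slope (T.π x₀))⁻¹
  have hc : ∀ l : ℕ+, (l : ℕ) = 1 ↔ l = 1 := fun l => by
    rw [← PNat.one_coe, PNat.coe_inj]
  have hP : ∀ w u, u ∈ T.P.part₁ w → T.P.kind u = Kind.I1 := fun w u h => (T.P.mem_part₁.1 h).1
  have h0 : ∀ w u n, u ∉ T.P.base → (T.P.kind w = Kind.J1 → T.P.kind u ≠ Kind.I1) →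
      T.P.structCoeff w u n = 0 := fun w u n h1 h2 => by
    rw [FundData.structCoeff, if_neg h1, if_neg fun h => h2 h.1 (hP _ _ h.2.1)]
  refine
    { base := ?_
      slope := inv_mul_cancel₀ h
      ν_ne := fun w hw => T.valid.J1_ν w (T.P.mem_part.2 hw)
      m_ne := ?_
      lie_base := ?_
      lie_I1 := ?_
      lie_J1 := ?_
      lie_I1_J1 := ?_
      lie_eq_zero := ?_ }
  · by_contra h'
    exact h (T.P.slope_of_notMem h')
  · intro w u hw hu
    have hu' : u ∈ T.P.part₁ w := by
      by_contra h'
      exact hu (if_neg h')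
    have hw' := (T.P.mem_part).2 hw
    refine ⟨T.valid.J1_ν_eq w hw' u hu', fun t ht => ?_⟩
    rw [T.valid.J1_b w hw' u hu' t ht]
  · intro x y k l hx hy
    rw [lie_scaledPrim]
    simp only [FundData.structCoeff, if_pos hx, if_pos hy, eq_comm (a := T.π y)]
    congr 2 <;> split_ifs <;> ring
  · intro x y k l hx hy
    rw [lie_scaledPrim, h0 _ _ _ (T.P.notMem_base_of_I1 hx) fun h =>
      absurd hy (T.P.notMem_base_of_J1 h)]
    simp only [FundData.structCoeff, if_neg (T.P.notMem_base_of_I1 hx), if_pos hy, if_pos hx, hc]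
    simp only [mul_zero, zero_smul, sub_zero, mul_ite]
    congr 1
    split_ifs <;> ring
  · intro x y k l hx hy
    rw [lie_scaledPrim, h0 _ _ _ (T.P.notMem_base_of_J1 hx) fun h =>
      absurd hy (T.P.notMem_base_of_J1 h)]
    simp only [FundData.structCoeff, if_neg (T.P.notMem_base_of_J1 hx), if_pos hy, hx, hc]
    simp only [reduceCtorEq, if_false, mul_zero, zero_smul, sub_zero, mul_ite]
    congr 1
    split_ifs <;> ring
  · intro x y k l hx hy
    rw [lie_scaledPrim, h0 _ _ _ (T.P.notMem_base_of_J1 hx) fun h =>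
      absurd (h.symm.trans hy) (by simp)]
    simp only [FundData.structCoeff, if_neg (T.P.notMem_base_of_I1 hy), hx, hc, true_and]
    simp only [mul_zero, zero_smul, sub_zero]
    congr 1
    split_ifs <;> simp_all
  · intro x y k l hx hxy
    have hy : T.π y ∉ T.P.base := by rwa [FundData.mem_base, ← hxy, ← FundData.mem_base]
    rw [lie_scaledPrim, h0 _ _ _ hy fun h h' => by simp [← hxy, h] at h',
      h0 _ _ _ hx fun h h' => by simp [hxy, h] at h']
    simp

end FundPres

end Adapted

end DysonSchwinger

theorem theorem62 {K : Type*} [Field K] [CharZero K] {I : Type*} [Finite I]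
    (S : DysonSchwinger.HopfSDSE K I) (hconn : S.Connected) (hfund : S.IsFundamental)
    (hna : ¬ S.IsAbelian) :
    ∃ (M N R : ℕ) (c : Fin N → K) (υ : Fin N → Fin M → K)
      (w : Fin R → DysonSchwinger.TopParam c υ),
      Nonempty (S.lieAlg ≃ₗ⁅K⁆ DysonSchwinger.L3 w) := by
  classical
  cases nonempty_fintype I
  obtain ⟨n, P, π, κ, μ, hv, hπ, hκ, hμ, hF⟩ := hfund
  let T : DysonSchwinger.FundPres S.toSDSE (Fin n) := ⟨P, π, κ, μ, hv, hπ, hκ, hμ, hF⟩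
  obtain ⟨v, hv⟩ : ∃ v, T.P.slope v ≠ 0 := by
    by_contra! h
    exact hna (T.isAbelian_of_slope_eq_zero h)
  obtain ⟨x₀, rfl⟩ := T.surj v
  set q := (T.P.slope (T.π x₀))⁻¹
  have hq0 : q ≠ 0 := inv_ne_zero hv
  have hne : ∀ x, (T.κ x)⁻¹ * q ≠ 0 := fun x => mul_ne_zero (inv_ne_zero (T.κ_ne x)) hq0
  refine (T.isAdapted hv).exists_lieEquiv T.surj
    (C := fun x n => ((T.κ x)⁻¹ * q)⁻¹ • S.coord x n) (fun x y n k => ?_) fun U hU => ?_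
  · rw [DysonSchwinger.FundPres.scaledPrim, LinearMap.smul_apply, map_smul, T.coord_prim]
    split_ifs with h
    · rw [h.1, smul_smul, inv_mul_cancel₀ (hne y), one_smul]
    · rw [smul_zero, smul_zero]
  · refine T.eq_top_of_prim_mem fun x k => ?_
    exact (U.smul_mem_iff (hne x)).1 (hU x k)
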